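/- Let $f\in C^2(\mathbb R)$ (no assumption on its inflection points). For an open set $\Omega\subset(0,\infty)\times\mathbb R$ and $g_E\in L^\infty(\Omega)$, a continuous distributional solution on $\Omega$ of the balance law $$\partial_t u+\partial_x\big(f(u)\big)=g_E \qquad (1)$$ is a function $u\in C(\Omega)$ with $\iint_\Omega\{\varphi_t\,u+\varphi_x\,f(u)\}\,dt\,dx=-\iint_\Omega\varphi\,g_E\,dt\,dx$ for all $\varphi\in C_c^\infty(\Omega)$. (i) (Entropy equality.) Let $u$ be a continuous distributional solution of (1) on $\Omega$. For every entropy–entropy flux pair, i.e. every $\eta\in C^1(\mathbb R)$ and every $q$ with $q'=\eta' f'$, $$\partial_t\,\eta(u)+\partial_x\,q(u)=\eta'(u)\,g_E\quad\text{in the sense of distributions on }\Omega,$$ and $u$ is Kruzkov iso-entropic: for every $k\in\mathbb R$, with $\operatorname{sgn}0=0$, $$\partial_t|u-k|+\partial_x\big[\operatorname{sgn}(u-k)(f(u)-f(k))\big]=\operatorname{sgn}(u-k)\,g_E\quad\text{in the sense of distributions on }\Omega.$$ (ii) (Uniqueness for the Cauchy problem.) Let $T>0$, $g_E\in L^\infty((0,T)\times\mathbb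 R)$, and let $u$ be a bounded continuous function on $[0,T)\times\mathbb R$ that is a distributional solution of (1) on $(0,T)\times\mathbb R$, with $u(0,\cdot)=u_0$. Call $v\in L^\infty((0,T)\times\mathbb R)$ a Kruzkov entropy solution of the Cauchy problem for (1) with datum $u_0$ if $$\iint_{(0,T)\times\mathbb R}\big\{|v-k|\,\varphi_t+\operatorname{sgn}(v-k)(f(v)-f(k))\,\varphi_x+\operatorname{sgn}(v-k)\,g_E\,\varphi\big\}\,dt\,dx\ \ge\ 0$$ for all $k\in\mathbb R$ and all $0\le\varphi\in C_c^\infty((0,T)\times\mathbb R)$, and there is a Lebesgue-null set $E$ of times such that $v(t,\cdot)\to u_0$ in $L^1([-R,R])$ for every $R>0$ as $t\downarrow0$, $t\notin E$. Then $u$ is a Kruzkov entropy solution of this Cauchy problem; every Kruzkov entropy solution $v$ with the same source $g_E$ and datum $u_0$ equals $u$ almost everywhere on $(0,T)\times\mathbb R$; and every bounded continuous function on $[0,T)\times\mathbb R$ that is a distributional solution of (1) on $(0,T)\times\mathbb R$ with the same $g_E$ and equals $u_0$ at $t=0$ coincides with $u$ on all of $[0,T)\times\mathbb R$. -/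

import Mathlib

open MeasureTheory Set Filter Topology
open scoped ContDiff

/-- Smooth functions of `(t, x)` whose support is a compact subset of `Ω`. -/
structure IsTestFunction (Ω : Set (ℝ × ℝ)) (φ : ℝ × ℝ → ℝ) : Prop where
  smooth : ContDiff ℝ ∞ φ
  compact : HasCompactSupport φ
  support_subset : tsupport φ ⊆ Ω

/-- The partial derivative in the first variable (time). -/
noncomputable def partialT (φ : ℝ × ℝ → ℝ) (p : ℝ × ℝ) : ℝ := fderiv ℝ φ p (1, 0)

/-- The partial derivative in the second variable (space). -/
noncomputable def partialX (φ : ℝ × ℝ → ℝ) (p : ℝ × ℝ) : ℝ := fderiv ℝ φ p (0, 1)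

/-- `∂ₜ A + ∂ₓ B = h` in the sense of distributions on `Ω`
(used only for `A`, `B`, `h` that are locally integrable on `Ω`). -/
def DistribBalance (Ω : Set (ℝ × ℝ)) (A B h : ℝ × ℝ → ℝ) : Prop :=
  ∀ φ : ℝ × ℝ → ℝ, IsTestFunction Ω φ →
    ∫ p in Ω, (partialT φ p * A p + partialX φ p * B p) = - ∫ p in Ω, φ p * h p

/-- `u` is a continuous distributional solution of `∂ₜ u + ∂ₓ f(u) = g` on `Ω`, with `g ∈ L^∞(Ω)`. -/
structure IsContinuousDistribSolution (f : ℝ → ℝ) (g : ℝ × ℝ → ℝ) (Ω : Set (ℝ × ℝ))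
    (u : ℝ × ℝ → ℝ) : Prop where
  source : MemLp g ⊤ (volume.restrict Ω)
  continuousOn : ContinuousOn u Ω
  equation : DistribBalance Ω u (fun p => f (u p)) g

/-- Entropy–entropy flux pairs: `η` is of class `C¹` and `q' = η' f'`. -/
structure IsEntropyPair (f η q : ℝ → ℝ) : Prop where
  contDiff : ContDiff ℝ 1 η
  flux : ∀ z : ℝ, HasDerivAt q (deriv η z * deriv f z) z

/-- The open strip `(0, T) × ℝ`. -/
def strip (T : ℝ) : Set (ℝ × ℝ) := Ioo 0 T ×ˢ univ

/-- The strip `[0, T) × ℝ`, which contains the initial line. -/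
def strip₀ (T : ℝ) : Set (ℝ × ℝ) := Ico 0 T ×ˢ univ

/-- Bounded continuous solutions on `[0, T) × ℝ` of the Cauchy problem
`∂ₜ u + ∂ₓ f(u) = g`, `u(0, ·) = u₀`. -/
structure IsContinuousCauchySolution (f : ℝ → ℝ) (g : ℝ × ℝ → ℝ) (T : ℝ) (u₀ : ℝ → ℝ)
    (u : ℝ × ℝ → ℝ) : Prop where
  solution : IsContinuousDistribSolution f g (strip T) u
  continuousOn : ContinuousOn u (strip₀ T)
  bounded : ∃ M : ℝ, ∀ p ∈ strip₀ T, |u p| ≤ M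
  initial : ∀ x : ℝ, u (0, x) = u₀ x

/-- Kruzkov's (bounded measurable) entropy solutions on `(0, T) × ℝ` of the Cauchy problem
`∂ₜ v + ∂ₓ f(v) = g`, `v(0, ·) = v₀`: the entropy inequality for all entropies `|v - k|`, and
`v(t, ·) → v₀` in `L¹_loc` as `t ↓ 0` outside a negligible set of times. -/
structure IsKruzkovEntropySolution (f : ℝ → ℝ) (g : ℝ × ℝ → ℝ) (T : ℝ) (v₀ : ℝ → ℝ)
    (v : ℝ × ℝ → ℝ) : Prop where
  bounded : MemLp v ⊤ (volume.restrict (strip T))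
  entropy : ∀ (k : ℝ) (φ : ℝ × ℝ → ℝ), IsTestFunction (strip T) φ → (∀ p, 0 ≤ φ p) →
    0 ≤ ∫ p in strip T,
      (partialT φ p * |v p - k|
        + partialX φ p * (Real.sign (v p - k) * (f (v p) - f k))
        + φ p * (Real.sign (v p - k) * g p))
  initial : ∃ E : Set ℝ, volume E = 0 ∧ ∀ R : ℝ,
    Tendsto (fun t : ℝ => ∫⁻ x in Icc (-R) R, ‖v (t, x) - v₀ x‖ₑ) (𝓝[Ioi 0 \ E] 0) (𝓝 0)

/-!
Let `u` be a continuous solution. Multiplying the equation for `w = u - k` by a cutoff function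
gives a balance `∂ₜ w + ∂ₓ B = h` with compact support, in which `B` vanishes wherever `w` does.
Fix `n` and let `F t` be the largest mass that `w (t, ·)` has on a union of `n` intervals. At an
optimal union, endpoints that coincide either occur with cancelling signs or sit at a zero of
`w (t, ·)`, hence of `B (t, ·)`: no flux passes through the endpoints. Keeping the union fixed for a
short time, `F` grows at least at the rate of the source on the union, which for large `n` is
nearly the source on `{w > 0}`. As `F` vanishes for early and for late times, the total source on
`{w > 0}` is at most `0`; the reflection in time and space gives the opposite inequality. This says
that `u` satisfies Kruzkov's equality. Affine entropies and superpositions of Kruzkov's exhaust the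
`C²` ones, and `C¹` entropies are limits of these. Uniqueness is then Kruzkov's doubling of
variables, tested with a cutoff of a backward cone that decays in time.
-/

/-! ### The smooth step -/

/-- A smooth approximation of the indicator function of `(t, ∞)`: it climbs from `0` to `1` on
`[t, t + ε]`. Its derivative is an approximate identity at `t`. -/
noncomputable def smoothStep (ε t s : ℝ) : ℝ := Real.smoothTransition ((s - t) / ε)

section SmoothStep

variable {ε t s : ℝ}

theorem contDiff_smoothStep (ε t : ℝ) : ContDiff ℝ ∞ (smoothStep ε t) :=
  Real.smoothTransition.contDiff.comp (by fun_prop)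

theorem smoothStep_nonneg : 0 ≤ smoothStep ε t s := Real.smoothTransition.nonneg _

theorem smoothStep_le_one : smoothStep ε t s ≤ 1 := Real.smoothTransition.le_one _

theorem abs_smoothStep_le_one : |smoothStep ε t s| ≤ 1 :=
  abs_le.2 ⟨by linarith [smoothStep_nonneg (ε := ε) (t := t) (s := s)], smoothStep_le_one⟩

theorem smoothStep_of_le (hε : 0 ≤ ε) (hs : s ≤ t) : smoothStep ε t s = 0 :=
  Real.smoothTransition.zero_of_nonpos (div_nonpos_of_nonpos_of_nonneg (by linarith) hε)

theorem smoothStep_of_ge (hε : 0 < ε) (hs : t + ε ≤ s) : smoothStep ε t s = 1 :=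
  Real.smoothTransition.one_of_one_le ((one_le_div hε).2 (by linarith))

theorem monotone_smoothStep (hε : 0 ≤ ε) (t : ℝ) : Monotone (smoothStep ε t) := fun _ _ h =>
  Real.smoothTransition.monotone (by gcongr)

theorem tendsto_smoothStep (t s : ℝ) :
    Tendsto (fun ε => smoothStep ε t s) (𝓝[>] 0) (𝓝 ((Ioi t).indicator 1 s)) := by
  refine tendsto_const_nhds.congr' ?_
  rcases le_or_gt s t with h | h
  · filter_upwards [self_mem_nhdsWithin] with ε hε
    rw [smoothStep_of_le (le_of_lt hε) h, indicator_of_notMem (by simpa using h)]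
  · filter_upwards [Ioo_mem_nhdsGT (sub_pos.2 h)] with ε hε
    rw [smoothStep_of_ge hε.1 (by linarith [hε.2]), indicator_of_mem (mem_Ioi.2 h), Pi.one_apply]

theorem hasDerivAt_smoothStep (ε t s : ℝ) :
    HasDerivAt (smoothStep ε t) (deriv (smoothStep ε t) s) s :=
  ((contDiff_smoothStep ε t).differentiable (by simp) s).hasDerivAt

theorem continuous_deriv_smoothStep (ε t : ℝ) : Continuous (deriv (smoothStep ε t)) :=
  (contDiff_smoothStep ε t).continuous_deriv (by simp)

theorem deriv_smoothStep_nonneg (hε : 0 ≤ ε) : 0 ≤ deriv (smoothStep ε t) s :=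
  (monotone_smoothStep hε t).deriv_nonneg

theorem deriv_smoothStep_eq_zero (hε : 0 < ε) (hs : s ∉ Icc t (t + ε)) :
    deriv (smoothStep ε t) s = 0 := by
  have hconst : ∃ c, smoothStep ε t =ᶠ[𝓝 s] fun _ => c := by
    rcases lt_or_ge s t with h | h
    · exact ⟨0, by filter_upwards [Iio_mem_nhds h] with r hr using smoothStep_of_le hε.le hr.le⟩
    · have h' : t + ε < s := not_le.1 fun h' => hs ⟨h, h'⟩
      exact ⟨1, by filter_upwards [Ioi_mem_nhds h'] with r hr using smoothStep_of_ge hε hr.le⟩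
  obtain ⟨c, hc⟩ := hconst
  rw [hc.deriv_eq, deriv_const]

theorem hasCompactSupport_deriv_smoothStep (hε : 0 < ε) (t : ℝ) :
    HasCompactSupport (deriv (smoothStep ε t)) :=
  HasCompactSupport.intro isCompact_Icc fun _ => deriv_smoothStep_eq_zero hε

theorem integrable_deriv_smoothStep (hε : 0 < ε) (t : ℝ) :
    Integrable (deriv (smoothStep ε t)) :=
  (continuous_deriv_smoothStep ε t).integrable_of_hasCompactSupport
    (hasCompactSupport_deriv_smoothStep hε t)

theorem integral_deriv_smoothStep (hε : 0 < ε) (t : ℝ) : ∫ s, deriv (smoothStep ε t) s = 1 := by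
  have hbot : Tendsto (smoothStep ε t) atBot (𝓝 0) := tendsto_const_nhds.congr' <| by
    filter_upwards [eventually_le_atBot t] with s hs using (smoothStep_of_le hε.le hs).symm
  have htop : Tendsto (smoothStep ε t) atTop (𝓝 1) := tendsto_const_nhds.congr' <| by
    filter_upwards [eventually_ge_atTop (t + ε)] with s hs using (smoothStep_of_ge hε hs).symm
  simpa using integral_of_hasDerivAt_of_tendsto (hasDerivAt_smoothStep ε t)
    (integrable_deriv_smoothStep hε t) hbot htop

theorem abs_integral_deriv_smoothStep_mul_le (hε : 0 < ε) {W : ℝ → ℝ} {C : ℝ}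
    (hW : ∀ s ∈ Icc t (t + ε), |W s| ≤ C) : |∫ s, deriv (smoothStep ε t) s * W s| ≤ C := by
  calc |∫ s, deriv (smoothStep ε t) s * W s|
      ≤ ∫ s, deriv (smoothStep ε t) s * C := by
        rw [← Real.norm_eq_abs]
        refine norm_integral_le_of_norm_le ((integrable_deriv_smoothStep hε t).mul_const C)
          (ae_of_all _ fun s => ?_)
        rw [norm_mul, Real.norm_of_nonneg (deriv_smoothStep_nonneg hε.le)]
        by_cases hs : s ∈ Icc t (t + ε)
        · exact mul_le_mul_of_nonneg_left (hW s hs) (deriv_smoothStep_nonneg hε.le)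
        · simp [deriv_smoothStep_eq_zero hε hs]
    _ = C := by rw [integral_mul_const, integral_deriv_smoothStep hε, one_mul]

theorem tendsto_integral_deriv_smoothStep_mul (t : ℝ) {W : ℝ → ℝ} (hW : Continuous W) :
    Tendsto (fun ε => ∫ s, deriv (smoothStep ε t) s * W s) (𝓝[>] 0) (𝓝 (W t)) := by
  rw [Metric.tendsto_nhds]
  intro η hη
  obtain ⟨δ, hδ, hWδ⟩ := Metric.continuous_iff.1 hW t (η / 2) (half_pos hη)
  filter_upwards [Ioo_mem_nhdsGT hδ] with ε hε
  have hint : Integrable fun s => deriv (smoothStep ε t) s * W s :=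
    ((continuous_deriv_smoothStep ε t).mul hW).integrable_of_hasCompactSupport
      (hasCompactSupport_deriv_smoothStep hε.1 t).mul_right
  have hsub : (∫ s, deriv (smoothStep ε t) s * W s) - W t =
      ∫ s, deriv (smoothStep ε t) s * (W s - W t) := by
    simp only [mul_sub]
    rw [integral_sub hint ((integrable_deriv_smoothStep hε.1 t).mul_const _), integral_mul_const,
      integral_deriv_smoothStep hε.1, one_mul]
  rw [Real.dist_eq, hsub]
  refine (abs_integral_deriv_smoothStep_mul_le hε.1 fun s hs => ?_).trans_lt (half_lt_self hη)
  refine (hWδ s ?_).le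
  rw [Real.dist_eq, abs_lt]
  constructor <;> linarith [hs.1, hs.2, hε.2]

end SmoothStep

/-! ### Integrals -/

theorem integral_indicator_one_mul {α : Type*} [MeasurableSpace α] {μ : Measure α} {s : Set α}
    (hs : MeasurableSet s) (v : α → ℝ) : ∫ y, s.indicator 1 y * v y ∂μ = ∫ y in s, v y ∂μ := by
  rw [← integral_indicator hs]
  congr with y
  by_cases hy : y ∈ s <;> simp [hy]

theorem hasCompactSupport_of_norm_ge {E : Type*} [NormedAddCommGroup E] [ProperSpace E]
    {W : E → ℝ} {R : ℝ} (hW : ∀ p, R ≤ ‖p‖ → W p = 0) : HasCompactSupport W :=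
  HasCompactSupport.intro (isCompact_closedBall (0 : E) R) fun p hp => hW p <| by
    simp only [Metric.mem_closedBall, dist_zero_right, not_le] at hp
    exact hp.le

theorem integrable_of_bounded_of_norm_ge {E : Type*} [NormedAddCommGroup E] [ProperSpace E]
    [MeasurableSpace E] {μ : Measure E} [IsFiniteMeasureOnCompacts μ] {h : E → ℝ} {R C : ℝ}
    (hm : AEStronglyMeasurable h μ) (hz : ∀ p, R ≤ ‖p‖ → h p = 0) (hb : ∀ p, |h p| ≤ C) :
    Integrable h μ := by
  have hball : IntegrableOn h (Metric.closedBall 0 R) μ :=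
    Measure.integrableOn_of_bounded measure_closedBall_lt_top.ne hm (ae_of_all _ hb)
  refine (integrableOn_iff_integrable_of_support_subset fun p hp => ?_).1 hball
  by_contra hp'
  simp only [Metric.mem_closedBall, dist_zero_right, not_le] at hp'
  exact hp (hz p hp'.le)

/-! ### Product test functions -/

theorem partialT_mul_prod {a b : ℝ → ℝ} {a' : ℝ} {p : ℝ × ℝ} (ha : HasDerivAt a a' p.1)
    (hb : DifferentiableAt ℝ b p.2) :
    partialT (fun q : ℝ × ℝ => a q.1 * b q.2) p = a' * b p.2 := by
  have ha₁ : HasFDerivAt (fun q : ℝ × ℝ => a q.1) _ p := ha.hasFDerivAt.comp p hasFDerivAt_fst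
  have hb₂ : HasFDerivAt (fun q : ℝ × ℝ => b q.2) _ p := hb.hasFDerivAt.comp p hasFDerivAt_snd
  rw [partialT, (ha₁.fun_mul hb₂).fderiv]
  simp [mul_comm]

theorem partialX_mul_prod {a b : ℝ → ℝ} {b' : ℝ} {p : ℝ × ℝ} (ha : DifferentiableAt ℝ a p.1)
    (hb : HasDerivAt b b' p.2) :
    partialX (fun q : ℝ × ℝ => a q.1 * b q.2) p = a p.1 * b' := by
  have ha₁ : HasFDerivAt (fun q : ℝ × ℝ => a q.1) _ p := ha.hasFDerivAt.comp p hasFDerivAt_fst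
  have hb₂ : HasFDerivAt (fun q : ℝ × ℝ => b q.2) _ p := hb.hasFDerivAt.comp p hasFDerivAt_snd
  rw [partialX, (ha₁.fun_mul hb₂).fderiv]
  simp [mul_comm]

theorem tendsto_integral_deriv_smoothStep_mul_prod (t : ℝ) {W : ℝ × ℝ → ℝ} (hc : Continuous W)
    (hW : HasCompactSupport W) {b : ℝ → ℝ → ℝ} {b' : ℝ → ℝ} (hb : ∀ ε, Continuous (b ε))
    (hb1 : ∀ ε y, |b ε y| ≤ 1) (hbb : ∀ y, Tendsto (fun ε => b ε y) (𝓝[>] 0) (𝓝 (b' y))) :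
    Tendsto (fun ε => ∫ p : ℝ × ℝ, deriv (smoothStep ε t) p.1 * b ε p.2 * W p) (𝓝[>] 0)
      (𝓝 (∫ y, b' y * W (t, y))) := by
  obtain ⟨C, hC⟩ := hW.exists_bound_of_continuous hc
  have hK : IsCompact (Prod.snd '' tsupport W) := hW.image continuous_snd
  have fubini (ε : ℝ) : ∫ p : ℝ × ℝ, deriv (smoothStep ε t) p.1 * b ε p.2 * W p =
      ∫ y, b ε y * ∫ s, deriv (smoothStep ε t) s * W (s, y) := by
    have hi : Integrable (fun p : ℝ × ℝ => deriv (smoothStep ε t) p.1 * b ε p.2 * W p) :=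
      ((((continuous_deriv_smoothStep ε t).comp continuous_fst).mul ((hb ε).comp
        continuous_snd)).mul hc).integrable_of_hasCompactSupport hW.mul_left
    rw [Measure.volume_eq_prod, integral_prod_symm _ hi]
    simp only [← integral_const_mul, ← mul_assoc, mul_comm]
  simp only [fubini]
  refine tendsto_integral_filter_of_dominated_convergence
    ((Prod.snd '' tsupport W).indicator fun _ => C) (Eventually.of_forall fun ε => ?_)
    (eventually_nhdsWithin_of_forall fun ε hε => ae_of_all _ fun y => ?_) ?_
    (ae_of_all _ fun y => ?_)
  · have : AEStronglyMeasurable (fun p : ℝ × ℝ => deriv (smoothStep ε t) p.2 * W p.swap)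
        ((volume : Measure ℝ).prod volume) :=
      (((continuous_deriv_smoothStep ε t).comp continuous_snd).mul
        (hc.comp continuous_swap)).aestronglyMeasurable
    exact (hb ε).aestronglyMeasurable.mul this.integral_prod_right'
  · by_cases hy : y ∈ Prod.snd '' tsupport W
    · rw [indicator_of_mem hy, norm_mul, ← one_mul C]
      exact mul_le_mul (hb1 ε y) (abs_integral_deriv_smoothStep_mul_le hε fun s _ => hC _)
        (norm_nonneg _) zero_le_one
    · have (s : ℝ) : W (s, y) = 0 := image_eq_zero_of_notMem_tsupport fun h => hy ⟨_, h, rfl⟩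
      simp [this, hy]
  · exact (integrable_indicator_iff hK.measurableSet).2
      (integrableOn_const hK.measure_lt_top.ne)
  · exact (hbb y).mul (tendsto_integral_deriv_smoothStep_mul t (hc.comp (by fun_prop)))

/-! ### The balance on quadrants -/

/-- Data `w`, `B`, `h` supported in the ball of radius `R` (for the maximum norm of `ℝ × ℝ`), with
`|h| ≤ C` and `∂ₜ w + ∂ₓ B = h` weakly on the whole plane. Because of the supports, the test
functions need not have compact support. -/
structure WeakBalance (w B h : ℝ × ℝ → ℝ) (R C : ℝ) : Prop where
  continuous_w : Continuous w
  continuous_B : Continuous B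
  measurable_h : Measurable h
  w_eq_zero : ∀ p, R ≤ ‖p‖ → w p = 0
  B_eq_zero : ∀ p, R ≤ ‖p‖ → B p = 0
  h_eq_zero : ∀ p, R ≤ ‖p‖ → h p = 0
  bound : ∀ p, |h p| ≤ C
  weak : ∀ ψ : ℝ × ℝ → ℝ, ContDiff ℝ ∞ ψ →
    ∫ p, (partialT ψ p * w p + partialX ψ p * B p) = - ∫ p, ψ p * h p

/-- The mass of `v` to the right of `x`. -/
noncomputable def tailMass (v : ℝ → ℝ) (x : ℝ) : ℝ := ∫ y in Ioi x, v y

namespace WeakBalance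

variable {w B h : ℝ × ℝ → ℝ} {R C : ℝ}

theorem integrable_h (H : WeakBalance w B h R C) : Integrable h :=
  integrable_of_bounded_of_norm_ge H.measurable_h.aestronglyMeasurable H.h_eq_zero H.bound

theorem integrable_slice_h (H : WeakBalance w B h R C) (s : ℝ) : Integrable fun y => h (s, y) :=
  integrable_of_bounded_of_norm_ge
    (H.measurable_h.comp measurable_prodMk_left).aestronglyMeasurable
    (fun y hy => H.h_eq_zero _ (hy.trans (norm_snd_le (s, y)))) fun _ => H.bound _

theorem continuous_slice_w (H : WeakBalance w B h R C) (t : ℝ) : Continuous fun y => w (t, y) :=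
  H.continuous_w.comp (by fun_prop)

theorem slice_w_eq_zero (H : WeakBalance w B h R C) (t : ℝ) {y : ℝ} (hy : R ≤ |y|) :
    w (t, y) = 0 :=
  H.w_eq_zero _ (hy.trans (norm_snd_le (t, y)))

theorem integrable_slice_w (H : WeakBalance w B h R C) (t : ℝ) : Integrable fun y => w (t, y) :=
  (H.continuous_slice_w t).integrable_of_hasCompactSupport
    (hasCompactSupport_of_norm_ge fun _ => H.slice_w_eq_zero t)

theorem integrable_B_left (H : WeakBalance w B h R C) (x : ℝ) : Integrable fun s => B (s, x) :=
  Continuous.integrable_of_hasCompactSupport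
    (H.continuous_B.comp (by fun_prop : Continuous fun s : ℝ => (s, x)))
    (hasCompactSupport_of_norm_ge fun s hs => H.B_eq_zero _ (hs.trans (norm_fst_le (s, x))))

theorem integral_smoothStep_mul (H : WeakBalance w B h R C) (ε t x : ℝ) :
    (∫ p, deriv (smoothStep ε t) p.1 * smoothStep ε x p.2 * w p) +
      (∫ p, smoothStep ε t p.1 * deriv (smoothStep ε x) p.2 * B p) =
      - ∫ p, smoothStep ε t p.1 * smoothStep ε x p.2 * h p := by
  have hcs (t : ℝ) := (contDiff_smoothStep ε t).continuous
  have hcd (t : ℝ) := continuous_deriv_smoothStep ε t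
  rw [← integral_add, ← H.weak (fun p => smoothStep ε t p.1 * smoothStep ε x p.2)
    (((contDiff_smoothStep ε t).comp contDiff_fst).mul
      ((contDiff_smoothStep ε x).comp contDiff_snd))]
  · simp only [partialT_mul_prod (hasDerivAt_smoothStep ε t _)
      (hasDerivAt_smoothStep ε x _).differentiableAt,
      partialX_mul_prod (hasDerivAt_smoothStep ε t _).differentiableAt
      (hasDerivAt_smoothStep ε x _)]
  · exact ((((hcd t).comp continuous_fst).mul ((hcs x).comp continuous_snd)).mul
      H.continuous_w).integrable_of_hasCompactSupport
      (hasCompactSupport_of_norm_ge H.w_eq_zero).mul_left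
  · exact ((((hcs t).comp continuous_fst).mul ((hcd x).comp continuous_snd)).mul
      H.continuous_B).integrable_of_hasCompactSupport
      (hasCompactSupport_of_norm_ge H.B_eq_zero).mul_left

theorem tendsto_integral_smoothStep_mul_h (H : WeakBalance w B h R C) (t x : ℝ) :
    Tendsto (fun ε => ∫ p, smoothStep ε t p.1 * smoothStep ε x p.2 * h p) (𝓝[>] 0)
      (𝓝 (∫ p in Ioi t ×ˢ Ioi x, h p)) := by
  rw [← integral_indicator_one_mul (measurableSet_Ioi.prod measurableSet_Ioi)]
  refine tendsto_integral_filter_of_dominated_convergence (fun p => |h p|)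
    (Eventually.of_forall fun ε => ?_)
    (Eventually.of_forall fun ε => ae_of_all _ fun p => ?_) H.integrable_h.abs
    (ae_of_all _ fun p => ?_)
  · exact ((((contDiff_smoothStep ε t).continuous.comp continuous_fst).mul
      ((contDiff_smoothStep ε x).continuous.comp continuous_snd)).measurable.mul
      H.measurable_h).aestronglyMeasurable
  · rw [norm_mul, norm_mul, ← one_mul |h p|, ← one_mul (1 : ℝ)]
    exact mul_le_mul_of_nonneg_right (mul_le_mul abs_smoothStep_le_one abs_smoothStep_le_one
      (norm_nonneg _) zero_le_one) (abs_nonneg _)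
  · have hprod : (Ioi t ×ˢ Ioi x).indicator (1 : ℝ × ℝ → ℝ) p =
        (Ioi t).indicator 1 p.1 * (Ioi x).indicator 1 p.2 := by
      simp [indicator_apply, ← ite_and, and_comm]
    rw [hprod]
    exact ((tendsto_smoothStep t p.1).mul (tendsto_smoothStep x p.2)).mul_const _

theorem quadrant (H : WeakBalance w B h R C) (t x : ℝ) :
    tailMass (fun y => w (t, y)) x + (∫ s in Ioi t, B (s, x)) =
      - ∫ p in Ioi t ×ˢ Ioi x, h p := by
  have hstep (r : ℝ) (ε : ℝ) : Continuous (smoothStep ε r) := (contDiff_smoothStep ε r).continuous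
  have hw := tendsto_integral_deriv_smoothStep_mul_prod t H.continuous_w
    (hasCompactSupport_of_norm_ge H.w_eq_zero) (hstep x) (fun _ _ => abs_smoothStep_le_one)
    (tendsto_smoothStep x)
  have hB := tendsto_integral_deriv_smoothStep_mul_prod x (H.continuous_B.comp continuous_swap)
    (hasCompactSupport_of_norm_ge fun p hp => H.B_eq_zero p.swap (by
      simpa [Prod.norm_def, max_comm] using hp))
    (hstep t) (fun _ _ => abs_smoothStep_le_one) (tendsto_smoothStep t)
  have hswap (ε : ℝ) : ∫ p, smoothStep ε t p.1 * deriv (smoothStep ε x) p.2 * B p =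
      ∫ p : ℝ × ℝ, deriv (smoothStep ε x) p.1 * smoothStep ε t p.2 * (B ∘ Prod.swap) p := by
    rw [Measure.volume_eq_prod, ← integral_prod_swap]
    simp only [Prod.fst_swap, Prod.snd_swap, mul_comm, Function.comp_apply]
  have hsum := hw.add hB
  simp only [← hswap, H.integral_smoothStep_mul] at hsum
  have := tendsto_nhds_unique hsum (H.tendsto_integral_smoothStep_mul_h t x).neg
  simpa only [integral_indicator_one_mul measurableSet_Ioi, tailMass, Function.comp,
    Prod.swap_prod_mk] using this

theorem integrable_tailMass_h (H : WeakBalance w B h R C) (x : ℝ) :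
    Integrable fun s => tailMass (fun y => h (s, y)) x :=
  (H.integrable_h.mono_measure (by
    rw [Measure.volume_eq_prod]
    exact Measure.prod_mono le_rfl Measure.restrict_le_self)).integral_prod_left

theorem tailMass_sub_tailMass (H : WeakBalance w B h R C) (t t' x : ℝ) :
    tailMass (fun y => w (t', y)) x - tailMass (fun y => w (t, y)) x =
      (∫ s in t..t', tailMass (fun y => h (s, y)) x) + ∫ s in t..t', B (s, x) := by
  have hint := H.integrable_tailMass_h x
  have hprod (r : ℝ) : ∫ p in Ioi r ×ˢ Ioi x, h p =
      ∫ s in Ioi r, tailMass (fun y => h (s, y)) x :=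
    setIntegral_prod h H.integrable_h.integrableOn
  rw [← intervalIntegral.integral_Ioi_sub_Ioi' hint.integrableOn hint.integrableOn,
    ← intervalIntegral.integral_Ioi_sub_Ioi' (H.integrable_B_left x).integrableOn
      (H.integrable_B_left x).integrableOn, ← hprod, ← hprod]
  linarith [H.quadrant t x, H.quadrant t' x]

end WeakBalance

/-! ### Unions of intervals on a line -/

section Layer

variable {n : ℕ} {R : ℝ} {v : ℝ → ℝ}

/-- Nondecreasing families of `n` points of `[-R, R]`. Such a family `x` stands for the union of
intervals `(x 0, x 1] ∪ (x 2, x 3] ∪ ⋯`, the last one being unbounded if `n` is odd. -/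
def configSet (R : ℝ) (n : ℕ) : Set (Fin n → ℝ) :=
  {x | Monotone x} ∩ Icc (fun _ => -R) (fun _ => R)

/-- The indicator function of `(x 0, x 1] ∪ (x 2, x 3] ∪ ⋯`, as an alternating sum of indicator
functions of half-lines. -/
noncomputable def layer (x : Fin n → ℝ) (y : ℝ) : ℝ :=
  ∑ i : Fin n, (-1) ^ (i : ℕ) * (Ioi (x i)).indicator 1 y

/-- The mass of `v` on `(x 0, x 1] ∪ (x 2, x 3] ∪ ⋯`. -/
noncomputable def layerMass (v : ℝ → ℝ) (x : Fin n → ℝ) : ℝ :=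
  ∑ i : Fin n, (-1) ^ (i : ℕ) * tailMass v (x i)

theorem isCompact_configSet (R : ℝ) (n : ℕ) : IsCompact (configSet R n) :=
  isCompact_Icc.inter_left isClosed_monotone

theorem configSet_nonempty (hR : 0 ≤ R) (n : ℕ) : (configSet R n).Nonempty :=
  ⟨fun _ => R, monotone_const, fun _ => by simpa using hR, le_rfl⟩

theorem layer_mem_Icc {x : Fin n → ℝ} (hx : Monotone x) (y : ℝ) : layer x y ∈ Icc (0 : ℝ) 1 := by
  induction n with
  | zero => simp [layer]
  | succ n ih =>
    rcases le_or_gt y (x 0) with hy | hy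
    · have hzero (i) : (Ioi (x i)).indicator (1 : ℝ → ℝ) y = 0 :=
        indicator_of_notMem (not_lt.2 (hy.trans (hx (Fin.zero_le i)))) _
      simp [layer, hzero]
    · have hsucc : layer x y = 1 - layer (fun i : Fin n => x i.succ) y := by
        have h0 : (Ioi (x 0)).indicator (1 : ℝ → ℝ) y = 1 := indicator_of_mem hy _
        simp [layer, Fin.sum_univ_succ, pow_succ, h0, sub_eq_add_neg]
      have := ih fun i j hij => hx (Fin.succ_le_succ_iff.2 hij)
      rw [hsucc]
      constructor <;> linarith [this.1, this.2]

theorem measurable_layer (x : Fin n → ℝ) : Measurable (layer x) :=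
  Finset.measurable_sum _ fun _ _ =>
    measurable_const.mul (measurable_one.indicator measurableSet_Ioi)

theorem integrable_layer_mul (hv : Integrable v) {x : Fin n → ℝ} (hx : Monotone x) :
    Integrable fun y => layer x y * v y :=
  hv.bdd_mul (c := 1) (measurable_layer x).aestronglyMeasurable <| ae_of_all _ fun y => by
    rw [Real.norm_of_nonneg (layer_mem_Icc hx y).1]
    exact (layer_mem_Icc hx y).2

theorem integral_layer_mul (hv : Integrable v) (x : Fin n → ℝ) :
    ∫ y, layer x y * v y = layerMass v x := by
  have hind (i) (y : ℝ) : (Ioi (x i)).indicator 1 y * v y = (Ioi (x i)).indicator v y := by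
    by_cases hy : y ∈ Ioi (x i) <;> simp [hy]
  simp only [layer, Finset.sum_mul, mul_assoc, hind]
  rw [integral_finsetSum _ fun i _ => (hv.indicator measurableSet_Ioi).const_mul _]
  simp only [integral_const_mul, integral_indicator measurableSet_Ioi, layerMass, tailMass]

theorem tailMass_sub_tailMass (hv : Integrable v) (a b : ℝ) :
    tailMass v a - tailMass v b = ∫ y in a..b, v y :=
  intervalIntegral.integral_Ioi_sub_Ioi' hv.integrableOn hv.integrableOn

theorem hasDerivAt_tailMass (hv : Continuous v) (hvi : Integrable v) (x : ℝ) :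
    HasDerivAt (tailMass v) (-v x) x := by
  have h : tailMass v = fun y => tailMass v 0 - ∫ z in (0 : ℝ)..y, v z := by
    funext y
    rw [← tailMass_sub_tailMass hvi, sub_sub_cancel]
  rw [h]
  exact (hv.integral_hasStrictDerivAt 0 x).hasDerivAt.const_sub _

theorem continuous_layerMass (hv : Continuous v) (hvi : Integrable v) :
    Continuous fun x : Fin n → ℝ => layerMass v x := by
  have h : Continuous (tailMass v) :=
    continuous_iff_continuousAt.2 fun x => (hasDerivAt_tailMass hv hvi x).continuousAt
  unfold layerMass
  fun_prop

theorem exists_isMaxOn_layerMass (hR : 0 ≤ R) (hv : Continuous v) (hvi : Integrable v) (n : ℕ) :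
    ∃ x ∈ configSet R n, IsMaxOn (layerMass v) (configSet R n) x :=
  (isCompact_configSet R n).exists_isMaxOn (configSet_nonempty hR n)
    (continuous_layerMass hv hvi).continuousOn

/-- Moves the endpoints that sit at `y` by `τ`. -/
noncomputable def moveCluster (x : Fin n → ℝ) (y τ : ℝ) (i : Fin n) : ℝ :=
  if x i = y then y + τ else x i

theorem moveCluster_zero (x : Fin n → ℝ) (y : ℝ) : moveCluster x y 0 = x := by
  ext i
  by_cases h : x i = y <;> simp [moveCluster, h]

theorem eventually_moveCluster_mem {x : Fin n → ℝ} (hx : x ∈ configSet R n) {y : ℝ}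
    (hy : |y| < R) : ∀ᶠ τ in 𝓝 (0 : ℝ), moveCluster x y τ ∈ configSet R n := by
  have hcont (i : Fin n) : Continuous fun τ => moveCluster x y τ i := by
    by_cases h : x i = y <;> simp only [moveCluster, h, if_true, if_false] <;> fun_prop
  have hIcc : ∀ᶠ τ in 𝓝 (0 : ℝ), y + τ ∈ Icc (-R) R :=
    (by fun_prop : ContinuousAt (fun τ : ℝ => y + τ) 0).eventually_mem <| by
      rw [add_zero]
      exact Icc_mem_nhds (abs_lt.1 hy).1 (abs_lt.1 hy).2
  have hmono : ∀ᶠ τ in 𝓝 (0 : ℝ), ∀ i j, i ≤ j → moveCluster x y τ i ≤ moveCluster x y τ j := by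
    refine eventually_all.2 fun i => eventually_all.2 fun j => ?_
    by_cases hij : i ≤ j
    · rcases (hx.1 hij).lt_or_eq with h | h
      · have : ∀ᶠ τ in 𝓝 (0 : ℝ), moveCluster x y τ i < moveCluster x y τ j :=
          (hcont i).continuousAt.eventually_lt (hcont j).continuousAt
            (by rwa [moveCluster_zero])
        filter_upwards [this] with τ hτ _ using hτ.le
      · exact Eventually.of_forall fun τ _ => by simp [moveCluster, h]
    · exact Eventually.of_forall fun τ h => absurd h hij
  filter_upwards [hIcc, hmono] with τ hτ hτm
  refine ⟨fun i j => hτm i j, fun i => ?_, fun i => ?_⟩ <;> by_cases h : x i = y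
  · simpa [moveCluster, h] using hτ.1
  · simpa [moveCluster, h] using hx.2.1 i
  · simpa [moveCluster, h] using hτ.2
  · simpa [moveCluster, h] using hx.2.2 i

theorem hasDerivAt_layerMass_moveCluster (hv : Continuous v) (hvi : Integrable v)
    (x : Fin n → ℝ) (y : ℝ) :
    HasDerivAt (fun τ => layerMass v (moveCluster x y τ))
      ((∑ i with x i = y, (-1 : ℝ) ^ (i : ℕ)) * -v y) 0 := by
  have hy : HasDerivAt (fun τ => tailMass v (y + τ)) (-v y) 0 := by
    have := hasDerivAt_tailMass hv hvi (y + 0)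
    simpa using this.comp_const_add y 0
  rw [Finset.sum_mul, Finset.sum_filter]
  refine HasDerivAt.fun_sum
    (A := fun (i : Fin n) τ => (-1 : ℝ) ^ (i : ℕ) * tailMass v (moveCluster x y τ i)) fun i _ => ?_
  by_cases h : x i = y
  · simpa [moveCluster, h] using hy.const_mul ((-1 : ℝ) ^ (i : ℕ))
  · simpa [moveCluster, h] using hasDerivAt_const (0 : ℝ) ((-1) ^ (i : ℕ) * tailMass v (x i))

theorem sum_cluster_mul_eq_zero (hv : Continuous v) (hvi : Integrable v) {x : Fin n → ℝ}
    (hx : x ∈ configSet R n) (hmax : IsMaxOn (layerMass v) (configSet R n) x) {y : ℝ}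
    (hy : |y| < R) : (∑ i with x i = y, (-1 : ℝ) ^ (i : ℕ)) * v y = 0 := by
  have hloc : IsLocalMax (fun τ => layerMass v (moveCluster x y τ)) 0 := by
    filter_upwards [eventually_moveCluster_mem hx hy] with τ hτ
    rw [moveCluster_zero]
    exact hmax hτ
  linarith [hloc.hasDerivAt_eq_zero (hasDerivAt_layerMass_moveCluster hv hvi x y)]

theorem sum_flux_eq_zero (hv : Continuous v) (hv0 : ∀ y, R ≤ |y| → v y = 0) {b : ℝ → ℝ}
    (hb : ∀ y, v y = 0 → b y = 0) {x : Fin n → ℝ}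
    (hx : x ∈ configSet R n) (hmax : IsMaxOn (layerMass v) (configSet R n) x) :
    ∑ i : Fin n, (-1 : ℝ) ^ (i : ℕ) * b (x i) = 0 := by
  have hvi : Integrable v :=
    hv.integrable_of_hasCompactSupport (hasCompactSupport_of_norm_ge hv0)
  rw [← Finset.sum_fiberwise_of_maps_to (t := Finset.univ.image x) (g := x)
    fun i _ => Finset.mem_image_of_mem x (Finset.mem_univ i)]
  refine Finset.sum_eq_zero fun y _ => ?_
  have hcluster : ∑ i with x i = y, (-1 : ℝ) ^ (i : ℕ) * b (x i) =
      (∑ i with x i = y, (-1 : ℝ) ^ (i : ℕ)) * b y := by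
    rw [Finset.sum_mul]
    exact Finset.sum_congr rfl fun i hi => by rw [(Finset.mem_filter.1 hi).2]
  rw [hcluster]
  by_cases hy : |y| < R
  · rcases mul_eq_zero.1 (sum_cluster_mul_eq_zero hv hvi hx hmax hy) with h | h
    · rw [h, zero_mul]
    · rw [hb y h, mul_zero]
  · rw [hb y (hv0 y (not_lt.1 hy)), mul_zero]

/-! ### Almost optimal unions of intervals -/

/-- The mass of the positive part of `v` that the configuration `x` misses, plus the mass of the
negative part that it catches. -/
noncomputable def deficit (v : ℝ → ℝ) (x : Fin n → ℝ) : ℝ :=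
  ∫ y, (max (v y) 0 - layer x y * v y)

theorem deficit_eq_sub (hv : Integrable v) {x : Fin n → ℝ} (hx : Monotone x) :
    deficit v x = (∫ y, max (v y) 0) - layerMass v x := by
  rw [deficit, integral_sub hv.pos_part (integrable_layer_mul hv hx), integral_layer_mul hv]

/-- The `j`-th point of the division of `[-R, R]` into `m` intervals of equal length. -/
noncomputable def gridPoint (R : ℝ) (m j : ℕ) : ℝ := -R + 2 * R / m * j

theorem monotone_gridPoint (hR : 0 ≤ R) (m : ℕ) : Monotone (gridPoint R m) := fun i j hij => by
  unfold gridPoint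
  gcongr

theorem gridPoint_zero (R : ℝ) (m : ℕ) : gridPoint R m 0 = -R := by simp [gridPoint]

theorem gridPoint_self (R : ℝ) {m : ℕ} (hm : m ≠ 0) : gridPoint R m m = R := by
  have : (m : ℝ) ≠ 0 := Nat.cast_ne_zero.2 hm
  rw [gridPoint, div_mul_cancel₀ _ this]
  ring

theorem gridPoint_succ (R : ℝ) (m j : ℕ) : gridPoint R m (j + 1) = gridPoint R m j + 2 * R / m := by
  simp only [gridPoint]
  push_cast
  ring

open Classical in
/-- The position on the grid of the `i`-th endpoint of the configuration that selects the cells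
whose left endpoint satisfies `P`: the other cells contribute empty intervals. -/
noncomputable def cellIndex (P : ℕ → Prop) (i : ℕ) : ℕ :=
  i / 2 + if i % 2 = 1 ∧ P (i / 2) then 1 else 0

theorem monotone_cellIndex (P : ℕ → Prop) : Monotone (cellIndex P) := by
  refine monotone_nat_of_le_succ fun i => ?_
  unfold cellIndex
  split_ifs <;> omega

theorem cellIndex_two_mul (P : ℕ → Prop) (j : ℕ) : cellIndex P (2 * j) = j := by
  simp [cellIndex]

open Classical in
theorem cellIndex_two_mul_add_one (P : ℕ → Prop) (j : ℕ) :
    cellIndex P (2 * j + 1) = if P j then j + 1 else j := by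
  have hdiv : (2 * j + 1) / 2 = j := by omega
  split_ifs with h <;> simp [cellIndex, hdiv, h, Nat.add_mod]

theorem cellIndex_le (P : ℕ → Prop) {i m : ℕ} (hi : i < 2 * m) : cellIndex P i ≤ m := by
  unfold cellIndex
  split_ifs <;> omega

theorem gridPoint_cellIndex_mem_configSet (hR : 0 ≤ R) {m : ℕ} (hm : m ≠ 0) (P : ℕ → Prop) :
    (fun i : Fin (2 * m) => gridPoint R m (cellIndex P i)) ∈ configSet R (2 * m) := by
  refine ⟨fun i j hij => monotone_gridPoint hR m (monotone_cellIndex P hij), fun i => ?_,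
    fun i => ?_⟩
  · simpa only [gridPoint_zero] using monotone_gridPoint hR m (Nat.zero_le (cellIndex P i))
  · simpa only [gridPoint_self R hm] using monotone_gridPoint hR m (cellIndex_le P i.2)

theorem sum_range_two_mul {M : Type*} [AddCommMonoid M] (f : ℕ → M) (m : ℕ) :
    ∑ i ∈ Finset.range (2 * m), f i = ∑ j ∈ Finset.range m, (f (2 * j) + f (2 * j + 1)) := by
  induction m with
  | zero => simp
  | succ m ih =>
    rw [Nat.mul_succ, Finset.sum_range_succ, Finset.sum_range_succ, ih, Finset.sum_range_succ,
      add_assoc]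

theorem layerMass_gridPoint_cellIndex (hv : Integrable v) (R : ℝ) (m : ℕ) (P : ℕ → Prop) :
    layerMass v (fun i : Fin (2 * m) => gridPoint R m (cellIndex P i)) =
      ∑ j ∈ Finset.range m,
        ∫ y in gridPoint R m j..gridPoint R m (cellIndex P (2 * j + 1)), v y := by
  rw [layerMass, Fin.sum_univ_eq_sum_range
    (fun i => (-1) ^ i * tailMass v (gridPoint R m (cellIndex P i))), sum_range_two_mul]
  refine Finset.sum_congr rfl fun j _ => ?_
  rw [← tailMass_sub_tailMass hv, cellIndex_two_mul, pow_succ, pow_mul]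
  simp [sub_eq_add_neg]

theorem integral_posPart_eq_intervalIntegral (hv0 : ∀ y, R ≤ |y| → v y = 0) :
    ∫ y, max (v y) 0 = ∫ y in (-R)..R, max (v y) 0 := by
  refine (intervalIntegral.integral_eq_integral_of_support_subset fun y hy => ?_).symm
  have : |y| < R := by
    by_contra h
    exact hy (by simp [hv0 y (not_lt.1 h)])
  exact ⟨(abs_lt.1 this).1, (abs_lt.1 this).2.le⟩

theorem integral_posPart_sub_cell_le (hv : Continuous v) {a b c ε : ℝ} (hab : a ≤ b)
    (hc : c = if 0 < v a then b else a) (hε : ∀ y ∈ Icc a b, |v y - v a| ≤ ε) :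
    (∫ y in a..b, max (v y) 0) - (∫ y in a..c, v y) ≤ (b - a) * ε := by
  have hp : Continuous fun y => max (v y) 0 := hv.max continuous_const
  have hconst : (b - a) * ε = ∫ _ in a..b, ε := by
    rw [intervalIntegral.integral_const, smul_eq_mul]
  rw [hconst]
  by_cases hpos : 0 < v a
  · rw [hc, if_pos hpos, ← intervalIntegral.integral_sub (hp.intervalIntegrable _ _)
      (hv.intervalIntegrable _ _)]
    refine intervalIntegral.integral_mono_on hab ((hp.sub hv).intervalIntegrable _ _)
      (continuous_const.intervalIntegrable _ _) fun y hy => ?_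
    have := abs_le.1 (hε y hy)
    rcases max_cases (v y) 0 with h | h <;> linarith [this.1, this.2]
  · rw [hc, if_neg hpos, intervalIntegral.integral_same, sub_zero]
    refine intervalIntegral.integral_mono_on hab (hp.intervalIntegrable _ _)
      (continuous_const.intervalIntegrable _ _) fun y hy => ?_
    have := abs_le.1 (hε y hy)
    rcases max_cases (v y) 0 with h | h <;> linarith [this.1, this.2]

theorem exists_mem_configSet_deficit_le (hR : 0 ≤ R) (hv : Continuous v)
    (hv0 : ∀ y, R ≤ |y| → v y = 0) {m : ℕ} (hm : m ≠ 0) {ε : ℝ}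
    (hε : ∀ a b, |a - b| ≤ 2 * R / m → |v a - v b| ≤ ε) :
    ∃ x ∈ configSet R (2 * m), deficit v x ≤ 2 * R * ε := by
  have hvi : Integrable v :=
    hv.integrable_of_hasCompactSupport (hasCompactSupport_of_norm_ge hv0)
  have hp : Continuous fun y => max (v y) 0 := hv.max continuous_const
  have hmono := monotone_gridPoint hR m
  set P : ℕ → Prop := fun j => 0 < v (gridPoint R m j)
  have hx := gridPoint_cellIndex_mem_configSet hR hm P
  refine ⟨_, hx, ?_⟩
  have hgrid : ∫ y, max (v y) 0 =
      ∑ j ∈ Finset.range m, ∫ y in gridPoint R m j..gridPoint R m (j + 1), max (v y) 0 := by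
    rw [intervalIntegral.sum_integral_adjacent_intervals fun k _ => hp.intervalIntegrable _ _,
      gridPoint_zero, gridPoint_self R hm, integral_posPart_eq_intervalIntegral hv0]
  rw [deficit_eq_sub hvi hx.1, layerMass_gridPoint_cellIndex hvi, hgrid, ← Finset.sum_sub_distrib]
  calc _ ≤ ∑ j ∈ Finset.range m, (gridPoint R m (j + 1) - gridPoint R m j) * ε := by
        refine Finset.sum_le_sum fun j _ => integral_posPart_sub_cell_le hv (hmono j.le_succ)
          (by rw [cellIndex_two_mul_add_one, apply_ite (gridPoint R m)]) fun y hy => hε _ _ ?_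
        rw [abs_of_nonneg (by linarith [hy.1])]
        linarith [hy.2, gridPoint_succ R m j]
    _ = 2 * R * ε := by
        rw [← Finset.sum_mul, Finset.sum_range_sub, gridPoint_self R hm, gridPoint_zero]
        ring

theorem posPart_sub_mul_le {θ a b e : ℝ} (hθ : θ ∈ Icc (0 : ℝ) 1) (h : |a - b| ≤ e) :
    max a 0 - θ * a ≤ max b 0 - θ * b + e := by
  obtain ⟨h1, h2⟩ := abs_le.1 h
  obtain ⟨h3, h4⟩ := hθ
  rcases max_cases a 0 with ha | ha <;> rcases max_cases b 0 with hb | hb <;>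
    rw [ha.1, hb.1] <;> nlinarith

theorem deficit_le_add (hR : 0 ≤ R) {v' : ℝ → ℝ} (hv : Integrable v) (hv' : Integrable v')
    (hv0 : ∀ y, R ≤ |y| → v y = 0) (hv0' : ∀ y, R ≤ |y| → v' y = 0) {x : Fin n → ℝ}
    (hx : Monotone x) {e : ℝ} (he : ∀ y, |v' y - v y| ≤ e) :
    deficit v' x ≤ deficit v x + 2 * R * e := by
  have hint {u : ℝ → ℝ} (hu : Integrable u) : Integrable fun y => max (u y) 0 - layer x y * u y :=
    hu.pos_part.sub (integrable_layer_mul hu hx)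
  have hconst : Integrable ((Icc (-R) R).indicator fun _ : ℝ => e) :=
    (integrable_indicator_iff measurableSet_Icc).2 (integrableOn_const (by simp))
  calc deficit v' x
      ≤ ∫ y, ((max (v y) 0 - layer x y * v y) + (Icc (-R) R).indicator (fun _ => e) y) := by
        refine integral_mono (hint hv') ((hint hv).add hconst) fun y => ?_
        by_cases hy : |y| < R
        · simp only [indicator_of_mem (mem_Icc.2 (abs_le.1 hy.le))]
          exact posPart_sub_mul_le (layer_mem_Icc hx y) (he y)
        · have he0 : 0 ≤ e := (abs_nonneg _).trans (he y)
          simp only [hv0 y (not_lt.1 hy), hv0' y (not_lt.1 hy)]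
          simpa using indicator_nonneg (fun _ _ => he0) y
    _ = deficit v x + 2 * R * e := by
        rw [integral_add (hint hv) hconst, integral_indicator measurableSet_Icc,
          setIntegral_const, Real.volume_real_Icc_of_le (by linarith), smul_eq_mul, deficit]
        ring

end Layer

/-! ### The source on the positivity set -/

theorem indicator_sub_mul_deficit_le {θ a h C δ : ℝ} (hθ : θ ∈ Icc (0 : ℝ) 1) (hδ : 0 < δ)
    (hC : |h| ≤ C) :
    (Ioi (0 : ℝ)).indicator (fun _ => h) a - (Icc (-δ) δ).indicator (fun _ => |h|) a
      - C / δ * (max a 0 - θ * a) ≤ θ * h := by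
  obtain ⟨h0, h1⟩ := hθ
  have hC0 : 0 ≤ C := (abs_nonneg h).trans hC
  have hh := abs_le.1 (le_refl |h|)
  have hdef : 0 ≤ max a 0 - θ * a := by
    rcases max_cases a 0 with ha | ha <;> rw [ha.1] <;> nlinarith
  have hCdef : 0 ≤ C / δ * (max a 0 - θ * a) := by positivity
  by_cases ha : a ∈ Icc (-δ) δ
  · rw [indicator_of_mem ha]
    by_cases hp : a ∈ Ioi (0 : ℝ)
    · rw [indicator_of_mem hp]
      nlinarith
    · rw [indicator_of_notMem hp]
      nlinarith
  · rw [indicator_of_notMem ha]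
    rcases lt_or_ge δ a with hδa | hδa
    · rw [indicator_of_mem (mem_Ioi.2 (hδ.trans hδa)), max_eq_left (hδ.trans hδa).le]
      have : C * (1 - θ) ≤ C * (1 - θ) * (a / δ) :=
        le_mul_of_one_le_right (mul_nonneg hC0 (by linarith)) ((one_le_div hδ).2 hδa.le)
      have : C / δ * (a - θ * a) = C * (1 - θ) * (a / δ) := by ring
      nlinarith
    · have ha' : a < -δ := not_le.1 fun h => ha ⟨h, hδa⟩
      rw [indicator_of_notMem (by simp; linarith), max_eq_right (by linarith)]
      have : C * θ ≤ C * θ * (-a / δ) :=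
        le_mul_of_one_le_right (mul_nonneg hC0 h0) ((one_le_div hδ).2 (by linarith))
      have : C / δ * (0 - θ * a) = C * θ * (-a / δ) := by ring
      nlinarith

/-- The source `h` on the set `{w > 0}`, diminished by `|h|` on `{|w| ≤ δ}`. -/
noncomputable def truncatedSource (w h : ℝ × ℝ → ℝ) (δ : ℝ) (p : ℝ × ℝ) : ℝ :=
  (Ioi (0 : ℝ)).indicator (fun _ => h p) (w p) - (Icc (-δ) δ).indicator (fun _ => |h p|) (w p)

theorem intervalIntegral_le_sub_of_forall_lt {F G : ℝ → ℝ} {κ : ℝ} (hκ : 0 < κ)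
    (hG : ∀ a b, IntervalIntegrable G volume a b)
    (hF : ∀ t t', t ≤ t' → t' < t + κ → ∫ s in t..t', G s ≤ F t' - F t) {a b : ℝ}
    (hab : a ≤ b) : ∫ s in a..b, G s ≤ F b - F a := by
  obtain ⟨K, hK⟩ := exists_nat_gt ((b - a) / κ)
  have hK0 : (0 : ℝ) < K := (div_nonneg (by linarith) hκ.le).trans_lt hK
  set c : ℕ → ℝ := fun j => a + j * ((b - a) / K)
  have hc0 : c 0 = a := by simp [c]
  have hcK : c K = b := by
    simp only [c]
    rw [mul_div_cancel₀ _ hK0.ne']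
    ring
  have hcs (j : ℕ) : c (j + 1) = c j + (b - a) / K := by
    simp only [c]
    push_cast
    ring
  have hsmall : (b - a) / K < κ := by
    rwa [div_lt_iff₀ hK0, mul_comm, ← div_lt_iff₀ hκ]
  calc ∫ s in a..b, G s = ∑ j ∈ Finset.range K, ∫ s in c j..c (j + 1), G s := by
        rw [intervalIntegral.sum_integral_adjacent_intervals fun _ _ => hG _ _, hc0, hcK]
    _ ≤ ∑ j ∈ Finset.range K, (F (c (j + 1)) - F (c j)) := Finset.sum_le_sum fun j _ => by
        refine hF _ _ ?_ ?_ <;> rw [hcs]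
        · linarith [div_nonneg (sub_nonneg.2 hab) hK0.le]
        · linarith
    _ = F b - F a := by rw [Finset.sum_range_sub (fun j => F (c j)), hc0, hcK]

namespace WeakBalance

variable {w B h : ℝ × ℝ → ℝ} {R C : ℝ}

theorem integrable_truncatedSource (H : WeakBalance w B h R C) (δ : ℝ) :
    Integrable (truncatedSource w h δ) :=
  (H.integrable_h.indicator (H.continuous_w.measurable measurableSet_Ioi)).sub
    (H.integrable_h.abs.indicator (H.continuous_w.measurable measurableSet_Icc))

theorem integrable_slice_truncatedSource (H : WeakBalance w B h R C) (δ s : ℝ) :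
    Integrable fun y => truncatedSource w h δ (s, y) :=
  ((H.integrable_slice_h s).indicator
    ((H.continuous_slice_w s).measurable measurableSet_Ioi)).sub
    ((H.integrable_slice_h s).abs.indicator
      ((H.continuous_slice_w s).measurable measurableSet_Icc))

theorem integral_truncatedSource_sub_le (H : WeakBalance w B h R C) {δ : ℝ} (hδ : 0 < δ)
    {n : ℕ} {x : Fin n → ℝ} (hx : Monotone x) (s : ℝ) :
    (∫ y, truncatedSource w h δ (s, y)) - C / δ * deficit (fun y => w (s, y)) x ≤
      layerMass (fun y => h (s, y)) x := by
  have hdef : Integrable fun y => max (w (s, y)) 0 - layer x y * w (s, y) :=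
    (H.integrable_slice_w s).pos_part.sub (integrable_layer_mul (H.integrable_slice_w s) hx)
  rw [deficit, ← integral_const_mul, ← integral_layer_mul (H.integrable_slice_h s),
    ← integral_sub (H.integrable_slice_truncatedSource δ s) (hdef.const_mul _)]
  exact integral_mono ((H.integrable_slice_truncatedSource δ s).sub (hdef.const_mul _))
    (integrable_layer_mul (H.integrable_slice_h s) hx) fun y =>
      indicator_sub_mul_deficit_le (layer_mem_Icc hx y) hδ (H.bound _)

theorem integrable_layerMass_h (H : WeakBalance w B h R C) {n : ℕ} (x : Fin n → ℝ) :
    Integrable fun s => layerMass (fun y => h (s, y)) x :=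
  integrable_finsetSum _ fun i _ => (H.integrable_tailMass_h (x i)).const_mul _

theorem integrable_flux (H : WeakBalance w B h R C) {n : ℕ} (x : Fin n → ℝ) :
    Integrable fun s => ∑ i : Fin n, (-1) ^ (i : ℕ) * B (s, x i) :=
  integrable_finsetSum _ fun i _ => (H.integrable_B_left (x i)).const_mul _

theorem layerMass_sub_layerMass (H : WeakBalance w B h R C) (t t' : ℝ) {n : ℕ}
    (x : Fin n → ℝ) :
    layerMass (fun y => w (t', y)) x - layerMass (fun y => w (t, y)) x =
      ∫ s in t..t', (layerMass (fun y => h (s, y)) x +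
        ∑ i : Fin n, (-1) ^ (i : ℕ) * B (s, x i)) := by
  rw [intervalIntegral.integral_add (H.integrable_layerMass_h x).intervalIntegrable
    (H.integrable_flux x).intervalIntegrable]
  simp only [layerMass]
  rw [intervalIntegral.integral_finsetSum fun i _ =>
      ((H.integrable_tailMass_h (x i)).const_mul _).intervalIntegrable,
    intervalIntegral.integral_finsetSum fun i _ =>
      ((H.integrable_B_left (x i)).const_mul _).intervalIntegrable,
    ← Finset.sum_sub_distrib, ← Finset.sum_add_distrib]
  refine Finset.sum_congr rfl fun i _ => ?_
  rw [← mul_sub, H.tailMass_sub_tailMass, intervalIntegral.integral_const_mul,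
    intervalIntegral.integral_const_mul, mul_add]

theorem exists_deficit_le_of_isMaxOn (H : WeakBalance w B h R C) (hR : 0 < R) {e : ℝ}
    (he : 0 < e) : ∃ n, ∀ t, ∀ x ∈ configSet R n,
      IsMaxOn (layerMass fun y => w (t, y)) (configSet R n) x →
        deficit (fun y => w (t, y)) x ≤ 2 * R * e := by
  obtain ⟨κ, hκ, hwκ⟩ := Metric.uniformContinuous_iff.1
    ((hasCompactSupport_of_norm_ge H.w_eq_zero).uniformContinuous_of_continuous H.continuous_w)
    e he
  obtain ⟨m, hm⟩ := exists_nat_gt (2 * R / κ)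
  have hm0 : (0 : ℝ) < m := lt_of_le_of_lt (by positivity) hm
  have hmκ : 2 * R / m < κ := by
    rw [div_lt_iff₀ hm0]
    linarith [(div_lt_iff₀ hκ).1 hm]
  refine ⟨2 * m, fun t x hx hmax => ?_⟩
  have hw (a b : ℝ) (hab : |a - b| ≤ 2 * R / m) : |w (t, a) - w (t, b)| ≤ e := by
    refine (hwκ (a := (t, a)) (b := (t, b)) ?_).le
    rw [Prod.dist_eq, dist_self, Real.dist_eq, max_eq_right (abs_nonneg _)]
    exact hab.trans_lt hmκ
  obtain ⟨x', hx', hdef⟩ := exists_mem_configSet_deficit_le hR.le (H.continuous_slice_w t)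
    (fun y => H.slice_w_eq_zero t) (by exact_mod_cast hm0.ne') hw
  have hle : layerMass (fun y => w (t, y)) x' ≤ layerMass (fun y => w (t, y)) x := hmax hx'
  rw [deficit_eq_sub (H.integrable_slice_w t) hx'.1] at hdef
  rw [deficit_eq_sub (H.integrable_slice_w t) hx.1]
  linarith

theorem exists_abs_flux_le_of_isMaxOn (H : WeakBalance w B h R C)
    (hB : ∀ p, w p = 0 → B p = 0) (n : ℕ) {ε : ℝ} (hε : 0 < ε) :
    ∃ κ > 0, ∀ t s, |s - t| < κ → ∀ x ∈ configSet R n,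
      IsMaxOn (layerMass fun y => w (t, y)) (configSet R n) x →
        |∑ i : Fin n, (-1) ^ (i : ℕ) * B (s, x i)| ≤ ε := by
  obtain ⟨κ, hκ, hBκ⟩ := Metric.uniformContinuous_iff.1
    ((hasCompactSupport_of_norm_ge H.B_eq_zero).uniformContinuous_of_continuous H.continuous_B)
    (ε / (n + 1)) (by positivity)
  refine ⟨κ, hκ, fun t s hst x hx hmax => ?_⟩
  rw [← sub_zero (∑ i : Fin n, _), ← sum_flux_eq_zero (H.continuous_slice_w t)
    (fun y => H.slice_w_eq_zero t) (fun y => hB (t, y)) hx hmax, ← Finset.sum_sub_distrib]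
  calc _ ≤ ∑ _i : Fin n, ε / (n + 1) := by
        refine (Finset.abs_sum_le_sum_abs _ _).trans (Finset.sum_le_sum fun i _ => ?_)
        rw [← mul_sub, abs_mul, abs_pow, abs_neg, abs_one, one_pow, one_mul]
        refine (hBκ (a := (s, x i)) (b := (t, x i)) ?_).le
        rwa [Prod.dist_eq, dist_self, Real.dist_eq, max_eq_left (abs_nonneg _)]
    _ = n * (ε / (n + 1)) := by simp
    _ ≤ (n + 1) * (ε / (n + 1)) := by gcongr; linarith
    _ = ε := by field_simp

/-- The flux through the endpoints of an optimal configuration nearly vanishes, so its mass grows at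
least as fast as the source feeds the positivity set. -/
theorem exists_integral_truncatedSource_le_layerMass_sub (H : WeakBalance w B h R C) (hR : 0 < R)
    (hB : ∀ p, w p = 0 → B p = 0) {δ ε : ℝ} (hδ : 0 < δ) (hε : 0 < ε) :
    ∃ n, ∃ κ > 0, ∀ t t', t ≤ t' → t' < t + κ → ∀ x ∈ configSet R n,
      IsMaxOn (layerMass fun y => w (t, y)) (configSet R n) x →
        ∫ s in t..t', ((∫ y, truncatedSource w h δ (s, y)) - ε) ≤
          layerMass (fun y => w (t', y)) x - layerMass (fun y => w (t, y)) x := by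
  have hC0 : 0 ≤ C := (abs_nonneg _).trans (H.bound 0)
  obtain ⟨e, he, hCe⟩ := exists_pos_mul_lt (half_pos hε) (C / δ * (4 * R))
  obtain ⟨n, hn⟩ := H.exists_deficit_le_of_isMaxOn hR he
  obtain ⟨κ₁, hκ₁, hw⟩ := Metric.uniformContinuous_iff.1
    ((hasCompactSupport_of_norm_ge H.w_eq_zero).uniformContinuous_of_continuous H.continuous_w)
    e he
  obtain ⟨κ₂, hκ₂, hflux⟩ := H.exists_abs_flux_le_of_isMaxOn hB n (half_pos hε)
  refine ⟨n, min κ₁ κ₂, lt_min hκ₁ hκ₂, fun t t' htt htκ x hx hmax => ?_⟩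
  rw [H.layerMass_sub_layerMass]
  refine intervalIntegral.integral_mono_on htt
    ((H.integrable_truncatedSource δ).integral_prod_left.intervalIntegrable.sub
      intervalIntegrable_const)
    ((H.integrable_layerMass_h x).add (H.integrable_flux x)).intervalIntegrable fun s hs => ?_
  have hst : |s - t| < min κ₁ κ₂ := by
    rw [abs_of_nonneg (by linarith [hs.1])]
    linarith [hs.2]
  have hdef : deficit (fun y => w (s, y)) x ≤ 2 * R * e + 2 * R * e :=
    (deficit_le_add hR.le (H.integrable_slice_w t) (H.integrable_slice_w s)
      (fun y => H.slice_w_eq_zero t) (fun y => H.slice_w_eq_zero s) hx.1 fun y =>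
        (hw (a := (s, y)) (b := (t, y)) (by
          rw [Prod.dist_eq, dist_self, Real.dist_eq, max_eq_left (abs_nonneg _)]
          exact hst.trans_le (min_le_left _ _))).le).trans (by linarith [hn t x hx hmax])
  have hCdef : C / δ * deficit (fun y => w (s, y)) x ≤ ε / 2 := by
    refine (mul_le_mul_of_nonneg_left hdef (by positivity)).trans ?_
    linarith
  linarith [H.integral_truncatedSource_sub_le hδ hx.1 s,
    (abs_le.1 (hflux t s (hst.trans_le (min_le_right _ _)) x hx hmax)).1]

theorem integral_truncatedSource_eq (H : WeakBalance w B h R C) (δ : ℝ) :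
    ∫ p, truncatedSource w h δ p = ∫ s in (-R)..R, ∫ y, truncatedSource w h δ (s, y) := by
  rw [Measure.volume_eq_prod, integral_prod _ (H.integrable_truncatedSource δ)]
  refine (intervalIntegral.integral_eq_integral_of_support_subset fun s hs => ?_).symm
  have : |s| < R := by
    by_contra! hsR
    have (y : ℝ) : h (s, y) = 0 := H.h_eq_zero _ (hsR.trans (norm_fst_le (s, y)))
    exact hs (by simp [truncatedSource, this])
  exact ⟨(abs_lt.1 this).1, (abs_lt.1 this).2.le⟩

theorem integral_truncatedSource_le (H : WeakBalance w B h R C) (hR : 0 < R)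
    (hB : ∀ p, w p = 0 → B p = 0) {δ ε : ℝ} (hδ : 0 < δ) (hε : 0 < ε) :
    ∫ p, truncatedSource w h δ p ≤ 2 * R * ε := by
  obtain ⟨n, κ, hκ, hgrowth⟩ := H.exists_integral_truncatedSource_le_layerMass_sub hR hB hδ hε
  choose X hX hmax using fun t =>
    exists_isMaxOn_layerMass hR.le (H.continuous_slice_w t) (H.integrable_slice_w t) n
  set F : ℝ → ℝ := fun t => layerMass (fun y => w (t, y)) (X t) with hF
  have hint (a b : ℝ) :
      IntervalIntegrable (fun s => ∫ y, truncatedSource w h δ (s, y)) volume a b :=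
    (H.integrable_truncatedSource δ).integral_prod_left.intervalIntegrable
  have hle := intervalIntegral_le_sub_of_forall_lt (F := F) hκ
    (fun a b => (hint a b).sub intervalIntegrable_const) (fun t t' htt htκ =>
      (hgrowth t t' htt htκ (X t) (hX t) (hmax t)).trans (sub_le_sub_right (hmax t' (hX t)) _))
    (neg_le_self hR.le)
  have hzero (t : ℝ) (ht : R ≤ |t|) : F t = 0 := by
    have (y : ℝ) : w (t, y) = 0 := H.w_eq_zero _ (ht.trans (norm_fst_le (t, y)))
    simp [hF, layerMass, tailMass, this]
  rw [hzero R (le_abs_self R), hzero (-R) (by rw [abs_neg]; exact le_abs_self R),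
    intervalIntegral.integral_sub (hint _ _) intervalIntegrable_const,
    intervalIntegral.integral_const, smul_eq_mul, ← H.integral_truncatedSource_eq] at hle
  linarith

theorem tendsto_integral_truncatedSource (H : WeakBalance w B h R C)
    (h0 : ∀ᵐ p, w p = 0 → h p = 0) :
    Tendsto (fun δ => ∫ p, truncatedSource w h δ p) (𝓝[>] 0)
      (𝓝 (∫ p in {p | 0 < w p}, h p)) := by
  have hpos : MeasurableSet {p | 0 < w p} := H.continuous_w.measurable measurableSet_Ioi
  rw [← integral_indicator hpos]
  refine tendsto_integral_filter_of_dominated_convergence (fun p => |h p| + |h p|)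
    (Eventually.of_forall fun δ => (H.integrable_truncatedSource δ).aestronglyMeasurable)
    (Eventually.of_forall fun δ => ae_of_all _ fun p => ?_)
    (H.integrable_h.abs.add H.integrable_h.abs) ?_
  · refine (norm_sub_le _ _).trans (add_le_add ?_ ?_)
    · exact norm_indicator_le_norm_self _ _
    · exact (norm_indicator_le_norm_self _ _).trans (by simp)
  · filter_upwards [h0] with p hp
    by_cases hwp : w p = 0
    · simp [truncatedSource, hp hwp, indicator]
    · refine tendsto_const_nhds.congr' ?_
      filter_upwards [Ioo_mem_nhdsGT (abs_pos.2 hwp)] with δ hδ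
      have hnot : w p ∉ Icc (-δ) δ := fun h => absurd (abs_le.2 h) (not_le.2 hδ.2)
      rw [truncatedSource, indicator_of_notMem hnot, sub_zero]
      rfl

theorem setIntegral_pos_nonpos (H : WeakBalance w B h R C) (hR : 0 < R)
    (hB : ∀ p, w p = 0 → B p = 0) (h0 : ∀ᵐ p, w p = 0 → h p = 0) :
    ∫ p in {p | 0 < w p}, h p ≤ 0 := by
  refine le_of_tendsto (H.tendsto_integral_truncatedSource h0)
    (eventually_nhdsWithin_of_forall fun δ hδ => le_of_forall_pos_le_add fun ε hε => ?_)
  have := H.integral_truncatedSource_le hR hB hδ (ε := ε / (2 * R)) (by positivity)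
  rwa [mul_div_cancel₀ _ (by positivity), ← zero_add ε] at this

theorem neg (H : WeakBalance w B h R C) :
    WeakBalance (fun p => w (-p)) (fun p => B (-p)) (fun p => -h (-p)) R C where
  continuous_w := H.continuous_w.comp continuous_neg
  continuous_B := H.continuous_B.comp continuous_neg
  measurable_h := (H.measurable_h.comp measurable_neg).neg
  w_eq_zero p hp := H.w_eq_zero _ (by rwa [norm_neg])
  B_eq_zero p hp := H.B_eq_zero _ (by rwa [norm_neg])
  h_eq_zero p hp := by rw [H.h_eq_zero _ (by rwa [norm_neg]), neg_zero]
  bound p := by rw [abs_neg]; exact H.bound _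
  weak ψ hψ := by
    have hfderiv (p : ℝ × ℝ) : fderiv ℝ (fun p => ψ (-p)) p = -fderiv ℝ ψ (-p) := by
      simpa using fderiv_comp_smul (f := ψ) (x := p) (-1 : ℝ)
    have hweak := H.weak _ (hψ.comp contDiff_neg)
    simp only [Function.comp_def, partialT, partialX, hfderiv, neg_apply, neg_mul, ← neg_add,
      integral_neg, neg_inj] at hweak
    rw [← integral_neg_eq_self, ← integral_neg_eq_self (fun p => ψ p * _)]
    simp only [partialT, partialX, neg_neg, mul_neg, integral_neg, hweak]

/-- The lower bound is the upper bound for the balance reflected in time and space. -/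
theorem setIntegral_pos_eq_zero (H : WeakBalance w B h R C) (hR : 0 < R)
    (hB : ∀ p, w p = 0 → B p = 0) (h0 : ∀ᵐ p, w p = 0 → h p = 0) :
    ∫ p in {p | 0 < w p}, h p = 0 := by
  refine le_antisymm (H.setIntegral_pos_nonpos hR hB h0) ?_
  have h0' : ∀ᵐ p : ℝ × ℝ, w (-p) = 0 → -h (-p) = 0 := by
    filter_upwards [(Measure.measurePreserving_neg volume).quasiMeasurePreserving.ae h0]
      with p hp hwp
    rw [hp hwp, neg_zero]
  have hneg := H.neg.setIntegral_pos_nonpos hR (fun p hp => hB _ hp) h0'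
  have hpos : MeasurableSet {p | 0 < w p} := H.continuous_w.measurable measurableSet_Ioi
  have hset : {p | 0 < w (-p)} = Neg.neg ⁻¹' {p | 0 < w p} := rfl
  rw [integral_neg, hset, (Measure.measurePreserving_neg volume).setIntegral_preimage_emb
    (MeasurableEquiv.neg (ℝ × ℝ)).measurableEmbedding] at hneg
  linarith

end WeakBalance

/-! ### Test functions and weak integrands -/

section TestFunction

variable {Ω : Set (ℝ × ℝ)} {φ ψ A B h : ℝ × ℝ → ℝ} {p : ℝ × ℝ}

theorem partialT_eq_zero (hp : p ∉ tsupport φ) : partialT φ p = 0 := by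
  rw [partialT, fderiv_of_notMem_tsupport ℝ hp]; rfl

theorem partialX_eq_zero (hp : p ∉ tsupport φ) : partialX φ p = 0 := by
  rw [partialX, fderiv_of_notMem_tsupport ℝ hp]; rfl

theorem continuous_partialT (hφ : ContDiff ℝ 1 φ) : Continuous (partialT φ) :=
  (hφ.continuous_fderiv one_ne_zero).clm_apply continuous_const

theorem continuous_partialX (hφ : ContDiff ℝ 1 φ) : Continuous (partialX φ) :=
  (hφ.continuous_fderiv one_ne_zero).clm_apply continuous_const

theorem partialT_mul (hφ : DifferentiableAt ℝ φ p) (hψ : DifferentiableAt ℝ ψ p) :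
    partialT (fun q => φ q * ψ q) p = φ p * partialT ψ p + ψ p * partialT φ p := by
  rw [partialT, fderiv_fun_mul hφ hψ]; rfl

theorem partialX_mul (hφ : DifferentiableAt ℝ φ p) (hψ : DifferentiableAt ℝ ψ p) :
    partialX (fun q => φ q * ψ q) p = φ p * partialX ψ p + ψ p * partialX φ p := by
  rw [partialX, fderiv_fun_mul hφ hψ]; rfl

theorem partialT_add_const_mul (hφ : DifferentiableAt ℝ φ p) (hψ : DifferentiableAt ℝ ψ p)
    (c : ℝ) : partialT (fun q => φ q + c * ψ q) p = partialT φ p + c * partialT ψ p := by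
  rw [partialT, fderiv_fun_add hφ (hψ.const_mul c), fderiv_const_mul hψ]; rfl

theorem partialX_add_const_mul (hφ : DifferentiableAt ℝ φ p) (hψ : DifferentiableAt ℝ ψ p)
    (c : ℝ) : partialX (fun q => φ q + c * ψ q) p = partialX φ p + c * partialX ψ p := by
  rw [partialX, fderiv_fun_add hφ (hψ.const_mul c), fderiv_const_mul hψ]; rfl

theorem partialT_eq_zero_of_min (h0 : ∀ q, 0 ≤ φ q) (hp : φ p = 0) : partialT φ p = 0 := by
  have : IsLocalMin φ p := Eventually.of_forall fun q => hp.trans_le (h0 q)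
  rw [partialT, this.fderiv_eq_zero]; rfl

theorem partialX_eq_zero_of_min (h0 : ∀ q, 0 ≤ φ q) (hp : φ p = 0) : partialX φ p = 0 := by
  have : IsLocalMin φ p := Eventually.of_forall fun q => hp.trans_le (h0 q)
  rw [partialX, this.fderiv_eq_zero]; rfl

theorem integral_fderiv_apply_eq_zero {E : Type*} [NormedAddCommGroup E] [NormedSpace ℝ E]
    [FiniteDimensional ℝ E] [MeasurableSpace E] [BorelSpace E] {μ : Measure E}
    [μ.IsAddHaarMeasure] {χ : E → ℝ} (hχ : ContDiff ℝ 1 χ) (hc : HasCompactSupport χ) (v : E) :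
    ∫ p, fderiv ℝ χ p v ∂μ = 0 := by
  have hi : Integrable χ μ := hχ.continuous.integrable_of_hasCompactSupport hc
  have hi' : Integrable (fun p => fderiv ℝ χ p v) μ :=
    ((hχ.continuous_fderiv one_ne_zero).clm_apply
      continuous_const).integrable_of_hasCompactSupport (hc.fderiv_apply ℝ v)
  simpa using integral_mul_fderiv_eq_neg_fderiv_mul_of_integrable (𝕜 := ℝ) (μ := μ)
    (f := fun _ => (1 : ℝ)) (g := χ) (v := v) (by simp) (by simpa using hi') (by simpa using hi)
    (by simp) (fun p _ => hχ.differentiable one_ne_zero p)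

namespace IsTestFunction

theorem differentiableAt (hφ : IsTestFunction Ω φ) (p : ℝ × ℝ) : DifferentiableAt ℝ φ p :=
  hφ.smooth.differentiable (by simp) p

theorem integral_partialT (hφ : IsTestFunction Ω φ) : ∫ p, partialT φ p = 0 :=
  integral_fderiv_apply_eq_zero (hφ.smooth.of_le (by simp)) hφ.compact _

theorem integral_partialX (hφ : IsTestFunction Ω φ) : ∫ p, partialX φ p = 0 :=
  integral_fderiv_apply_eq_zero (hφ.smooth.of_le (by simp)) hφ.compact _

theorem eq_zero_of_notMem (hφ : IsTestFunction Ω φ) (hp : p ∉ Ω) : φ p = 0 :=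
  image_eq_zero_of_notMem_tsupport fun h => hp (hφ.support_subset h)

protected theorem partialT (hφ : IsTestFunction Ω φ) : IsTestFunction Ω (partialT φ) where
  smooth := (hφ.smooth.fderiv_right (m := ∞) (by simp)).clm_apply contDiff_const
  compact := hφ.compact.fderiv_apply ℝ _
  support_subset := (tsupport_fderiv_apply_subset ℝ _).trans hφ.support_subset

protected theorem partialX (hφ : IsTestFunction Ω φ) : IsTestFunction Ω (partialX φ) where
  smooth := (hφ.smooth.fderiv_right (m := ∞) (by simp)).clm_apply contDiff_const
  compact := hφ.compact.fderiv_apply ℝ _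
  support_subset := (tsupport_fderiv_apply_subset ℝ _).trans hφ.support_subset

theorem mul_smooth (hφ : IsTestFunction Ω φ) (hψ : ContDiff ℝ ∞ ψ) :
    IsTestFunction Ω fun p => φ p * ψ p where
  smooth := hφ.smooth.mul hψ
  compact := hφ.compact.mul_right
  support_subset := tsupport_mul_subset_left.trans hφ.support_subset

theorem add_const_mul (hφ : IsTestFunction Ω φ) (hψ : IsTestFunction Ω ψ) (c : ℝ) :
    IsTestFunction Ω fun p => φ p + c * ψ p where
  smooth := hφ.smooth.add (contDiff_const.mul hψ.smooth)
  compact := hφ.compact.add (hψ.compact.mul_left (f := fun _ => c))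
  support_subset := (tsupport_add _ _).trans <| union_subset hφ.support_subset <|
    (tsupport_mul_subset_right (f := fun _ => c)).trans hψ.support_subset

theorem integrable (hφ : IsTestFunction Ω φ) : Integrable φ :=
  hφ.smooth.continuous.integrable_of_hasCompactSupport hφ.compact

theorem continuous_mul (hφ : IsTestFunction Ω φ) (hΩ : IsOpen Ω) (hA : ContinuousOn A Ω) :
    Continuous fun p => φ p * A p :=
  (hφ.smooth.continuous.continuousOn.mul hA).continuous_of_tsupport_subset hΩ
    (tsupport_mul_subset_left.trans hφ.support_subset)

theorem integrable_mul (hφ : IsTestFunction Ω φ) (hA : LocallyIntegrableOn A Ω) :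
    Integrable fun p => φ p * A p := by
  rw [← integrableOn_iff_integrable_of_support_subset
    ((subset_tsupport _).trans (tsupport_mul_subset_left (f := φ)))]
  exact (hA.integrableOn_compact_subset hφ.support_subset hφ.compact).continuousOn_mul
    hφ.smooth.continuous.continuousOn hφ.compact

theorem exists_radius (hφ : IsTestFunction Ω φ) : ∃ R > 0, ∀ p, R ≤ ‖p‖ → p ∉ tsupport φ := by
  obtain ⟨R, hR0, hR⟩ := hφ.compact.isBounded.exists_pos_norm_le
  exact ⟨R + 1, by positivity, fun p hp h => by linarith [hR p h]⟩

theorem exists_nonneg_pos_on_tsupport (hΩ : IsOpen Ω) (hφ : IsTestFunction Ω φ) :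
    ∃ χ, IsTestFunction Ω χ ∧ (∀ p, 0 ≤ χ p) ∧ ∀ p ∈ tsupport φ, 0 < χ p := by
  obtain ⟨K, hK, hφK, hKΩ⟩ := exists_compact_between hφ.compact hΩ hφ.support_subset
  obtain ⟨χ, hχr, hχs, hχm⟩ := (isOpen_interior (s := K)).exists_contDiff_support_eq (n := ⊤)
  have hχ0 (p : ℝ × ℝ) : 0 ≤ χ p := (hχm (mem_range_self p)).1
  have hsupp : Function.support χ ⊆ K := hχr.trans_subset interior_subset
  exact ⟨χ, ⟨hχs, .of_support_subset_isCompact hK hsupp,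
    (closure_minimal hsupp hK.isClosed).trans hKΩ⟩, hχ0, fun p hp =>
    (hχ0 p).lt_of_ne' <| Function.mem_support.1 <| hχr ▸ hφK hp⟩

theorem exists_nonneg_add (hΩ : IsOpen Ω) (hφ : IsTestFunction Ω φ) :
    ∃ (χ : ℝ × ℝ → ℝ) (c : ℝ), IsTestFunction Ω χ ∧ (∀ p, 0 ≤ χ p) ∧
      ∀ p, 0 ≤ φ p + c * χ p := by
  obtain ⟨χ, hχ, hχ0, hpos⟩ := hφ.exists_nonneg_pos_on_tsupport hΩ
  obtain ⟨c, hc⟩ := hφ.compact.exists_bound_of_continuousOn (f := fun p => φ p / χ p)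
    (hφ.smooth.continuous.continuousOn.div hχ.smooth.continuous.continuousOn
      fun p hp => (hpos p hp).ne')
  refine ⟨χ, |c|, hχ, hχ0, fun p => ?_⟩
  by_cases hp : p ∈ tsupport φ
  · have : -|c| ≤ φ p / χ p :=
      (neg_le_neg ((hc p hp).trans (le_abs_self c))).trans (neg_abs_le _)
    linarith [(le_div_iff₀ (hpos p hp)).1 this]
  · rw [image_eq_zero_of_notMem_tsupport hp, zero_add]
    exact mul_nonneg (abs_nonneg c) (hχ0 p)

end IsTestFunction

/-- The integrand of the weak formulation of `∂ₜ A + ∂ₓ B = h` with test function `φ`. It is also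
the source of the balance satisfied by `φ A` and `φ B`. -/
noncomputable def weakIntegrand (φ A B h : ℝ × ℝ → ℝ) (p : ℝ × ℝ) : ℝ :=
  partialT φ p * A p + partialX φ p * B p + φ p * h p

theorem weakIntegrand_eq_zero (A B h : ℝ × ℝ → ℝ) (hp : p ∉ tsupport φ) :
    weakIntegrand φ A B h p = 0 := by
  simp [weakIntegrand, partialT_eq_zero hp, partialX_eq_zero hp,
    image_eq_zero_of_notMem_tsupport hp]

theorem weakIntegrand_eq_zero_of_min (A B h : ℝ × ℝ → ℝ) (h0 : ∀ q, 0 ≤ φ q) (hp : φ p = 0) :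
    weakIntegrand φ A B h p = 0 := by
  simp [weakIntegrand, partialT_eq_zero_of_min h0 hp, partialX_eq_zero_of_min h0 hp, hp]

theorem weakIntegrand_add_const_mul (A B h : ℝ × ℝ → ℝ) (hφ : DifferentiableAt ℝ φ p)
    (hψ : DifferentiableAt ℝ ψ p) (c : ℝ) :
    weakIntegrand (fun q => φ q + c * ψ q) A B h p =
      weakIntegrand φ A B h p + c * weakIntegrand ψ A B h p := by
  simp only [weakIntegrand, partialT_add_const_mul hφ hψ, partialX_add_const_mul hφ hψ]
  ring

theorem weakIntegrand_mul (A B h : ℝ × ℝ → ℝ) (hφ : DifferentiableAt ℝ φ p)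
    (hψ : DifferentiableAt ℝ ψ p) :
    weakIntegrand (fun q => φ q * ψ q) A B h p = partialT ψ p * (φ p * A p) +
      partialX ψ p * (φ p * B p) + ψ p * weakIntegrand φ A B h p := by
  simp only [weakIntegrand, partialT_mul hφ hψ, partialX_mul hφ hψ]
  ring

theorem IsTestFunction.integrable_weakIntegrand (hφ : IsTestFunction Ω φ)
    (hA : LocallyIntegrableOn A Ω) (hB : LocallyIntegrableOn B Ω) (hh : LocallyIntegrableOn h Ω) :
    Integrable (weakIntegrand φ A B h) :=
  ((hφ.partialT.integrable_mul hA).add (hφ.partialX.integrable_mul hB)).add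
    (hφ.integrable_mul hh)

theorem IsTestFunction.setIntegral_weakIntegrand (hφ : IsTestFunction Ω φ) (A B h : ℝ × ℝ → ℝ) :
    ∫ p in Ω, weakIntegrand φ A B h p = ∫ p, weakIntegrand φ A B h p :=
  setIntegral_eq_integral_of_forall_compl_eq_zero fun _ hp =>
    weakIntegrand_eq_zero A B h fun hp' => hp (hφ.support_subset hp')

theorem distribBalance_iff (hA : LocallyIntegrableOn A Ω) (hB : LocallyIntegrableOn B Ω)
    (hh : LocallyIntegrableOn h Ω) :
    DistribBalance Ω A B h ↔ ∀ φ, IsTestFunction Ω φ → ∫ p, weakIntegrand φ A B h p = 0 := by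
  refine forall₂_congr fun φ hφ => ?_
  rw [← hφ.setIntegral_weakIntegrand, eq_neg_iff_add_eq_zero, ← integral_add]
  · rfl
  · exact ((hφ.partialT.integrable_mul hA).add (hφ.partialX.integrable_mul hB)).integrableOn
  · exact (hφ.integrable_mul hh).integrableOn

theorem IsTestFunction.integrable_partial_mul_const (hφ : IsTestFunction Ω φ) (a b : ℝ) :
    Integrable fun p => partialT φ p * a + partialX φ p * b :=
  (hφ.partialT.integrable.mul_const a).add (hφ.partialX.integrable.mul_const b)

theorem IsTestFunction.integral_partial_mul_const (hφ : IsTestFunction Ω φ) (a b : ℝ) :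
    ∫ p, (partialT φ p * a + partialX φ p * b) = 0 := by
  rw [integral_add (hφ.partialT.integrable.mul_const a) (hφ.partialX.integrable.mul_const b),
    integral_mul_const, integral_mul_const, hφ.integral_partialT, hφ.integral_partialX]
  simp

theorem weakIntegrand_sub_const (φ A B h : ℝ × ℝ → ℝ) (a b : ℝ) (p : ℝ × ℝ) :
    weakIntegrand φ (fun q => A q - a) (fun q => B q - b) h p =
      weakIntegrand φ A B h p - (partialT φ p * a + partialX φ p * b) := by
  simp only [weakIntegrand]
  ring

theorem DistribBalance.sub_const (H : DistribBalance Ω A B h) (hA : LocallyIntegrableOn A Ω)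
    (hB : LocallyIntegrableOn B Ω) (hh : LocallyIntegrableOn h Ω) (a b : ℝ) :
    DistribBalance Ω (fun p => A p - a) (fun p => B p - b) h := by
  rw [distribBalance_iff hA hB hh] at H
  refine (distribBalance_iff (A := fun p => A p - a) (B := fun p => B p - b)
    (hA.sub ((locallyIntegrable_const a).locallyIntegrableOn Ω))
    (hB.sub ((locallyIntegrable_const b).locallyIntegrableOn Ω)) hh).2 fun φ hφ => ?_
  simp only [weakIntegrand_sub_const]
  rw [integral_sub (hφ.integrable_weakIntegrand hA hB hh)
    (hφ.integrable_partial_mul_const a b), H φ hφ, hφ.integral_partial_mul_const, sub_zero]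

theorem DistribBalance.congr_source {h' : ℝ × ℝ → ℝ} (H : DistribBalance Ω A B h)
    (hh : h =ᵐ[volume.restrict Ω] h') : DistribBalance Ω A B h' := fun φ hφ => by
  rw [H φ hφ, integral_congr_ae (hh.mono fun p hp => congrArg (φ p * ·) hp)]

theorem locallyIntegrableOn_of_memLp_top {S : Set (ℝ × ℝ)} {g : ℝ × ℝ → ℝ}
    (hg : MemLp g ⊤ (volume.restrict S)) : LocallyIntegrableOn g S :=
  locallyIntegrableOn_of_locallyIntegrable_restrict (hg.locallyIntegrable le_top)

theorem exists_measurable_bounded_ae_eq {α : Type*} [MeasurableSpace α] {μ : Measure α}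
    {g : α → ℝ} (hg : MemLp g ⊤ μ) :
    ∃ (g' : α → ℝ) (C : ℝ), Measurable g' ∧ (∀ p, |g' p| ≤ C) ∧ g =ᵐ[μ] g' := by
  obtain ⟨g₁, hg₁, hgg₁⟩ := hg.aestronglyMeasurable
  set C := lpNorm g ⊤ μ
  have hb : ∀ᵐ p ∂μ, ‖g p‖ ≤ C := ae_le_lpNorm_exponent_top hg
  have hC : 0 ≤ C := lpNorm_nonneg
  refine ⟨fun p => max (-C) (min (g₁ p) C), C,
    measurable_const.max (hg₁.measurable.min measurable_const), fun p => ?_, ?_⟩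
  · exact abs_le.2 ⟨le_max_left _ _, max_le (by linarith) (min_le_right _ _)⟩
  · filter_upwards [hgg₁, hb] with p h₁ h₂
    have := abs_le.1 h₂
    rw [← h₁, min_eq_left this.2, max_eq_right this.1]

end TestFunction

/-! ### The balance on superlevel sets -/

section Positivity

variable {Ω : Set (ℝ × ℝ)} {φ A B h : ℝ × ℝ → ℝ}

theorem IsTestFunction.exists_weakBalance (hφ : IsTestFunction Ω φ) (hΩ : IsOpen Ω)
    (hA : ContinuousOn A Ω) (hB : ContinuousOn B Ω) (hh : Measurable h) {C : ℝ}
    (hC : ∀ p, |h p| ≤ C) (H : DistribBalance Ω A B h) :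
    ∃ R > 0, ∃ D, WeakBalance (fun p => φ p * A p) (fun p => φ p * B p)
      (weakIntegrand φ A B h) R D := by
  have hhΩ : LocallyIntegrableOn h Ω := locallyIntegrableOn_of_memLp_top
    (memLp_top_of_bound hh.aestronglyMeasurable C (ae_of_all _ hC))
  have hAΩ : LocallyIntegrableOn A Ω := hA.locallyIntegrableOn hΩ.measurableSet
  have hBΩ : LocallyIntegrableOn B Ω := hB.locallyIntegrableOn hΩ.measurableSet
  rw [distribBalance_iff hAΩ hBΩ hhΩ] at H
  obtain ⟨R, hR0, hR⟩ := hφ.exists_radius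
  have hφA := hφ.continuous_mul hΩ hA
  have hφB := hφ.continuous_mul hΩ hB
  have hflux : Continuous fun p => partialT φ p * A p + partialX φ p * B p :=
    (hφ.partialT.continuous_mul hΩ hA).add (hφ.partialX.continuous_mul hΩ hB)
  obtain ⟨D₁, hD₁⟩ := (hφ.partialT.compact.mul_right.add
    hφ.partialX.compact.mul_right).exists_bound_of_continuous hflux
  obtain ⟨D₂, hD₂⟩ := hφ.compact.exists_bound_of_continuous hφ.smooth.continuous
  refine ⟨R, hR0, D₁ + D₂ * C, hφA, hφB,
    hflux.measurable.add (hφ.smooth.continuous.measurable.mul hh),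
    fun p hp => by simp [image_eq_zero_of_notMem_tsupport (hR p hp)],
    fun p hp => by simp [image_eq_zero_of_notMem_tsupport (hR p hp)],
    fun p hp => weakIntegrand_eq_zero A B h (hR p hp), fun p => ?_, fun ψ hψ => ?_⟩
  · refine (abs_add_le _ _).trans (add_le_add (hD₁ p) ?_)
    rw [abs_mul]
    exact mul_le_mul (hD₂ p) (hC p) (abs_nonneg _) ((norm_nonneg _).trans (hD₂ p))
  · have hψ₁ : ContDiff ℝ 1 ψ := hψ.of_le (by simp)
    have hX : Integrable fun p => partialT ψ p * (φ p * A p) + partialX ψ p * (φ p * B p) :=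
      (((continuous_partialT hψ₁).mul hφA).integrable_of_hasCompactSupport
        hφ.compact.mul_right.mul_left).add
      (((continuous_partialX hψ₁).mul hφB).integrable_of_hasCompactSupport
        hφ.compact.mul_right.mul_left)
    rw [← neg_eq_iff_eq_neg, ← zero_sub, ← H _ (hφ.mul_smooth hψ),
      ← integral_sub ((hφ.mul_smooth hψ).integrable_weakIntegrand hAΩ hBΩ hhΩ) hX]
    refine integral_congr_ae (ae_of_all _ fun p => ?_)
    simp only [weakIntegrand_mul A B h (hφ.differentiableAt p) (hψ.differentiable (by simp) p)]
    ring

theorem DistribBalance.setIntegral_pos_of_nonneg (H : DistribBalance Ω A B h) (hΩ : IsOpen Ω)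
    (hA : ContinuousOn A Ω) (hB : ContinuousOn B Ω) (hh : MemLp h ⊤ (volume.restrict Ω))
    (hAB : ∀ p ∈ Ω, A p = 0 → B p = 0) (hA0 : ∀ᵐ p ∂volume.restrict Ω, A p ≠ 0)
    (hφ : IsTestFunction Ω φ) (hφ0 : ∀ p, 0 ≤ φ p) :
    ∫ p in Ω ∩ {p | 0 < A p}, weakIntegrand φ A B h p = 0 := by
  obtain ⟨h', C, hm, hC, hhh'⟩ := exists_measurable_bounded_ae_eq hh
  obtain ⟨R, hR, D, W⟩ :=
    hφ.exists_weakBalance hΩ hA hB hm hC (H.congr_source hhh')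
  have hpos : MeasurableSet (Ω ∩ {p | 0 < A p}) :=
    (hA.isOpen_inter_preimage hΩ isOpen_Ioi).measurableSet
  have hcongr : ∫ p in Ω ∩ {p | 0 < A p}, weakIntegrand φ A B h p =
      ∫ p in Ω ∩ {p | 0 < A p}, weakIntegrand φ A B h' p := by
    refine setIntegral_congr_ae hpos ?_
    filter_upwards [(ae_restrict_iff' hΩ.measurableSet).1 hhh'] with p hp hpA
    simp only [weakIntegrand, hp hpA.1]
  have hz {p : ℝ × ℝ} (hp : φ p = 0) : weakIntegrand φ A B h' p = 0 :=
    weakIntegrand_eq_zero_of_min A B h' hφ0 hp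
  rw [hcongr]
  refine Eq.trans ?_ (W.setIntegral_pos_eq_zero hR ?_ ?_)
  · refine setIntegral_eq_of_subset_of_forall_sdiff_eq_zero hpos (fun p hp => ?_) fun p hp => ?_
    · refine ⟨by_contra fun hpΩ => ?_, pos_of_mul_pos_right hp (hφ0 p)⟩
      simp [hφ.eq_zero_of_notMem hpΩ] at hp
    · refine hz ((hφ0 p).eq_or_lt'.resolve_right fun hφp => hp.2 (mul_pos hφp hp.1.2))
  · intro p hp
    by_cases hpΩ : p ∈ Ω
    · rcases mul_eq_zero.1 hp with hp | hp
      · simp [hp]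
      · simp [hAB p hpΩ hp]
    · simp [hφ.eq_zero_of_notMem hpΩ]
  · filter_upwards [(ae_restrict_iff' hΩ.measurableSet).1 hA0] with p hp hφp
    by_contra hne
    have hpΩ : p ∈ Ω := by_contra fun hpΩ => hne (hz (hφ.eq_zero_of_notMem hpΩ))
    exact hne (hz ((mul_eq_zero.1 hφp).resolve_right (hp hpΩ)))

theorem DistribBalance.setIntegral_pos (H : DistribBalance Ω A B h) (hΩ : IsOpen Ω)
    (hA : ContinuousOn A Ω) (hB : ContinuousOn B Ω) (hh : MemLp h ⊤ (volume.restrict Ω))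
    (hAB : ∀ p ∈ Ω, A p = 0 → B p = 0) (hA0 : ∀ᵐ p ∂volume.restrict Ω, A p ≠ 0)
    (hφ : IsTestFunction Ω φ) : ∫ p in Ω ∩ {p | 0 < A p}, weakIntegrand φ A B h p = 0 := by
  obtain ⟨χ, c, hχ, hχ0, hφχ⟩ := hφ.exists_nonneg_add hΩ
  have hint {ψ : ℝ × ℝ → ℝ} (hψ : IsTestFunction Ω ψ) :
      IntegrableOn (weakIntegrand ψ A B h) (Ω ∩ {p | 0 < A p}) :=
    (hψ.integrable_weakIntegrand (hA.locallyIntegrableOn hΩ.measurableSet)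
      (hB.locallyIntegrableOn hΩ.measurableSet)
      (locallyIntegrableOn_of_memLp_top hh)).integrableOn
  have hsum := H.setIntegral_pos_of_nonneg hΩ hA hB hh hAB hA0 (hφ.add_const_mul hχ c) hφχ
  simp only [weakIntegrand_add_const_mul A B h (hφ.differentiableAt _) (hχ.differentiableAt _)]
    at hsum
  rwa [integral_add (hint hφ) ((hint hχ).const_mul c), integral_const_mul,
    H.setIntegral_pos_of_nonneg hΩ hA hB hh hAB hA0 hχ hχ0, mul_zero, add_zero] at hsum

end Positivity

/-! ### Kruzkov's equality -/

theorem measurable_real_sign : Measurable Real.sign :=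
  Measurable.ite measurableSet_Iio measurable_const
    (Measurable.ite measurableSet_Ioi measurable_const measurable_const)

theorem abs_real_sign_le_one (x : ℝ) : |Real.sign x| ≤ 1 := by
  rcases Real.sign_apply_eq x with h | h | h <;> simp [h]

theorem real_sign_mul_self (x : ℝ) : Real.sign x * x = |x| := by
  rcases lt_trichotomy x 0 with h | h | h
  · rw [Real.sign_of_neg h, abs_of_neg h, neg_one_mul]
  · simp [h]
  · rw [Real.sign_of_pos h, abs_of_pos h, one_mul]

/-- The entropy flux `sgn (a - b) (f a - f b)` of Kruzkov's entropy `|a - b|`. -/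
noncomputable def kruzkovFlux (f : ℝ → ℝ) (a b : ℝ) : ℝ := Real.sign (a - b) * (f a - f b)

theorem kruzkovFlux_eq_sub (f : ℝ → ℝ) (a b : ℝ) :
    kruzkovFlux f a b = f (max a b) - f (min a b) := by
  rw [kruzkovFlux]
  rcases lt_trichotomy a b with h | h | h
  · rw [Real.sign_of_neg (sub_neg.2 h), max_eq_right h.le, min_eq_left h.le]; ring
  · simp [h]
  · rw [Real.sign_of_pos (sub_pos.2 h), max_eq_left h.le, min_eq_right h.le, one_mul]

theorem kruzkovFlux_comm (f : ℝ → ℝ) (a b : ℝ) : kruzkovFlux f a b = kruzkovFlux f b a := by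
  rw [kruzkovFlux_eq_sub, kruzkovFlux_eq_sub, max_comm, min_comm]

theorem continuous_kruzkovFlux {f : ℝ → ℝ} (hf : Continuous f) :
    Continuous fun z : ℝ × ℝ => kruzkovFlux f z.1 z.2 := by
  simp only [kruzkovFlux_eq_sub]
  fun_prop

/-- The integrand of the weak formulation of the balance law for `u - k`. -/
noncomputable def levelIntegrand (f : ℝ → ℝ) (g u φ : ℝ × ℝ → ℝ) (k : ℝ) : ℝ × ℝ → ℝ :=
  weakIntegrand φ (fun p => u p - k) (fun p => f (u p) - f k) g

theorem levelIntegrand_eq_sub (f : ℝ → ℝ) (g u φ : ℝ × ℝ → ℝ) (k : ℝ) (p : ℝ × ℝ) :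
    levelIntegrand f g u φ k p = weakIntegrand φ u (fun q => f (u q)) g p -
      (partialT φ p * k + partialX φ p * f k) :=
  weakIntegrand_sub_const ..

namespace IsContinuousDistribSolution

variable {f : ℝ → ℝ} {g u φ : ℝ × ℝ → ℝ} {Ω : Set (ℝ × ℝ)}

theorem locallyIntegrableOn_comp (H : IsContinuousDistribSolution f g Ω u) (hΩ : IsOpen Ω)
    {F : ℝ → ℝ} (hF : Continuous F) : LocallyIntegrableOn (fun p => F (u p)) Ω :=
  (hF.comp_continuousOn H.continuousOn).locallyIntegrableOn hΩ.measurableSet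

theorem aemeasurable (H : IsContinuousDistribSolution f g Ω u) (hΩ : IsOpen Ω) :
    AEMeasurable u (volume.restrict Ω) :=
  H.continuousOn.aemeasurable hΩ.measurableSet

theorem measurableSet_lt (H : IsContinuousDistribSolution f g Ω u) (hΩ : IsOpen Ω)
    (k : ℝ) : MeasurableSet (Ω ∩ {p | k < u p}) :=
  (H.continuousOn.isOpen_inter_preimage hΩ isOpen_Ioi).measurableSet

theorem measurableSet_le (H : IsContinuousDistribSolution f g Ω u) (hΩ : IsOpen Ω)
    (k : ℝ) : MeasurableSet (Ω ∩ {p | k ≤ u p}) := by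
  convert hΩ.measurableSet.diff
    (H.continuousOn.isOpen_inter_preimage hΩ (isOpen_Iio (a := k))).measurableSet using 1
  ext p
  simp +contextual

theorem distribBalance_sub_const (H : IsContinuousDistribSolution f g Ω u) (hΩ : IsOpen Ω)
    (hf : Continuous f) (k : ℝ) :
    DistribBalance Ω (fun p => u p - k) (fun p => f (u p) - f k) g :=
  H.equation.sub_const (H.locallyIntegrableOn_comp hΩ continuous_id)
    (H.locallyIntegrableOn_comp hΩ hf) (locallyIntegrableOn_of_memLp_top H.source) k (f k)

theorem integrable_levelIntegrand (H : IsContinuousDistribSolution f g Ω u) (hΩ : IsOpen Ω)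
    (hf : Continuous f) (hφ : IsTestFunction Ω φ) (k : ℝ) :
    Integrable (levelIntegrand f g u φ k) :=
  hφ.integrable_weakIntegrand
    (H.locallyIntegrableOn_comp hΩ (F := fun z => z - k) (by fun_prop))
    (H.locallyIntegrableOn_comp hΩ (F := fun z => f z - f k) (by fun_prop))
    (locallyIntegrableOn_of_memLp_top H.source)

theorem integral_levelIntegrand (H : IsContinuousDistribSolution f g Ω u) (hΩ : IsOpen Ω)
    (hf : Continuous f) (hφ : IsTestFunction Ω φ) (k : ℝ) :
    ∫ p, levelIntegrand f g u φ k p = 0 :=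
  (distribBalance_iff (H.locallyIntegrableOn_comp hΩ (F := fun z => z - k) (by fun_prop))
    (H.locallyIntegrableOn_comp hΩ (F := fun z => f z - f k) (by fun_prop))
    (locallyIntegrableOn_of_memLp_top H.source)).1 (H.distribBalance_sub_const hΩ hf k) φ hφ

theorem dense_null_level (H : IsContinuousDistribSolution f g Ω u) (hΩ : IsOpen Ω) :
    Dense {k | volume.restrict Ω {p | u p = k} = 0} := by
  convert (Measure.countable_meas_level_set_pos₀
    (H.aemeasurable hΩ).nullMeasurable).dense_compl ℝ using 1
  ext k
  simp

theorem setIntegral_levelIntegrand_of_null_level (H : IsContinuousDistribSolution f g Ω u)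
    (hΩ : IsOpen Ω) (hf : Continuous f) (hφ : IsTestFunction Ω φ) {k : ℝ}
    (hk : volume.restrict Ω {p | u p = k} = 0) :
    ∫ p in Ω ∩ {p | k < u p}, levelIntegrand f g u φ k p = 0 := by
  have := (H.distribBalance_sub_const hΩ hf k).setIntegral_pos hΩ
    (H.continuousOn.sub continuousOn_const)
    ((hf.comp_continuousOn H.continuousOn).sub continuousOn_const) H.source
    (fun p _ hp => by rw [sub_eq_zero.1 hp, sub_self])
    (by simpa [ae_iff, sub_eq_zero] using hk) hφ
  simpa only [sub_pos, levelIntegrand] using this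

theorem tendsto_setIntegral_levelIntegrand (H : IsContinuousDistribSolution f g Ω u)
    (hΩ : IsOpen Ω) (hf : Continuous f) (hφ : IsTestFunction Ω φ) {κ : ℕ → ℝ} {k : ℝ}
    (hκ : Tendsto κ atTop (𝓝 k)) {S : Set (ℝ × ℝ)} (hS : MeasurableSet S)
    (hκS : ∀ p, ∀ᶠ n in atTop, p ∈ Ω ∩ {p | κ n < u p} ↔ p ∈ S) :
    Tendsto (fun n => ∫ p in Ω ∩ {p | κ n < u p}, levelIntegrand f g u φ (κ n) p) atTop
      (𝓝 (∫ p in S, levelIntegrand f g u φ k p)) := by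
  have hfκ : Tendsto (fun n => f (κ n)) atTop (𝓝 (f k)) := (hf.tendsto k).comp hκ
  obtain ⟨K, hK⟩ := hκ.norm.bddAbove_range
  obtain ⟨F, hF⟩ := hfκ.norm.bddAbove_range
  have hbase : Integrable (weakIntegrand φ u (fun q => f (u q)) g) :=
    hφ.integrable_weakIntegrand (H.locallyIntegrableOn_comp hΩ continuous_id)
      (H.locallyIntegrableOn_comp hΩ hf) (locallyIntegrableOn_of_memLp_top H.source)
  simp only [← integral_indicator (H.measurableSet_lt hΩ _), ← integral_indicator hS]
  refine tendsto_integral_of_dominated_convergence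
    (fun p => ‖weakIntegrand φ u (fun q => f (u q)) g p‖ +
      (‖partialT φ p‖ * K + ‖partialX φ p‖ * F))
    (fun n => ((H.integrable_levelIntegrand hΩ hf hφ (κ n)).indicator
      (H.measurableSet_lt hΩ _)).aestronglyMeasurable)
    (hbase.norm.add ((hφ.partialT.integrable.norm.mul_const K).add
      (hφ.partialX.integrable.norm.mul_const F))) (fun n => ae_of_all _ fun p => ?_)
    (ae_of_all _ fun p => ?_)
  · refine (norm_indicator_le_norm_self _ _).trans ?_
    rw [levelIntegrand_eq_sub]
    refine (norm_sub_le _ _).trans (add_le_add_right ((norm_add_le _ _).trans ?_) _)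
    rw [norm_mul, norm_mul]
    gcongr
    exacts [hK (mem_range_self n), hF (mem_range_self n)]
  · have hlim : Tendsto (fun n => levelIntegrand f g u φ (κ n) p) atTop
        (𝓝 (levelIntegrand f g u φ k p)) := by
      simp only [levelIntegrand_eq_sub]
      exact tendsto_const_nhds.sub ((hκ.const_mul _).add (hfκ.const_mul _))
    by_cases hp : p ∈ S
    · rw [indicator_of_mem hp]
      refine hlim.congr' ?_
      filter_upwards [hκS p] with n hn
      rw [indicator_of_mem (hn.2 hp)]
    · rw [indicator_of_notMem hp]
      refine tendsto_const_nhds.congr' ?_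
      filter_upwards [hκS p] with n hn
      rw [indicator_of_notMem (mt hn.1 hp)]

theorem setIntegral_levelIntegrand_lt (H : IsContinuousDistribSolution f g Ω u)
    (hΩ : IsOpen Ω) (hf : Continuous f) (hφ : IsTestFunction Ω φ) (k : ℝ) :
    ∫ p in Ω ∩ {p | k < u p}, levelIntegrand f g u φ k p = 0 := by
  obtain ⟨κ, -, hκ, hlim⟩ := (H.dense_null_level hΩ).exists_seq_strictAnti_tendsto k
  refine tendsto_nhds_unique (H.tendsto_setIntegral_levelIntegrand hΩ hf hφ hlim
    (H.measurableSet_lt hΩ k) fun p => ?_) (tendsto_const_nhds.congr fun n =>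
    (H.setIntegral_levelIntegrand_of_null_level hΩ hf hφ (hκ n).2).symm)
  rcases lt_or_ge k (u p) with hp | hp
  · filter_upwards [hlim.eventually_lt_const hp] with n hn
    simp [hp, hn]
  · filter_upwards with n
    simp [hp.not_gt, (hp.trans (hκ n).1.le).not_gt]

theorem setIntegral_levelIntegrand_le (H : IsContinuousDistribSolution f g Ω u)
    (hΩ : IsOpen Ω) (hf : Continuous f) (hφ : IsTestFunction Ω φ) (k : ℝ) :
    ∫ p in Ω ∩ {p | k ≤ u p}, levelIntegrand f g u φ k p = 0 := by
  obtain ⟨κ, -, hκ, hlim⟩ := (H.dense_null_level hΩ).exists_seq_strictMono_tendsto k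
  refine tendsto_nhds_unique (H.tendsto_setIntegral_levelIntegrand hΩ hf hφ hlim
    (H.measurableSet_le hΩ k) fun p => ?_) (tendsto_const_nhds.congr fun n =>
    (H.setIntegral_levelIntegrand_of_null_level hΩ hf hφ (hκ n).2).symm)
  rcases le_or_gt k (u p) with hp | hp
  · filter_upwards with n
    simp [hp, (hκ n).1.trans_le hp]
  · filter_upwards [hlim.eventually_const_lt hp] with n hn
    simp [hp.not_ge, hn.not_gt]

theorem memLp_sign_mul (H : IsContinuousDistribSolution f g Ω u) (hΩ : IsOpen Ω) (k : ℝ) :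
    MemLp (fun p => Real.sign (u p - k) * g p) ⊤ (volume.restrict Ω) := by
  refine H.source.of_le ((measurable_real_sign.comp_aemeasurable
    ((H.aemeasurable hΩ).sub_const k)).aestronglyMeasurable.mul H.source.1)
    (ae_of_all _ fun p => ?_)
  rw [norm_mul]
  exact mul_le_of_le_one_left (norm_nonneg _) (abs_real_sign_le_one _)

theorem distribBalance_kruzkov (H : IsContinuousDistribSolution f g Ω u) (hΩ : IsOpen Ω)
    (hf : Continuous f) (k : ℝ) :
    DistribBalance Ω (fun p => |u p - k|) (fun p => kruzkovFlux f (u p) k)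
      (fun p => Real.sign (u p - k) * g p) := by
  refine (distribBalance_iff (H.locallyIntegrableOn_comp hΩ (F := fun z => |z - k|)
    (by fun_prop)) (H.locallyIntegrableOn_comp hΩ (F := fun z => kruzkovFlux f z k)
    ((continuous_kruzkovFlux hf).comp (by fun_prop : Continuous fun z : ℝ => (z, k))))
    (locallyIntegrableOn_of_memLp_top (H.memLp_sign_mul hΩ k))).2 fun φ hφ => ?_
  have hsplit (p : ℝ × ℝ) : weakIntegrand φ (fun p => |u p - k|)
      (fun p => kruzkovFlux f (u p) k) (fun p => Real.sign (u p - k) * g p) p =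
      (Ω ∩ {p | k < u p}).indicator (levelIntegrand f g u φ k) p +
      (Ω ∩ {p | k ≤ u p}).indicator (levelIntegrand f g u φ k) p -
      levelIntegrand f g u φ k p := by
    by_cases hp : p ∈ Ω
    · rcases lt_trichotomy (u p) k with h | h | h
      · simp [hp, h.not_gt, h.not_ge, weakIntegrand, levelIntegrand, kruzkovFlux,
          ← real_sign_mul_self, Real.sign_of_neg (sub_neg.2 h)]
        ring
      · simp [hp, h, weakIntegrand, levelIntegrand, kruzkovFlux]
      · simp [hp, h, h.le, weakIntegrand, levelIntegrand, kruzkovFlux,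
          ← real_sign_mul_self, Real.sign_of_pos (sub_pos.2 h)]
    · have hp' : p ∉ tsupport φ := fun h => hp (hφ.support_subset h)
      simp [hp, levelIntegrand, weakIntegrand_eq_zero _ _ _ hp']
  have hi := H.integrable_levelIntegrand hΩ hf hφ k
  have hlt := H.measurableSet_lt hΩ k
  have hle := H.measurableSet_le hΩ k
  have hadd : Integrable fun p => (Ω ∩ {p | k < u p}).indicator (levelIntegrand f g u φ k) p +
      (Ω ∩ {p | k ≤ u p}).indicator (levelIntegrand f g u φ k) p :=
    (hi.indicator hlt).add (hi.indicator hle)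
  simp only [hsplit]
  rw [integral_sub hadd hi,
    integral_add (hi.indicator hlt) (hi.indicator hle), integral_indicator hlt,
    integral_indicator hle, H.setIntegral_levelIntegrand_lt hΩ hf hφ,
    H.setIntegral_levelIntegrand_le hΩ hf hφ, H.integral_levelIntegrand hΩ hf hφ]
  simp

end IsContinuousDistribSolution

/-! ### General entropies -/

theorem integral_deriv_mul_sub {e F F' Q : ℝ → ℝ} (he : ContDiff ℝ 1 e)
    (hF : ∀ z, HasDerivAt F (F' z) z) (hQ : ∀ z, HasDerivAt Q (e z * F' z) z) (a z : ℝ) :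
    ∫ k in a..z, deriv e k * (F z - F k) = Q z - Q a - e a * (F z - F a) := by
  have hderiv (k : ℝ) : HasDerivAt (fun k => e k * (F z - F k) + Q k)
      (deriv e k * (F z - F k)) k := by
    refine (((he.differentiable one_ne_zero k).hasDerivAt.mul
      ((hF k).const_sub (F z))).add (hQ k)).congr_deriv ?_
    ring
  have hFc : Continuous F := continuous_iff_continuousAt.2 fun k => (hF k).continuousAt
  have := he.continuous_deriv le_rfl
  rw [intervalIntegral.integral_eq_sub_of_hasDerivAt (fun k _ => hderiv k)
    (Continuous.intervalIntegrable (by fun_prop) _ _)]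
  ring

theorem setIntegral_indicator_Iio {a b z : ℝ} (hz : z ∈ Icc a b) (h : ℝ → ℝ) :
    ∫ k in Ioc a b, (Iio z).indicator h k = ∫ k in a..z, h k := by
  have hset : Ioc a b ∩ Iio z = Ioo a z := by
    ext k
    simp only [mem_inter_iff, mem_Ioc, mem_Iio, mem_Ioo]
    exact ⟨fun hk => ⟨hk.1.1, hk.2⟩, fun hk => ⟨⟨hk.1, hk.2.le.trans hz.2⟩, hk.2⟩⟩
  rw [setIntegral_indicator measurableSet_Iio, hset, intervalIntegral.integral_of_le hz.1,
    integral_Ioc_eq_integral_Ioo]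

namespace IsContinuousDistribSolution

variable {f e η q : ℝ → ℝ} {g u φ : ℝ × ℝ → ℝ} {Ω : Set (ℝ × ℝ)}

theorem integrable_prod_levelIntegrand (H : IsContinuousDistribSolution f g Ω u) (hΩ : IsOpen Ω)
    (hf : Continuous f) (hφ : IsTestFunction Ω φ) {a : ℝ → ℝ} (ha : Continuous a) (M : ℝ) :
    Integrable (fun z : ℝ × ℝ × ℝ => a z.1 *
      (Ω ∩ {p | z.1 < u p}).indicator (levelIntegrand f g u φ z.1) z.2)
      ((volume.restrict (Ioc (-M) M)).prod volume) := by
  have hint {b : ℝ → ℝ} (hb : Continuous b) : Integrable b (volume.restrict (Ioc (-M) M)) :=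
    hb.integrableOn_Ioc
  have hw : Integrable (weakIntegrand φ u (fun q => f (u q)) g) :=
    hφ.integrable_weakIntegrand (H.locallyIntegrableOn_comp hΩ continuous_id)
      (H.locallyIntegrableOn_comp hΩ hf) (locallyIntegrableOn_of_memLp_top H.source)
  have hset : MeasurableSet {z : ℝ × ℝ × ℝ | z.2 ∈ Ω ∩ {p | z.1 < u p}} := by
    convert ((ContinuousOn.sub (H.continuousOn.comp continuousOn_snd fun _ hz => hz.2)
      continuousOn_fst).isOpen_inter_preimage (isOpen_univ.prod hΩ)
      (isOpen_Ioi (a := (0 : ℝ)))).measurableSet using 1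
    ext z
    simp
  refine ((((hint ha).mul_prod hw).sub (((hint (ha.mul continuous_id)).mul_prod
    hφ.partialT.integrable).add ((hint (ha.mul hf)).mul_prod hφ.partialX.integrable))).indicator
    hset).congr (ae_of_all _ fun z => ?_)
  by_cases hz : z.2 ∈ Ω ∩ {p | z.1 < u p}
  · refine (indicator_of_mem (by exact hz) _).trans ?_
    simp only [indicator_of_mem hz, levelIntegrand_eq_sub, Pi.sub_apply, Pi.add_apply,
      Pi.mul_apply, id]
    ring
  · refine (indicator_of_notMem (by exact hz) _).trans ?_
    simp only [indicator_of_notMem hz, mul_zero]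

theorem intervalIntegral_mul_levelIntegrand_eq (hf : ContDiff ℝ 1 f) (he : ContDiff ℝ 1 e)
    (hη : ∀ z, HasDerivAt η (e z) z) (hq : ∀ z, HasDerivAt q (e z * deriv f z) z)
    (g u φ : ℝ × ℝ → ℝ) (a : ℝ) (p : ℝ × ℝ) :
    ∫ k in a..u p, deriv e k * levelIntegrand f g u φ k p =
      weakIntegrand φ (fun p => η (u p)) (fun p => q (u p)) (fun p => e (u p) * g p) p -
        (partialT φ p * η a + partialX φ p * q a) - e a * levelIntegrand f g u φ a p := by
  have hec := he.continuous_deriv le_rfl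
  have hfc := hf.continuous
  have hint {b : ℝ → ℝ} (hb : Continuous b) : IntervalIntegrable b volume a (u p) :=
    hb.intervalIntegrable _ _
  have hentropy := integral_deriv_mul_sub he (fun z => hasDerivAt_id z) (Q := η)
    (by simpa using hη) a (u p)
  have hflux := integral_deriv_mul_sub he
    (fun z => (hf.differentiable one_ne_zero z).hasDerivAt) hq a (u p)
  have hsource : ∫ k in a..u p, deriv e k = e (u p) - e a :=
    intervalIntegral.integral_deriv_eq_sub (fun z _ => he.differentiable one_ne_zero z)
      (hint hec)
  have hexp (k : ℝ) : deriv e k * levelIntegrand f g u φ k p =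
      partialT φ p * (deriv e k * (id (u p) - id k)) +
      partialX φ p * (deriv e k * (f (u p) - f k)) + φ p * g p * deriv e k := by
    simp only [levelIntegrand, weakIntegrand, id]
    ring
  simp only [hexp]
  rw [intervalIntegral.integral_add (hint (by fun_prop)) (hint (by fun_prop)),
    intervalIntegral.integral_add (hint (by fun_prop)) (hint (by fun_prop)),
    intervalIntegral.integral_const_mul, intervalIntegral.integral_const_mul,
    intervalIntegral.integral_const_mul, hentropy, hflux, hsource]
  simp only [levelIntegrand, weakIntegrand, id]
  ring

theorem integral_mul_levelIntegrand_eq (hφ : IsTestFunction Ω φ) (hf : ContDiff ℝ 1 f)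
    (he : ContDiff ℝ 1 e) (hη : ∀ z, HasDerivAt η (e z) z)
    (hq : ∀ z, HasDerivAt q (e z * deriv f z) z) {M : ℝ} {p : ℝ × ℝ}
    (hM : p ∈ tsupport φ → |u p| ≤ M) :
    ∫ k in Ioc (-M) M, deriv e k *
        (Ω ∩ {p | k < u p}).indicator (levelIntegrand f g u φ k) p =
      weakIntegrand φ (fun p => η (u p)) (fun p => q (u p)) (fun p => e (u p) * g p) p -
        (partialT φ p * η (-M) + partialX φ p * q (-M)) -
        e (-M) * levelIntegrand f g u φ (-M) p := by
  by_cases hp : p ∈ tsupport φ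
  · rw [← intervalIntegral_mul_levelIntegrand_eq hf he hη hq,
      ← setIntegral_indicator_Iio (abs_le.1 (hM hp))]
    congr with k
    by_cases hk : k < u p <;> simp [hφ.support_subset hp, hk]
  · have hl (k : ℝ) : levelIntegrand f g u φ k p = 0 := weakIntegrand_eq_zero _ _ _ hp
    have hlΩ (k : ℝ) : (Ω ∩ {p | k < u p}).indicator (levelIntegrand f g u φ k) p = 0 :=
      indicator_apply_eq_zero.2 fun _ => hl k
    simp only [hl, hlΩ, weakIntegrand_eq_zero _ _ _ hp, partialT_eq_zero hp, partialX_eq_zero hp]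
    simp

theorem exists_abs_le_on_tsupport (H : IsContinuousDistribSolution f g Ω u)
    (hφ : IsTestFunction Ω φ) : ∃ M, ∀ p ∈ tsupport φ, |u p| ≤ M :=
  hφ.compact.exists_bound_of_continuousOn (H.continuousOn.mono hφ.support_subset)

theorem integrable_weakIntegrand_comp (H : IsContinuousDistribSolution f g Ω u) (hΩ : IsOpen Ω)
    (hφ : IsTestFunction Ω φ) (hη : Continuous η) (hq : Continuous q) (he : Continuous e) :
    Integrable (weakIntegrand φ (fun p => η (u p)) (fun p => q (u p))
      (fun p => e (u p) * g p)) :=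
  hφ.integrable_weakIntegrand (H.locallyIntegrableOn_comp hΩ hη) (H.locallyIntegrableOn_comp hΩ hq)
    ((locallyIntegrableOn_of_memLp_top H.source).continuousOn_mul
      (he.comp_continuousOn H.continuousOn) hΩ.isLocallyClosed)

/-- The superposition, with weight `e'(k)`, of the balances on the superlevel sets `{k < u}`. -/
theorem integral_weakIntegrand_of_contDiff_deriv (H : IsContinuousDistribSolution f g Ω u)
    (hΩ : IsOpen Ω) (hf : ContDiff ℝ 1 f) (hφ : IsTestFunction Ω φ) (he : ContDiff ℝ 1 e)
    (hη : ∀ z, HasDerivAt η (e z) z) (hq : ∀ z, HasDerivAt q (e z * deriv f z) z) :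
    ∫ p, weakIntegrand φ (fun p => η (u p)) (fun p => q (u p)) (fun p => e (u p) * g p) p = 0 := by
  obtain ⟨M, hM⟩ := H.exists_abs_le_on_tsupport hφ
  have hint := H.integrable_weakIntegrand_comp hΩ hφ
    (continuous_iff_continuousAt.2 fun z => (hη z).continuousAt)
    (continuous_iff_continuousAt.2 fun z => (hq z).continuousAt) he.continuous
  have hconst := hφ.integrable_partial_mul_const (η (-M)) (q (-M))
  have hsub : Integrable fun p => weakIntegrand φ (fun p => η (u p)) (fun p => q (u p))
      (fun p => e (u p) * g p) p - (partialT φ p * η (-M) + partialX φ p * q (-M)) :=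
    hint.sub hconst
  have hlevel := (H.integrable_levelIntegrand hΩ hf.continuous hφ (-M)).const_mul (e (-M))
  have hzero : ∫ k in Ioc (-M) M, ∫ p, deriv e k *
      (Ω ∩ {p | k < u p}).indicator (levelIntegrand f g u φ k) p = 0 := by
    simp [integral_const_mul, integral_indicator (H.measurableSet_lt hΩ _),
      H.setIntegral_levelIntegrand_lt hΩ hf.continuous hφ]
  rw [integral_integral_swap (H.integrable_prod_levelIntegrand hΩ hf.continuous hφ
    (he.continuous_deriv le_rfl) M)] at hzero
  simp only [integral_mul_levelIntegrand_eq hφ hf he hη hq (hM _)] at hzero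
  rwa [integral_sub hsub hlevel, integral_sub hint hconst, integral_const_mul,
    H.integral_levelIntegrand hΩ hf.continuous hφ, hφ.integral_partial_mul_const, mul_zero,
    sub_zero, sub_zero] at hzero

end IsContinuousDistribSolution

theorem abs_sub_le_of_hasDerivAt {F F' G G' : ℝ → ℝ} {M C : ℝ}
    (hF : ∀ z, HasDerivAt F (F' z) z) (hG : ∀ z, HasDerivAt G (G' z) z) (h0 : F 0 = G 0)
    (hC : ∀ z ∈ Icc (-M) M, |F' z - G' z| ≤ C) {z : ℝ} (hz : z ∈ Icc (-M) M) :
    |F z - G z| ≤ C * |z| := by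
  have hM : (0 : ℝ) ∈ Icc (-M) M := by constructor <;> linarith [hz.1, hz.2]
  simpa [h0] using (convex_Icc (-M) M).norm_image_sub_le_of_norm_hasDerivWithin_le
    (fun x _ => ((hF x).sub (hG x)).hasDerivWithinAt) hC hM hz

theorem exists_contDiff_entropy_near {f e η q : ℝ → ℝ} (hf : ContDiff ℝ 1 f) (he : Continuous e)
    (hη : ∀ z, HasDerivAt η (e z) z) (hq : ∀ z, HasDerivAt q (e z * deriv f z) z) (M : ℝ)
    {ε : ℝ} (hε : 0 < ε) :
    ∃ e' η' q' : ℝ → ℝ, ContDiff ℝ 1 e' ∧ (∀ z, HasDerivAt η' (e' z) z) ∧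
      (∀ z, HasDerivAt q' (e' z * deriv f z) z) ∧
      ∀ z ∈ Icc (-M) M, |η z - η' z| ≤ ε ∧ |q z - q' z| ≤ ε ∧ |e z - e' z| ≤ ε := by
  have hfc := hf.continuous_deriv le_rfl
  obtain ⟨L, hL⟩ := isCompact_Icc.exists_bound_of_continuousOn (s := Icc (-M) M) hfc.continuousOn
  set C := 1 + |M| + |L| * |M| with hC
  have hC0 : 0 < C := by positivity
  obtain ⟨P, hP⟩ := exists_polynomial_near_of_continuousOn (-M) M e he.continuousOn (ε / C)
    (by positivity)
  have hPe (z : ℝ) (hz : z ∈ Icc (-M) M) : |e z - P.eval z| ≤ ε / C := by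
    rw [abs_sub_comm]
    exact (hP z hz).le
  have hPf (z : ℝ) (hz : z ∈ Icc (-M) M) :
      |e z * deriv f z - P.eval z * deriv f z| ≤ ε / C * |L| := by
    rw [← sub_mul, abs_mul]
    exact mul_le_mul (hPe z hz) ((hL z hz).trans (le_abs_self L)) (abs_nonneg _) (by positivity)
  have hη' (z : ℝ) : HasDerivAt (fun z => η 0 + ∫ k in (0 : ℝ)..z, P.eval k) (P.eval z) z :=
    (P.continuous.integral_hasStrictDerivAt 0 z).hasDerivAt.const_add _
  have hq' (z : ℝ) : HasDerivAt (fun z => q 0 + ∫ k in (0 : ℝ)..z, P.eval k * deriv f k)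
      (P.eval z * deriv f z) z :=
    ((P.continuous.mul hfc).integral_hasStrictDerivAt 0 z).hasDerivAt.const_add _
  refine ⟨fun z => P.eval z, _, _, by simpa using P.contDiff_aeval (𝕜 := ℝ) 1, hη', hq',
    fun z hz => ?_⟩
  have hzM : |z| ≤ |M| := (abs_le.2 hz).trans (le_abs_self M)
  have hεC : ε / C * C = ε := div_mul_cancel₀ ε hC0.ne'
  have hle {a : ℝ} (ha : a ≤ C) : ε / C * a ≤ ε :=
    (mul_le_mul_of_nonneg_left ha (by positivity)).trans_eq hεC
  refine ⟨(abs_sub_le_of_hasDerivAt hη hη' (by simp) hPe hz).trans (hle ?_),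
    (abs_sub_le_of_hasDerivAt hq hq' (by simp) hPf hz).trans ?_,
    (hPe z hz).trans (div_le_self hε.le ?_)⟩
  · rw [hC]
    nlinarith [abs_nonneg L, abs_nonneg M]
  · rw [mul_assoc]
    refine hle ?_
    rw [hC]
    nlinarith [abs_nonneg L, abs_nonneg M, abs_nonneg z]
  · rw [hC]
    nlinarith [abs_nonneg L, abs_nonneg M]

theorem abs_weakIntegrand_sub_le {A A' B B' d d' : ℝ × ℝ → ℝ} {ε : ℝ} {p : ℝ × ℝ}
    (φ g : ℝ × ℝ → ℝ) (hA : |A p - A' p| ≤ ε) (hB : |B p - B' p| ≤ ε) (hd : |d p - d' p| ≤ ε) :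
    |weakIntegrand φ A B (fun p => d p * g p) p - weakIntegrand φ A' B' (fun p => d' p * g p) p| ≤
      ε * (|partialT φ p| + |partialX φ p| + |φ p * g p|) :=
  calc
    _ = |partialT φ p * (A p - A' p) + partialX φ p * (B p - B' p) +
        φ p * g p * (d p - d' p)| := by
      simp only [weakIntegrand]
      ring_nf
    _ ≤ |partialT φ p| * ε + |partialX φ p| * ε + |φ p * g p| * ε := by
      refine (abs_add_three _ _ _).trans ?_
      simp only [abs_mul (partialT φ p), abs_mul (partialX φ p), abs_mul (φ p * g p)]
      gcongr
    _ = _ := by ring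

theorem IsContinuousDistribSolution.distribBalance_entropy {f η q : ℝ → ℝ} {g u : ℝ × ℝ → ℝ}
    {Ω : Set (ℝ × ℝ)} (H : IsContinuousDistribSolution f g Ω u) (hΩ : IsOpen Ω)
    (hf : ContDiff ℝ 1 f) (hηq : IsEntropyPair f η q) :
    DistribBalance Ω (fun p => η (u p)) (fun p => q (u p)) (fun p => deriv η (u p) * g p) := by
  have he := hηq.contDiff.continuous_deriv le_rfl
  have hη (z : ℝ) : HasDerivAt η (deriv η z) z :=
    (hηq.contDiff.differentiable one_ne_zero z).hasDerivAt
  have hqc : Continuous q := continuous_iff_continuousAt.2 fun z => (hηq.flux z).continuousAt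
  have hg := locallyIntegrableOn_of_memLp_top H.source
  refine (distribBalance_iff (H.locallyIntegrableOn_comp hΩ hηq.contDiff.continuous)
    (H.locallyIntegrableOn_comp hΩ hqc) (hg.continuousOn_mul
      (he.comp_continuousOn H.continuousOn) hΩ.isLocallyClosed)).2 fun φ hφ => ?_
  obtain ⟨M, hM⟩ := H.exists_abs_le_on_tsupport hφ
  have hbound : Integrable fun p => |partialT φ p| + |partialX φ p| + |φ p * g p| :=
    (hφ.partialT.integrable.abs.add hφ.partialX.integrable.abs).add (hφ.integrable_mul hg).abs
  set A := ∫ p, (|partialT φ p| + |partialX φ p| + |φ p * g p|)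
  set W := weakIntegrand φ (fun p => η (u p)) (fun p => q (u p)) (fun p => deriv η (u p) * g p)
  suffices hA : ∀ ε > 0, |∫ p, W p| ≤ ε * A by
    have hlim : Tendsto (fun ε => ε * A) (𝓝[>] 0) (𝓝 0) := by
      simpa using ((continuous_mul_const A).tendsto 0).mono_left nhdsWithin_le_nhds
    exact abs_nonpos_iff.1 (ge_of_tendsto hlim (eventually_mem_nhdsWithin.mono hA))
  intro ε hε
  obtain ⟨e', η', q', he', hη', hq', hnear⟩ := exists_contDiff_entropy_near hf he hη hηq.flux M hε
  have hηc' : Continuous η' := continuous_iff_continuousAt.2 fun z => (hη' z).continuousAt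
  have hqc' : Continuous q' := continuous_iff_continuousAt.2 fun z => (hq' z).continuousAt
  have hint := H.integrable_weakIntegrand_comp hΩ hφ hηq.contDiff.continuous hqc he
  have hint' := H.integrable_weakIntegrand_comp hΩ hφ hηc' hqc' he'.continuous
  have hzero := H.integral_weakIntegrand_of_contDiff_deriv hΩ hf hφ he' hη' hq'
  rw [← sub_zero (∫ p, W p : ℝ), ← hzero, ← integral_sub hint hint', ← integral_const_mul,
    ← Real.norm_eq_abs]
  refine norm_integral_le_of_norm_le (hbound.const_mul ε) (ae_of_all _ fun p => ?_)
  by_cases hp : p ∈ tsupport φ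
  · obtain ⟨hA, hB, hd⟩ := hnear (u p) (abs_le.1 (hM p hp))
    exact abs_weakIntegrand_sub_le (A := fun p => η (u p)) φ g hA hB hd
  · rw [weakIntegrand_eq_zero _ _ _ hp, weakIntegrand_eq_zero _ _ _ hp, sub_zero, norm_zero]
    positivity

/-! ### Doubling of variables -/

section Mollifier

/-- Bumps at the origin of radii `1 / (n + 1)`, constant on the ball of half the radius; their
normalisations are the mollifiers used to let the two variables coalesce. -/
noncomputable def shrinkingBump (E : Type*) [NormedAddCommGroup E] (n : ℕ) :
    ContDiffBump (0 : E) where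
  rIn := 1 / ((n : ℝ) + 1) / 2
  rOut := 1 / ((n : ℝ) + 1)
  rIn_pos := by positivity
  rIn_lt_rOut := half_lt_self (by positivity)

theorem tendsto_shrinkingBump_rOut (E : Type*) [NormedAddCommGroup E] :
    Tendsto (fun n => (shrinkingBump E n).rOut) atTop (𝓝[>] 0) :=
  tendsto_nhdsWithin_iff.2 ⟨tendsto_one_div_add_atTop_nhds_zero_nat,
    Eventually.of_forall fun n => (shrinkingBump E n).rOut_pos⟩

variable {E : Type*} [NormedAddCommGroup E] [NormedSpace ℝ E] [FiniteDimensional ℝ E]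
  [MeasurableSpace E] [BorelSpace E] {μ : Measure E} [μ.IsAddHaarMeasure]

theorem normed_comp_sub_eq_zero (ρ : ContDiffBump (0 : E)) {p q : E}
    (hq : q ∉ Metric.closedBall p ρ.rOut) : ρ.normed μ (p - q) = 0 := by
  refine Function.notMem_support.1 fun h => hq ?_
  rw [ρ.support_normed_eq, Metric.mem_ball, dist_zero_right] at h
  rw [Metric.mem_closedBall, dist_comm, dist_eq_norm]
  exact h.le

theorem integral_normed_comp_sub (ρ : ContDiffBump (0 : E)) (p : E) :
    ∫ q, ρ.normed μ (p - q) ∂μ = 1 := by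
  rw [integral_sub_left_eq_self (fun z => ρ.normed μ z) μ p, ρ.integral_normed]

theorem integrable_normed_comp_sub_mul (ρ : ContDiffBump (0 : E)) (p : E) {g : E → ℝ}
    (hg : LocallyIntegrable g μ) : Integrable (fun q => ρ.normed μ (p - q) * g q) μ :=
  hg.integrable_smul_left_of_hasCompactSupport
    (ρ.continuous_normed.comp (continuous_const.sub continuous_id))
    (HasCompactSupport.intro (isCompact_closedBall p ρ.rOut) fun _ => normed_comp_sub_eq_zero ρ)

theorem integral_normed_comp_sub_mul_le_average (n : ℕ) (p : E) {g : E → ℝ}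
    (hg : LocallyIntegrable g μ) (h0 : ∀ q, 0 ≤ g q) :
    ∫ q, (shrinkingBump E n).normed μ (p - q) * g q ∂μ ≤
      2 ^ Module.finrank ℝ E * ⨍ q in Metric.closedBall p (shrinkingBump E n).rOut, g q ∂μ := by
  set ρ := shrinkingBump E n with hρ
  rw [← setIntegral_eq_integral_of_forall_compl_eq_zero fun q hq => by
    rw [normed_comp_sub_eq_zero ρ hq, zero_mul], setAverage_eq, smul_eq_mul, ← mul_assoc,
    ← integral_const_mul]
  refine integral_mono (integrable_normed_comp_sub_mul ρ p hg).integrableOn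
    ((hg.integrableOn_isCompact (isCompact_closedBall p _)).const_mul _) fun q => ?_
  refine mul_le_mul_of_nonneg_right ?_ (h0 q)
  refine (ρ.normed_le_div_measure_closedBall_rOut μ 2
    (le_of_eq (by rw [hρ, shrinkingBump]; ring)) (p - q)).trans_eq ?_
  rw [div_eq_mul_inv, Measure.real, Measure.real, Measure.addHaar_closedBall_center,
    Measure.addHaar_closedBall_center μ p]

theorem ae_tendsto_integral_normed_comp_sub_mul_abs_sub {g : E → ℝ} (hg : LocallyIntegrable g μ) :
    ∀ᵐ p ∂μ, Tendsto (fun n => ∫ q, (shrinkingBump E n).normed μ (p - q) * |g q - g p| ∂μ) atTop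
      (𝓝 0) := by
  filter_upwards [IsUnifLocDoublingMeasure.ae_tendsto_average_norm_sub μ hg 1] with p hp
  have hlim := (hp (fun _ : ℕ => p) (fun n => (shrinkingBump E n).rOut)
    (tendsto_shrinkingBump_rOut E)
    (Eventually.of_forall fun n => Metric.mem_closedBall_self
      (by rw [one_mul]; exact (shrinkingBump E n).rOut_pos.le))).const_mul
        ((2 : ℝ) ^ Module.finrank ℝ E)
  rw [mul_zero] at hlim
  have hdist : LocallyIntegrable (fun q => |g q - g p|) μ := fun x =>
    let ⟨U, hU, h⟩ := (hg.sub (locallyIntegrable_const (g p))) x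
    ⟨U, hU, h.norm⟩
  exact squeeze_zero (fun n => integral_nonneg fun q =>
    mul_nonneg ((shrinkingBump E n).nonneg_normed _) (abs_nonneg _))
    (fun n => integral_normed_comp_sub_mul_le_average n p hdist
      fun _ => abs_nonneg _) hlim

theorem tendsto_integral_normed_comp_sub_mul {F : E → ℝ} (hF : LocallyIntegrable F μ) {p : E}
    (hp : Tendsto (fun n => ∫ q, (shrinkingBump E n).normed μ (p - q) * |F q - F p| ∂μ) atTop
      (𝓝 0)) :
    Tendsto (fun n => ∫ q, (shrinkingBump E n).normed μ (p - q) * F q ∂μ) atTop (𝓝 (F p)) := by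
  refine tendsto_iff_norm_sub_tendsto_zero.2
    (squeeze_zero (fun _ => norm_nonneg _) (fun n => ?_) hp)
  have hconst : ∫ q, (shrinkingBump E n).normed μ (p - q) * F p ∂μ = F p := by
    rw [integral_mul_const, integral_normed_comp_sub, one_mul]
  have hsub := integral_sub (integrable_normed_comp_sub_mul (shrinkingBump E n) p hF)
    (integrable_normed_comp_sub_mul (shrinkingBump E n) p (locallyIntegrable_const (F p)))
  rw [hconst] at hsub
  rw [← hsub]
  refine (norm_integral_le_integral_norm _).trans_eq (integral_congr_ae (.of_forall fun q => ?_))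
  simp only [← mul_sub, norm_mul, Real.norm_eq_abs,
    abs_of_nonneg ((shrinkingBump E n).nonneg_normed _)]

end Mollifier

theorem locallyIntegrable_of_bounded {X : Type*} [TopologicalSpace X] [MeasurableSpace X]
    {μ : Measure X} [IsLocallyFiniteMeasure μ] {F : X → ℝ} {C : ℝ} (hF : Measurable F)
    (hC : ∀ x, |F x| ≤ C) : LocallyIntegrable F μ :=
  (locallyIntegrable_const C).mono hF.aestronglyMeasurable
    (.of_forall fun x => (hC x).trans (le_abs_self C))

theorem integrable_mul_comp_sub {G : Type*} [AddCommGroup G] [MeasurableSpace G] [MeasurableAdd₂ G]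
    [MeasurableNeg G] {μ : Measure G} [SFinite μ] [μ.IsAddLeftInvariant] [μ.IsNegInvariant]
    {a r : G → ℝ} (ha : Integrable a μ) (hr : Integrable r μ) :
    Integrable (fun z : G × G => a z.1 * r (z.1 - z.2)) (μ.prod μ) := by
  simpa [Function.comp_def] using
    (ha.convolution_integrand (ContinuousLinearMap.mul ℝ ℝ) hr.comp_neg).swap

theorem partialT_comp_sub_right (r : ℝ × ℝ → ℝ) (p q : ℝ × ℝ) :
    partialT (fun p => r (p - q)) p = partialT r (p - q) := by
  rw [partialT, fderiv_comp_sub, partialT]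

theorem partialX_comp_sub_right (r : ℝ × ℝ → ℝ) (p q : ℝ × ℝ) :
    partialX (fun p => r (p - q)) p = partialX r (p - q) := by
  rw [partialX, fderiv_comp_sub, partialX]

theorem hasFDerivAt_const_mul_comp_sub_left {r : ℝ × ℝ → ℝ} (hr : Differentiable ℝ r) (c : ℝ)
    (p q : ℝ × ℝ) :
    HasFDerivAt (fun q => c * r (p - q)) (-(c • fderiv ℝ r (p - q))) q := by
  have h := ((hr (p - q)).hasFDerivAt.comp q ((hasFDerivAt_id q).const_sub p)).const_mul c
  exact h.congr_fderiv (by ext <;> simp)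

theorem partialT_const_mul_comp_sub_left {r : ℝ × ℝ → ℝ} (hr : Differentiable ℝ r) (c : ℝ)
    (p q : ℝ × ℝ) : partialT (fun q => c * r (p - q)) q = -(c * partialT r (p - q)) := by
  rw [partialT, (hasFDerivAt_const_mul_comp_sub_left hr c p q).fderiv]
  rfl

theorem partialX_const_mul_comp_sub_left {r : ℝ × ℝ → ℝ} (hr : Differentiable ℝ r) (c : ℝ)
    (p q : ℝ × ℝ) : partialX (fun q => c * r (p - q)) q = -(c * partialX r (p - q)) := by
  rw [partialX, (hasFDerivAt_const_mul_comp_sub_left hr c p q).fderiv]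
  rfl

theorem exists_abs_kruzkovFlux_le {f : ℝ → ℝ} (hf : Continuous f) (M : ℝ) :
    ∃ D, ∀ a b, |a| ≤ M → |b| ≤ M → |kruzkovFlux f a b| ≤ D := by
  obtain ⟨D, hD⟩ := (isCompact_Icc (a := -M) (b := M)).prod (isCompact_Icc (a := -M) (b := M))
    |>.exists_bound_of_continuousOn (continuous_kruzkovFlux hf).continuousOn
  exact ⟨D, fun a b ha hb => hD (a, b) ⟨abs_le.1 ha, abs_le.1 hb⟩⟩

theorem exists_abs_kruzkovFlux_sub_le {f : ℝ → ℝ} (hf : LocallyLipschitz f) (M : ℝ) :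
    ∃ L, 0 ≤ L ∧ ∀ a b c, |a| ≤ M → |b| ≤ M → |c| ≤ M →
      |kruzkovFlux f a b - kruzkovFlux f a c| ≤ L * |b - c| := by
  obtain ⟨K, hK⟩ := (hf.locallyLipschitzOn (s := Icc (-M) M)).exists_lipschitzOnWith_of_compact
    isCompact_Icc
  have hLip (x y : ℝ) (hx : |x| ≤ M) (hy : |y| ≤ M) : |f x - f y| ≤ K * |x - y| := by
    simpa only [Real.dist_eq] using hK.dist_le_mul x (abs_le.1 hx) y (abs_le.1 hy)
  have hmax (x y : ℝ) (hx : |x| ≤ M) (hy : |y| ≤ M) : |max x y| ≤ M :=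
    abs_max_le_max_abs_abs.trans (max_le hx hy)
  have hmin (x y : ℝ) (hx : |x| ≤ M) (hy : |y| ≤ M) : |min x y| ≤ M :=
    abs_min_le_max_abs_abs.trans (max_le hx hy)
  refine ⟨K + K, by positivity, fun a b c ha hb hc => ?_⟩
  calc |kruzkovFlux f a b - kruzkovFlux f a c|
      = |(f (max a b) - f (max a c)) - (f (min a b) - f (min a c))| := by
        rw [kruzkovFlux_eq_sub, kruzkovFlux_eq_sub]
        ring_nf
    _ ≤ |f (max a b) - f (max a c)| + |f (min a b) - f (min a c)| := abs_sub _ _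
    _ ≤ K * |max a b - max a c| + K * |min a b - min a c| :=
        add_le_add (hLip _ _ (hmax a b ha hb) (hmax a c ha hc))
          (hLip _ _ (hmin a b ha hb) (hmin a c ha hc))
    _ ≤ K * |b - c| + K * |b - c| :=
        add_le_add
          (mul_le_mul_of_nonneg_left (by simpa using abs_max_sub_max_le_max a b a c) K.coe_nonneg)
          (mul_le_mul_of_nonneg_left (by simpa using abs_min_sub_min_le_max a b a c) K.coe_nonneg)
    _ = (K + K) * |b - c| := by ring

/-- The integrand of the weak formulation of Kruzkov's entropy balance at level `k`. -/
noncomputable def kruzkovIntegrand (f : ℝ → ℝ) (g v φ : ℝ × ℝ → ℝ) (k : ℝ) : ℝ × ℝ → ℝ :=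
  weakIntegrand φ (fun p => |v p - k|) (fun p => kruzkovFlux f (v p) k)
    fun p => Real.sign (v p - k) * g p

/-- Entropy solutions on `Ω`, in the sense of Kruzkov, of `∂ₜ v + ∂ₓ f(v) = g`. The functions
`v` and `g` are normalised: measurable and bounded by `M` on the whole plane, not only almost
everywhere on `Ω`. -/
structure IsBoundedEntropySolution (f : ℝ → ℝ) (g : ℝ × ℝ → ℝ) (Ω : Set (ℝ × ℝ)) (M : ℝ)
    (v : ℝ × ℝ → ℝ) : Prop where
  measurable_source : Measurable g
  abs_source_le : ∀ p, |g p| ≤ M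
  measurable : Measurable v
  abs_le : ∀ p, |v p| ≤ M
  entropy : ∀ (k : ℝ) (φ : ℝ × ℝ → ℝ), IsTestFunction Ω φ → (∀ p, 0 ≤ φ p) →
    0 ≤ ∫ p, kruzkovIntegrand f g v φ k p

/-- The integrand left after adding Kruzkov's inequalities for `v` at `p` with level `u q`, and
for `u` at `q` with level `v p`, with test function `ψ p * r (p - q)`; the factor `r (p - q)` is
omitted. -/
noncomputable def doubledIntegrand (f : ℝ → ℝ) (u v g ψ : ℝ × ℝ → ℝ) (p q : ℝ × ℝ) : ℝ :=
  partialT ψ p * |v p - u q| + partialX ψ p * kruzkovFlux f (v p) (u q) +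
    ψ p * (Real.sign (v p - u q) * (g p - g q))

theorem kruzkovIntegrand_add_kruzkovIntegrand (f : ℝ → ℝ) (u v g : ℝ × ℝ → ℝ) {ψ r : ℝ × ℝ → ℝ}
    (hψ : Differentiable ℝ ψ) (hr : Differentiable ℝ r) (p q : ℝ × ℝ) :
    kruzkovIntegrand f g v (fun p' => ψ p' * r (p' - q)) (u q) p +
      kruzkovIntegrand f g u (fun q' => ψ p * r (p - q')) (v p) q =
        r (p - q) * doubledIntegrand f u v g ψ p q := by
  have hr' : DifferentiableAt ℝ (fun p' => r (p' - q)) p := by fun_prop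
  have hsign : Real.sign (u q - v p) = -Real.sign (v p - u q) := by
    rw [← Real.sign_neg, neg_sub]
  simp only [kruzkovIntegrand, weakIntegrand, doubledIntegrand, partialT_mul (hψ p) hr',
    partialX_mul (hψ p) hr', partialT_comp_sub_right, partialX_comp_sub_right,
    partialT_const_mul_comp_sub_left hr, partialX_const_mul_comp_sub_left hr,
    abs_sub_comm (u q), kruzkovFlux_comm f (u q), hsign]
  ring

section Doubling

variable {f : ℝ → ℝ} {g u v ψ r : ℝ × ℝ → ℝ} {Ω : Set (ℝ × ℝ)} {M : ℝ}

theorem isTestFunction_const_mul_normed_comp_sub (ρ : ContDiffBump (0 : ℝ × ℝ)) {p : ℝ × ℝ}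
    (hp : Metric.closedBall p ρ.rOut ⊆ Ω) (c : ℝ) :
    IsTestFunction Ω fun q => c * ρ.normed volume (p - q) where
  smooth := contDiff_const.mul (ρ.contDiff_normed.comp (contDiff_const.sub contDiff_id))
  compact := HasCompactSupport.intro (isCompact_closedBall p ρ.rOut) fun q hq => by
    rw [normed_comp_sub_eq_zero ρ hq, mul_zero]
  support_subset := (closure_minimal (fun q hq => by
    contrapose! hq
    simp [normed_comp_sub_eq_zero ρ hq]) Metric.isClosed_closedBall).trans hp

theorem isTestFunction_normed (ρ : ContDiffBump (0 : ℝ × ℝ)) :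
    IsTestFunction univ (ρ.normed volume) where
  smooth := ρ.contDiff_normed
  compact := ρ.hasCompactSupport_normed
  support_subset := subset_univ _

theorem doubledIntegrand_self (f : ℝ → ℝ) (u v g ψ : ℝ × ℝ → ℝ) (p : ℝ × ℝ) :
    doubledIntegrand f u v g ψ p p =
      partialT ψ p * |v p - u p| + partialX ψ p * kruzkovFlux f (v p) (u p) := by
  simp [doubledIntegrand]

theorem abs_doubledIntegrand_sub_self_le {L : ℝ} {p q : ℝ × ℝ}
    (hL : |kruzkovFlux f (v p) (u q) - kruzkovFlux f (v p) (u p)| ≤ L * |u q - u p|) :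
    |doubledIntegrand f u v g ψ p q - doubledIntegrand f u v g ψ p p| ≤
      (|partialT ψ p| + |partialX ψ p| * L) * |u q - u p| + |ψ p| * |g q - g p| := by
  have habs : |(|v p - u q| - |v p - u p|)| ≤ |u q - u p| := by
    simpa [abs_sub_comm] using abs_abs_sub_abs_le_abs_sub (v p - u q) (v p - u p)
  have hsource : |Real.sign (v p - u q)| * |g p - g q| ≤ |g q - g p| := by
    rw [abs_sub_comm (g q)]
    exact mul_le_of_le_one_left (abs_nonneg _) (abs_real_sign_le_one _)
  calc |doubledIntegrand f u v g ψ p q - doubledIntegrand f u v g ψ p p|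
      = |partialT ψ p * (|v p - u q| - |v p - u p|) +
          partialX ψ p * (kruzkovFlux f (v p) (u q) - kruzkovFlux f (v p) (u p)) +
          ψ p * (Real.sign (v p - u q) * (g p - g q))| := by
        rw [doubledIntegrand_self, doubledIntegrand]
        ring_nf
    _ ≤ |partialT ψ p| * |(|v p - u q| - |v p - u p|)| +
          |partialX ψ p| * |kruzkovFlux f (v p) (u q) - kruzkovFlux f (v p) (u p)| +
          |ψ p| * (|Real.sign (v p - u q)| * |g p - g q|) := by
        simpa only [abs_mul] using abs_add_three (partialT ψ p * (|v p - u q| - |v p - u p|))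
          (partialX ψ p * (kruzkovFlux f (v p) (u q) - kruzkovFlux f (v p) (u p)))
          (ψ p * (Real.sign (v p - u q) * (g p - g q)))
    _ ≤ |partialT ψ p| * |u q - u p| + |partialX ψ p| * (L * |u q - u p|) +
          |ψ p| * |g q - g p| := by gcongr
    _ = _ := by ring

theorem integrable_doubling (hf : Continuous f) (hv : Measurable v) (hvM : ∀ p, |v p| ≤ M)
    (hu : Measurable u) (huM : ∀ p, |u p| ≤ M) {a₁ a₂ a₃ r₁ r₂ r₃ : ℝ × ℝ → ℝ}
    (ha₁ : Integrable a₁) (ha₂ : Integrable a₂) (ha₃ : Integrable a₃) (hr₁ : Integrable r₁)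
    (hr₂ : Integrable r₂) (hr₃ : Integrable r₃) {h : (ℝ × ℝ) × ℝ × ℝ → ℝ} (hh : Measurable h)
    {C : ℝ} (hC : ∀ z, |h z| ≤ C) :
    Integrable (fun z : (ℝ × ℝ) × ℝ × ℝ =>
      a₁ z.1 * r₁ (z.1 - z.2) * |v z.1 - u z.2| +
        a₂ z.1 * r₂ (z.1 - z.2) * kruzkovFlux f (v z.1) (u z.2) +
        a₃ z.1 * r₃ (z.1 - z.2) * (Real.sign (v z.1 - u z.2) * h z)) (volume.prod volume) := by
  obtain ⟨D, hD⟩ := exists_abs_kruzkovFlux_le hf M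
  have hv' : Measurable fun z : (ℝ × ℝ) × ℝ × ℝ => v z.1 := hv.comp measurable_fst
  have hu' : Measurable fun z : (ℝ × ℝ) × ℝ × ℝ => u z.2 := hu.comp measurable_snd
  refine (((integrable_mul_comp_sub ha₁ hr₁).mul_bdd (c := M + M) ?_ (.of_forall fun z => ?_)).add
    ((integrable_mul_comp_sub ha₂ hr₂).mul_bdd (c := D) ?_ (.of_forall fun z => ?_))).add
    ((integrable_mul_comp_sub ha₃ hr₃).mul_bdd (c := 1 * C) ?_ (.of_forall fun z => ?_))
  · exact (hv'.sub hu').abs.aestronglyMeasurable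
  · rw [Real.norm_eq_abs, abs_abs]
    exact (abs_sub _ _).trans (add_le_add (hvM _) (huM _))
  · exact ((continuous_kruzkovFlux hf).measurable.comp (hv'.prodMk hu')).aestronglyMeasurable
  · exact hD _ _ (hvM _) (huM _)
  · exact ((measurable_real_sign.comp (hv'.sub hu')).mul hh).aestronglyMeasurable
  · rw [Real.norm_eq_abs, abs_mul]
    exact mul_le_mul (abs_real_sign_le_one _) (hC z) (abs_nonneg _) zero_le_one

namespace IsBoundedEntropySolution

theorem integrable_mul_doubledIntegrand (Hv : IsBoundedEntropySolution f g Ω M v)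
    (Hu : IsBoundedEntropySolution f g Ω M u) (hf : Continuous f) (hψ : IsTestFunction Ω ψ)
    (hr : Integrable r) :
    Integrable (fun z : (ℝ × ℝ) × ℝ × ℝ => r (z.1 - z.2) * doubledIntegrand f u v g ψ z.1 z.2)
      (volume.prod volume) := by
  refine (integrable_doubling hf Hv.measurable Hv.abs_le Hu.measurable Hu.abs_le
    hψ.partialT.integrable hψ.partialX.integrable hψ.integrable hr hr hr
    (h := fun z => g z.1 - g z.2)
    ((Hv.measurable_source.comp measurable_fst).sub (Hv.measurable_source.comp measurable_snd))
    (C := M + M) fun z => (abs_sub _ _).trans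
      (add_le_add (Hv.abs_source_le _) (Hv.abs_source_le _))).congr (.of_forall fun z => ?_)
  simp only [doubledIntegrand]
  ring

theorem integrable_kruzkovIntegrand_comp_sub (Hv : IsBoundedEntropySolution f g Ω M v)
    (Hu : IsBoundedEntropySolution f g Ω M u) (hf : Continuous f) (hψ : IsTestFunction Ω ψ)
    (hr : IsTestFunction univ r) :
    Integrable (fun z : (ℝ × ℝ) × ℝ × ℝ =>
      kruzkovIntegrand f g u (fun q => ψ z.1 * r (z.1 - q)) (v z.1) z.2)
      (volume.prod volume) := by
  refine (integrable_doubling hf Hv.measurable Hv.abs_le Hu.measurable Hu.abs_le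
    hψ.integrable hψ.integrable hψ.integrable hr.partialT.integrable hr.partialX.integrable
    hr.integrable (h := fun z => g z.2) (Hv.measurable_source.comp measurable_snd)
    fun z => Hv.abs_source_le _).neg.congr (.of_forall fun z => ?_)
  have hsign : Real.sign (u z.2 - v z.1) = -Real.sign (v z.1 - u z.2) := by
    rw [← Real.sign_neg, neg_sub]
  simp only [kruzkovIntegrand, weakIntegrand, Pi.neg_apply, abs_sub_comm (u z.2),
    partialT_const_mul_comp_sub_left hr.differentiableAt,
    partialX_const_mul_comp_sub_left hr.differentiableAt, kruzkovFlux_comm f (u z.2), hsign]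
  ring

theorem integral_integral_doubledIntegrand_nonneg (Hv : IsBoundedEntropySolution f g Ω M v)
    (Hu : IsBoundedEntropySolution f g Ω M u) (hf : Continuous f) (hψ : IsTestFunction Ω ψ)
    (hψ0 : ∀ p, 0 ≤ ψ p) (ρ : ContDiffBump (0 : ℝ × ℝ))
    (hρ : ∀ p ∈ tsupport ψ, Metric.closedBall p ρ.rOut ⊆ Ω) :
    0 ≤ ∫ p, ∫ q, ρ.normed volume (p - q) * doubledIntegrand f u v g ψ p q := by
  set r := ρ.normed volume
  have hr : IsTestFunction univ r := isTestFunction_normed ρ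
  have hZ := Hv.integrable_mul_doubledIntegrand Hu hf hψ hr.integrable
  have hW := Hv.integrable_kruzkovIntegrand_comp_sub Hu hf hψ hr
  have hr0 (p q : ℝ × ℝ) : 0 ≤ ψ p * r (p - q) := mul_nonneg (hψ0 p) (ρ.nonneg_normed _)
  have hin_q (p : ℝ × ℝ) :
      0 ≤ ∫ q, kruzkovIntegrand f g u (fun q => ψ p * r (p - q)) (v p) q := by
    by_cases hp : p ∈ tsupport ψ
    · exact Hu.entropy _ _ (isTestFunction_const_mul_normed_comp_sub ρ (hρ p hp) _) (hr0 p)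
    · simp [kruzkovIntegrand, weakIntegrand, partialT, partialX,
        image_eq_zero_of_notMem_tsupport hp]
  have hin_p (q : ℝ × ℝ) : 0 ≤ ∫ p, (r (p - q) * doubledIntegrand f u v g ψ p q -
      kruzkovIntegrand f g u (fun q => ψ p * r (p - q)) (v p) q) := by
    simp only [← kruzkovIntegrand_add_kruzkovIntegrand f u v g hψ.differentiableAt
      hr.differentiableAt, add_sub_cancel_right]
    exact Hv.entropy _ _ (hψ.mul_smooth (hr.smooth.comp (contDiff_id.sub contDiff_const)))
      fun p => hr0 p q
  have hdiff : 0 ≤ ∫ z : (ℝ × ℝ) × ℝ × ℝ, (r (z.1 - z.2) * doubledIntegrand f u v g ψ z.1 z.2 -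
      kruzkovIntegrand f g u (fun q => ψ z.1 * r (z.1 - q)) (v z.1) z.2) ∂volume.prod volume :=
    (integral_nonneg hin_p).trans_eq (integral_prod_symm _ (hZ.sub hW)).symm
  have hlevel : 0 ≤ ∫ p, ∫ q, kruzkovIntegrand f g u (fun q => ψ p * r (p - q)) (v p) q :=
    integral_nonneg hin_q
  rw [integral_sub hZ hW, integral_prod _ hZ, integral_prod _ hW] at hdiff
  linarith

theorem measurable_doubledIntegrand (Hu : IsBoundedEntropySolution f g Ω M u)
    (hf : Continuous f) (v ψ : ℝ × ℝ → ℝ) (p : ℝ × ℝ) :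
    Measurable (doubledIntegrand f u v g ψ p) := by
  have hsub : Measurable fun q => v p - u q := Hu.measurable.const_sub _
  have hflux : Measurable fun q => kruzkovFlux f (v p) (u q) :=
    (continuous_kruzkovFlux hf).measurable.comp (measurable_const.prodMk Hu.measurable)
  exact ((hsub.abs.const_mul _).add (hflux.const_mul _)).add
    (((measurable_real_sign.comp hsub).mul (Hu.measurable_source.const_sub _)).const_mul _)

theorem abs_doubledIntegrand_le {D : ℝ} (Hv : IsBoundedEntropySolution f g Ω M v)
    (Hu : IsBoundedEntropySolution f g Ω M u)
    (hD : ∀ a b, |a| ≤ M → |b| ≤ M → |kruzkovFlux f a b| ≤ D) (ψ : ℝ × ℝ → ℝ) (p q : ℝ × ℝ) :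
    |doubledIntegrand f u v g ψ p q| ≤
      |partialT ψ p| * (2 * M) + |partialX ψ p| * D + |ψ p| * (2 * M) := by
  have hgM := Hv.abs_source_le
  have hsource : |Real.sign (v p - u q)| * |g p - g q| ≤ 1 * (2 * M) :=
    mul_le_mul (abs_real_sign_le_one _) ((abs_sub _ _).trans (by linarith [hgM p, hgM q]))
      (abs_nonneg _) zero_le_one
  refine (abs_add_three _ _ _).trans ?_
  simp only [abs_mul, abs_abs]
  refine add_le_add (add_le_add ?_ ?_) ?_ <;> refine mul_le_mul_of_nonneg_left ?_ (abs_nonneg _)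
  · exact (abs_sub _ _).trans (by linarith [Hv.abs_le p, Hu.abs_le q])
  · exact hD _ _ (Hv.abs_le p) (Hu.abs_le q)
  · linarith

theorem ae_tendsto_integral_normed_comp_sub_mul_doubledIntegrand
    (Hv : IsBoundedEntropySolution f g Ω M v) (Hu : IsBoundedEntropySolution f g Ω M u)
    (hf : LocallyLipschitz f) (ψ : ℝ × ℝ → ℝ) :
    ∀ᵐ p, Tendsto (fun n => ∫ q, (shrinkingBump (ℝ × ℝ) n).normed volume (p - q) *
      doubledIntegrand f u v g ψ p q) atTop (𝓝 (doubledIntegrand f u v g ψ p p)) := by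
  obtain ⟨D, hD⟩ := exists_abs_kruzkovFlux_le hf.continuous M
  obtain ⟨L, -, hL⟩ := exists_abs_kruzkovFlux_sub_le hf M
  have hu : LocallyIntegrable u := locallyIntegrable_of_bounded Hu.measurable Hu.abs_le
  have hg : LocallyIntegrable g :=
    locallyIntegrable_of_bounded Hu.measurable_source Hu.abs_source_le
  filter_upwards [ae_tendsto_integral_normed_comp_sub_mul_abs_sub hu,
    ae_tendsto_integral_normed_comp_sub_mul_abs_sub hg] with p hpu hpg
  have hdist {w : ℝ × ℝ → ℝ} (hw : Measurable w) (hM : ∀ q, |w q| ≤ M) :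
      LocallyIntegrable fun q => |w q - w p| :=
    locallyIntegrable_of_bounded (C := M + M) (hw.sub_const _).abs fun q => by
      rw [abs_abs]
      exact (abs_sub _ _).trans (add_le_add (hM q) (hM p))
  refine tendsto_integral_normed_comp_sub_mul (locallyIntegrable_of_bounded
    (Hu.measurable_doubledIntegrand hf.continuous v ψ p)
    (Hv.abs_doubledIntegrand_le Hu hD ψ p)) ?_
  have hlim := (hpu.const_mul (|partialT ψ p| + |partialX ψ p| * L)).add (hpg.const_mul |ψ p|)
  simp only [mul_zero, add_zero] at hlim
  refine squeeze_zero (fun n => integral_nonneg fun q =>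
    mul_nonneg ((shrinkingBump _ n).nonneg_normed _) (abs_nonneg _)) (fun n => ?_) hlim
  have hiu := integrable_normed_comp_sub_mul (shrinkingBump _ n) p (hdist Hu.measurable Hu.abs_le)
  have hig := integrable_normed_comp_sub_mul (shrinkingBump _ n) p
    (hdist Hu.measurable_source Hu.abs_source_le)
  rw [← integral_const_mul, ← integral_const_mul,
    ← integral_add (hiu.const_mul _) (hig.const_mul _)]
  refine integral_mono_of_nonneg (.of_forall fun q =>
    mul_nonneg ((shrinkingBump _ n).nonneg_normed _) (abs_nonneg _))
    ((hiu.const_mul _).add (hig.const_mul _)) (.of_forall fun q => ?_)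
  refine (mul_le_mul_of_nonneg_left (abs_doubledIntegrand_sub_self_le
    (hL _ _ _ (Hv.abs_le p) (Hu.abs_le q) (Hu.abs_le p)))
    ((shrinkingBump _ n).nonneg_normed _)).trans_eq ?_
  ring

theorem comparison (Hv : IsBoundedEntropySolution f g Ω M v)
    (Hu : IsBoundedEntropySolution f g Ω M u) (hΩ : IsOpen Ω) (hf : LocallyLipschitz f)
    (hψ : IsTestFunction Ω ψ) (hψ0 : ∀ p, 0 ≤ ψ p) :
    0 ≤ ∫ p, (partialT ψ p * |v p - u p| + partialX ψ p * kruzkovFlux f (v p) (u p)) := by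
  obtain ⟨D, hD⟩ := exists_abs_kruzkovFlux_le hf.continuous M
  obtain ⟨ε, hε, hεΩ⟩ := hψ.compact.exists_cthickening_subset_open hΩ hψ.support_subset
  simp only [← doubledIntegrand_self f u v g ψ]
  have hint (n : ℕ) := Hv.integrable_mul_doubledIntegrand Hu hf.continuous hψ
    (isTestFunction_normed (shrinkingBump (ℝ × ℝ) n)).integrable
  have hlim := tendsto_integral_of_dominated_convergence
    (fun p => |partialT ψ p| * (2 * M) + |partialX ψ p| * D + |ψ p| * (2 * M))
    (fun n => (hint n).integral_prod_left.aestronglyMeasurable)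
    (((hψ.partialT.integrable.abs.mul_const _).add (hψ.partialX.integrable.abs.mul_const _)).add
      (hψ.integrable.abs.mul_const _))
    (fun n => .of_forall fun p => ?_)
    (Hv.ae_tendsto_integral_normed_comp_sub_mul_doubledIntegrand Hu hf ψ)
  · refine ge_of_tendsto hlim ?_
    filter_upwards [(tendsto_shrinkingBump_rOut (ℝ × ℝ)).eventually (Ioo_mem_nhdsGT hε)]
      with n hn
    exact Hv.integral_integral_doubledIntegrand_nonneg Hu hf.continuous hψ hψ0 _ fun p hp =>
      (Metric.closedBall_subset_cthickening hp _).trans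
        ((Metric.cthickening_mono hn.2.le _).trans hεΩ)
  · rw [← one_mul (_ + _), ← integral_normed_comp_sub (μ := volume) (shrinkingBump (ℝ × ℝ) n) p,
      ← integral_mul_const]
    refine norm_integral_le_of_norm_le (integrable_normed_comp_sub_mul _ p
      (locallyIntegrable_const _)) (.of_forall fun q => ?_)
    rw [norm_mul, Real.norm_eq_abs, Real.norm_eq_abs,
      abs_of_nonneg ((shrinkingBump _ n).nonneg_normed _)]
    exact mul_le_mul_of_nonneg_left (Hv.abs_doubledIntegrand_le Hu hD ψ p q)
      ((shrinkingBump _ n).nonneg_normed _)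

theorem of_ae_eq {g' v' : ℝ × ℝ → ℝ} (hg' : Measurable g') (hg'M : ∀ p, |g' p| ≤ M)
    (hgg' : g =ᵐ[volume.restrict Ω] g') (hv' : Measurable v') (hv'M : ∀ p, |v' p| ≤ M)
    (hvv' : v =ᵐ[volume.restrict Ω] v')
    (h : ∀ (k : ℝ) (φ : ℝ × ℝ → ℝ), IsTestFunction Ω φ → (∀ p, 0 ≤ φ p) →
      0 ≤ ∫ p in Ω, kruzkovIntegrand f g v φ k p) :
    IsBoundedEntropySolution f g' Ω M v' where
  measurable_source := hg'
  abs_source_le := hg'M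
  measurable := hv'
  abs_le := hv'M
  entropy k φ hφ hφ0 := by
    refine (h k φ hφ hφ0).trans_eq (Eq.trans ?_ (hφ.setIntegral_weakIntegrand _ _ _))
    refine integral_congr_ae ?_
    filter_upwards [hgg', hvv'] with p hg hv
    simp only [kruzkovIntegrand, weakIntegrand, hg, hv]

end IsBoundedEntropySolution

end Doubling

/-! ### Decay on backward cones -/

section Cone

variable {L ρ τ ε T D : ℝ} {p : ℝ × ℝ}

theorem partialT_eq_of_hasDerivAt {φ : ℝ × ℝ → ℝ} {d : ℝ} (hφ : DifferentiableAt ℝ φ p)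
    (h : HasDerivAt (fun s => φ (s, p.2)) d p.1) : partialT φ p = d :=
  (hφ.hasFDerivAt.comp_hasDerivAt p.1
    ((hasDerivAt_id p.1).prodMk (hasDerivAt_const p.1 p.2))).unique h

theorem partialX_eq_of_hasDerivAt {φ : ℝ × ℝ → ℝ} {d : ℝ} (hφ : DifferentiableAt ℝ φ p)
    (h : HasDerivAt (fun y => φ (p.1, y)) d p.2) : partialX φ p = d :=
  (hφ.hasFDerivAt.comp_hasDerivAt p.2
    ((hasDerivAt_const p.2 p.1).prodMk (hasDerivAt_id p.2))).unique h

/-- A smooth cutoff of the cone `√(1 + x²) + L t < ρ`, a smooth version of the backward cone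
`|x| + L t < ρ` of a speed of propagation `L`. -/
noncomputable def coneCutoff (L ρ : ℝ) (p : ℝ × ℝ) : ℝ :=
  Real.smoothTransition (ρ - √(1 + p.2 ^ 2) - L * p.1)

theorem contDiff_coneCutoff (L ρ : ℝ) : ContDiff ℝ ∞ (coneCutoff L ρ) := by
  refine Real.smoothTransition.contDiff.comp ?_
  refine (contDiff_const.sub (ContDiff.sqrt ?_ fun p => ?_)).sub (contDiff_const.mul contDiff_fst)
  · exact contDiff_const.add (contDiff_snd.pow 2)
  · positivity

theorem coneCutoff_nonneg (L ρ : ℝ) (p : ℝ × ℝ) : 0 ≤ coneCutoff L ρ p :=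
  Real.smoothTransition.nonneg _

theorem abs_le_of_coneCutoff_ne_zero (hL : 0 ≤ L) (hp : 0 ≤ p.1) (h : coneCutoff L ρ p ≠ 0) :
    |p.2| ≤ ρ := by
  have hpos : 0 < ρ - √(1 + p.2 ^ 2) - L * p.1 := by
    contrapose! h
    exact Real.smoothTransition.zero_of_nonpos h
  have hsqrt : |p.2| ≤ √(1 + p.2 ^ 2) := Real.abs_le_sqrt (by linarith)
  linarith [mul_nonneg hL hp]

theorem hasDerivAt_sqrt_one_add_sq (x : ℝ) :
    HasDerivAt (fun y : ℝ => √(1 + y ^ 2)) (x / √(1 + x ^ 2)) x := by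
  have h : HasDerivAt (fun y : ℝ => 1 + y ^ 2) (2 * x) x := by
    simpa using (hasDerivAt_pow 2 x).const_add 1
  exact (h.sqrt (by positivity)).congr_deriv (by field_simp)

theorem abs_div_sqrt_one_add_sq_le_one (x : ℝ) : |x / √(1 + x ^ 2)| ≤ 1 := by
  rw [abs_div, abs_of_nonneg (Real.sqrt_nonneg _), div_le_one (by positivity)]
  exact Real.abs_le_sqrt (by linarith)

theorem coneCutoff_flux_nonpos (p : ℝ × ℝ) {d F : ℝ} (hF : |F| ≤ L * d) :
    partialT (coneCutoff L ρ) p * d + partialX (coneCutoff L ρ) p * F ≤ 0 := by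
  set s := ρ - √(1 + p.2 ^ 2) - L * p.1
  have hcone : DifferentiableAt ℝ (coneCutoff L ρ) p :=
    (contDiff_coneCutoff L ρ).differentiable (by simp) p
  have hS : HasDerivAt Real.smoothTransition (deriv Real.smoothTransition s) s :=
    (Real.smoothTransition.contDiff.differentiable one_ne_zero s).hasDerivAt
  have hT : partialT (coneCutoff L ρ) p = deriv Real.smoothTransition s * -L :=
    partialT_eq_of_hasDerivAt hcone (hS.comp p.1 (by
      simpa using ((hasDerivAt_id p.1).const_mul L).const_sub (ρ - √(1 + p.2 ^ 2))))
  have hX : partialX (coneCutoff L ρ) p =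
      deriv Real.smoothTransition s * -(p.2 / √(1 + p.2 ^ 2)) :=
    partialX_eq_of_hasDerivAt hcone
      (hS.comp p.2 (((hasDerivAt_sqrt_one_add_sq p.2).const_sub ρ).sub_const (L * p.1)))
  have hspeed : -(p.2 / √(1 + p.2 ^ 2)) * F ≤ L * d := by
    refine (le_abs_self _).trans ?_
    rw [abs_mul, abs_neg]
    exact (mul_le_of_le_one_left (abs_nonneg _) (abs_div_sqrt_one_add_sq_le_one _)).trans hF
  rw [hT, hX]
  linarith [mul_le_mul_of_nonneg_left hspeed (Real.smoothTransition.monotone.deriv_nonneg (x := s))]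

theorem partial_mul_coneCutoff_le {α : ℝ → ℝ} {a d F : ℝ} (hα : HasDerivAt α a p.1)
    (hα0 : 0 ≤ α p.1) (hF : |F| ≤ L * d) :
    partialT (fun q => α q.1 * coneCutoff L ρ q) p * d +
      partialX (fun q => α q.1 * coneCutoff L ρ q) p * F ≤ a * coneCutoff L ρ p * d := by
  have hcone : DifferentiableAt ℝ (coneCutoff L ρ) p :=
    (contDiff_coneCutoff L ρ).differentiable (by simp) p
  have hα' : DifferentiableAt ℝ (fun q : ℝ × ℝ => α q.1) p :=
    hα.differentiableAt.comp p differentiableAt_fst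
  rw [partialT_mul hα' hcone, partialX_mul hα' hcone, partialT_eq_of_hasDerivAt hα' hα,
    partialX_eq_of_hasDerivAt hα' (hasDerivAt_const p.2 (α p.1))]
  linarith [mul_nonpos_of_nonneg_of_nonpos hα0 (coneCutoff_flux_nonpos (ρ := ρ) p hF)]

theorem integrable_mul_coneCutoff_mul {a b : ℝ} (hL : 0 ≤ L) (ha : 0 ≤ a) {α : ℝ → ℝ}
    (hα : Continuous α) (hα0 : ∀ t ∉ Icc a b, α t = 0) {d : ℝ × ℝ → ℝ} (hd : Measurable d)
    (hD : ∀ p, |d p| ≤ D) : Integrable fun p : ℝ × ℝ => α p.1 * coneCutoff L ρ p * d p := by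
  have hcutoff : Integrable fun p : ℝ × ℝ => α p.1 * coneCutoff L ρ p := by
    refine ((hα.comp continuous_fst).mul
      (contDiff_coneCutoff L ρ).continuous).integrable_of_hasCompactSupport ?_
    refine HasCompactSupport.intro (K := Icc a b ×ˢ Icc (-ρ) ρ)
      (isCompact_Icc.prod isCompact_Icc) fun p hp => ?_
    contrapose! hp
    have hp1 : p.1 ∈ Icc a b := not_imp_comm.1 (hα0 p.1) (left_ne_zero_of_mul hp)
    exact ⟨hp1, abs_le.1 (abs_le_of_coneCutoff_ne_zero hL (ha.trans hp1.1)
      (right_ne_zero_of_mul hp))⟩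
  exact hcutoff.mul_bdd hd.aestronglyMeasurable (.of_forall hD)

theorem deriv_expNegInvGlue (s : ℝ) : deriv expNegInvGlue s = s⁻¹ ^ 2 * expNegInvGlue s := by
  simpa using (expNegInvGlue.hasDerivAt_polynomial_eval_inv_mul 1 s).deriv

theorem deriv_expNegInvGlue_nonneg (s : ℝ) : 0 ≤ deriv expNegInvGlue s :=
  expNegInvGlue.monotone.deriv_nonneg

/-- The time profile of the cone test functions: switched on between `ε` and `2 ε`, and then
strictly decreasing up to `τ`, after which it vanishes. -/
noncomputable def timeProfile (ε τ t : ℝ) : ℝ := smoothStep ε ε t * expNegInvGlue (τ - t)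

theorem contDiff_timeProfile (ε τ : ℝ) : ContDiff ℝ ∞ (timeProfile ε τ) :=
  (contDiff_smoothStep ε ε).mul (expNegInvGlue.contDiff.comp (contDiff_const.sub contDiff_id))

theorem timeProfile_nonneg (ε τ t : ℝ) : 0 ≤ timeProfile ε τ t :=
  mul_nonneg smoothStep_nonneg (expNegInvGlue.nonneg _)

theorem hasDerivAt_timeProfile (ε τ t : ℝ) :
    HasDerivAt (timeProfile ε τ) (deriv (smoothStep ε ε) t * expNegInvGlue (τ - t) -
      smoothStep ε ε t * deriv expNegInvGlue (τ - t)) t := by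
  have hexp : HasDerivAt expNegInvGlue (deriv expNegInvGlue (τ - t)) (τ - t) :=
    ((expNegInvGlue.contDiff (n := 1)).differentiable one_ne_zero _).hasDerivAt
  have hstep : HasDerivAt (smoothStep ε ε) (deriv (smoothStep ε ε) t) t :=
    ((contDiff_smoothStep ε ε).differentiable (by simp) t).hasDerivAt
  exact (hstep.mul (hexp.comp t ((hasDerivAt_id t).const_sub τ))).congr_deriv (by simp; ring)

theorem isTestFunction_timeProfile_mul_coneCutoff (hL : 0 ≤ L) (hε : 0 < ε) (hτT : τ < T) (ρ : ℝ) :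
    IsTestFunction (strip T) fun p => timeProfile ε τ p.1 * coneCutoff L ρ p := by
  have hsub : Function.support (fun p : ℝ × ℝ => timeProfile ε τ p.1 * coneCutoff L ρ p) ⊆
      Icc ε τ ×ˢ Icc (-ρ) ρ := fun p hp => by
    have hα : timeProfile ε τ p.1 ≠ 0 := left_ne_zero_of_mul hp
    have hεp : ε ≤ p.1 := le_of_not_gt fun h => left_ne_zero_of_mul hα (smoothStep_of_le hε.le h.le)
    have hpτ : p.1 ≤ τ := le_of_not_gt fun h => right_ne_zero_of_mul hα
      (expNegInvGlue.zero_of_nonpos (by linarith))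
    exact ⟨⟨hεp, hpτ⟩, abs_le.1 (abs_le_of_coneCutoff_ne_zero hL (hε.le.trans hεp)
      (right_ne_zero_of_mul hp))⟩
  have hK : IsCompact (Icc ε τ ×ˢ Icc (-ρ) ρ) := isCompact_Icc.prod isCompact_Icc
  exact ⟨((contDiff_timeProfile ε τ).comp contDiff_fst).mul (contDiff_coneCutoff L ρ),
    .of_support_subset_isCompact hK hsub, (closure_minimal hsub hK.isClosed).trans
      (prod_mono (Icc_subset_Ioo hε hτT) (subset_univ _))⟩

theorem integral_coneCutoff_mul_le (hL : 0 ≤ L) {t δ : ℝ} (ht : 0 ≤ t) (hδ : 0 ≤ δ)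
    {d : ℝ × ℝ → ℝ} (hd : Measurable d) (hd0 : ∀ p, 0 ≤ d p)
    (h : ∫⁻ x in Icc (-ρ) ρ, ‖d (t, x)‖ₑ ≤ ENNReal.ofReal δ) :
    ∫ x, coneCutoff L ρ (t, x) * d (t, x) ≤ δ := by
  have hm : Measurable fun x => coneCutoff L ρ (t, x) * d (t, x) :=
    ((contDiff_coneCutoff L ρ).continuous.measurable.mul hd).comp measurable_prodMk_left
  rw [integral_eq_lintegral_of_nonneg_ae (.of_forall fun x =>
    mul_nonneg (coneCutoff_nonneg _ _ _) (hd0 _)) hm.aestronglyMeasurable]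
  refine ENNReal.toReal_le_of_le_ofReal hδ (le_trans ?_ h)
  rw [← lintegral_indicator measurableSet_Icc]
  refine lintegral_mono fun x => ?_
  by_cases hx : x ∈ Icc (-ρ) ρ
  · rw [indicator_of_mem hx, Real.enorm_eq_ofReal (hd0 _)]
    exact ENNReal.ofReal_le_ofReal (mul_le_of_le_one_left (hd0 _) (Real.smoothTransition.le_one _))
  · have hcone : coneCutoff L ρ (t, x) = 0 := by
      contrapose! hx
      exact abs_le.1 (abs_le_of_coneCutoff_ne_zero (p := (t, x)) hL ht hx)
    simp [hcone]

/-- `d ≥ 0` is a bounded density with `∂ₜ d + ∂ₓ F ≤ 0` in the sense of distributions on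
`strip T`, moving with speed at most `L`. -/
structure IsDissipated (T L D : ℝ) (d F : ℝ × ℝ → ℝ) : Prop where
  measurable : Measurable d
  nonneg : ∀ p, 0 ≤ d p
  le : ∀ p, d p ≤ D
  measurable_flux : Measurable F
  abs_flux_le : ∀ p, |F p| ≤ L * d p
  dissipation : ∀ ψ : ℝ × ℝ → ℝ, IsTestFunction (strip T) ψ → (∀ p, 0 ≤ ψ p) →
    0 ≤ ∫ p, (partialT ψ p * d p + partialX ψ p * F p)

namespace IsDissipated

variable {d F : ℝ × ℝ → ℝ}

theorem abs_le (H : IsDissipated T L D d F) (p : ℝ × ℝ) : |d p| ≤ D :=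
  (abs_of_nonneg (H.nonneg p)).trans_le (H.le p)

theorem integrable_partial (H : IsDissipated T L D d F) (hL : 0 ≤ L) {ψ : ℝ × ℝ → ℝ}
    (hψ : IsTestFunction (strip T) ψ) :
    Integrable fun p => partialT ψ p * d p + partialX ψ p * F p :=
  (hψ.partialT.integrable.mul_bdd H.measurable.aestronglyMeasurable (.of_forall H.abs_le)).add
    (hψ.partialX.integrable.mul_bdd H.measurable_flux.aestronglyMeasurable
      (.of_forall fun p => (H.abs_flux_le p).trans (mul_le_mul_of_nonneg_left (H.le p) hL)))

theorem integrable_inflow (H : IsDissipated T L D d F) (hL : 0 ≤ L) (hε : 0 < ε) (ρ τ : ℝ) :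
    Integrable fun p : ℝ × ℝ =>
      deriv (smoothStep ε ε) p.1 * expNegInvGlue (τ - p.1) * coneCutoff L ρ p * d p :=
  integrable_mul_coneCutoff_mul (b := ε + ε) hL hε.le
    (α := fun t => deriv (smoothStep ε ε) t * expNegInvGlue (τ - t))
    ((continuous_deriv_smoothStep ε ε).mul
      ((expNegInvGlue.contDiff (n := 0)).continuous.comp (by fun_prop)))
    (fun t ht => by rw [deriv_smoothStep_eq_zero hε ht, zero_mul]) H.measurable H.abs_le

theorem integrable_decay (H : IsDissipated T L D d F) (hL : 0 ≤ L) (hε : 0 < ε) (ρ τ : ℝ) :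
    Integrable fun p : ℝ × ℝ =>
      smoothStep ε ε p.1 * deriv expNegInvGlue (τ - p.1) * coneCutoff L ρ p * d p := by
  refine integrable_mul_coneCutoff_mul (a := ε) (b := τ) hL hε.le
    (α := fun t => smoothStep ε ε t * deriv expNegInvGlue (τ - t))
    ((contDiff_smoothStep ε ε).continuous.mul
      (((expNegInvGlue.contDiff (n := 1)).continuous_deriv le_rfl).comp (by fun_prop)))
    (fun t ht => ?_) H.measurable H.abs_le
  rcases not_and_or.1 ht with h | h
  · rw [smoothStep_of_le hε.le (not_le.1 h).le, zero_mul]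
  · rw [deriv_expNegInvGlue, expNegInvGlue.zero_of_nonpos (by linarith), mul_zero, mul_zero]

theorem decay_nonneg (H : IsDissipated T L D d F) (ρ ε τ : ℝ) (p : ℝ × ℝ) :
    0 ≤ smoothStep ε ε p.1 * deriv expNegInvGlue (τ - p.1) * coneCutoff L ρ p * d p :=
  mul_nonneg (mul_nonneg (mul_nonneg smoothStep_nonneg (deriv_expNegInvGlue_nonneg _))
    (coneCutoff_nonneg _ _ _)) (H.nonneg p)

theorem integral_decay_le_integral_inflow (H : IsDissipated T L D d F) (hL : 0 ≤ L) (hε : 0 < ε)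
    (hτT : τ < T) (ρ : ℝ) :
    ∫ p : ℝ × ℝ, smoothStep ε ε p.1 * deriv expNegInvGlue (τ - p.1) * coneCutoff L ρ p * d p ≤
      ∫ p : ℝ × ℝ,
        deriv (smoothStep ε ε) p.1 * expNegInvGlue (τ - p.1) * coneCutoff L ρ p * d p := by
  have hψ := isTestFunction_timeProfile_mul_coneCutoff hL hε hτT ρ
  have hinflow := H.integrable_inflow hL hε ρ τ
  have hdecay := H.integrable_decay hL hε ρ τ
  rw [← sub_nonneg, ← integral_sub hinflow hdecay]
  refine (H.dissipation _ hψ fun p =>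
    mul_nonneg (timeProfile_nonneg _ _ _) (coneCutoff_nonneg _ _ _)).trans
    (integral_mono (H.integrable_partial hL hψ) (hinflow.sub hdecay) fun p => ?_)
  refine (partial_mul_coneCutoff_le (hasDerivAt_timeProfile ε τ p.1) (timeProfile_nonneg _ _ _)
    (H.abs_flux_le p)).trans_eq ?_
  ring

theorem integral_inflow_le (H : IsDissipated T L D d F) (hL : 0 ≤ L) (hε : 0 < ε) {κ δ : ℝ}
    (hεκ : ε + ε < κ) (hδ : 0 ≤ δ)
    (h0 : ∀ᵐ t : ℝ, t ∈ Ioo 0 κ → ∫⁻ x in Icc (-ρ) ρ, ‖d (t, x)‖ₑ ≤ ENNReal.ofReal δ) (τ : ℝ) :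
    ∫ p : ℝ × ℝ, deriv (smoothStep ε ε) p.1 * expNegInvGlue (τ - p.1) * coneCutoff L ρ p * d p ≤
      expNegInvGlue τ * δ := by
  have hinflow := H.integrable_inflow hL hε ρ τ
  rw [Measure.volume_eq_prod, integral_prod _ hinflow]
  calc ∫ t, ∫ x, deriv (smoothStep ε ε) t * expNegInvGlue (τ - t) * coneCutoff L ρ (t, x) *
        d (t, x)
      ≤ ∫ t, deriv (smoothStep ε ε) t * (expNegInvGlue τ * δ) := by
        refine integral_mono_ae hinflow.integral_prod_left
          ((integrable_deriv_smoothStep hε ε).mul_const _) ?_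
        filter_upwards [h0] with t ht
        simp only [mul_assoc, integral_const_mul]
        by_cases htI : t ∈ Icc ε (ε + ε)
        · have ht0 : 0 < t := hε.trans_le htI.1
          refine mul_le_mul_of_nonneg_left (mul_le_mul (expNegInvGlue.monotone (by linarith))
            (integral_coneCutoff_mul_le hL ht0.le hδ H.measurable H.nonneg
              (ht ⟨ht0, htI.2.trans_lt hεκ⟩)) (integral_nonneg fun x =>
                mul_nonneg (coneCutoff_nonneg _ _ _) (H.nonneg _)) (expNegInvGlue.nonneg _))
            (deriv_smoothStep_nonneg hε.le)
        · rw [deriv_smoothStep_eq_zero hε htI, zero_mul, zero_mul]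
    _ = expNegInvGlue τ * δ := by
        rw [integral_mul_const, integral_deriv_smoothStep hε, one_mul]

theorem integral_decay_eq_zero (H : IsDissipated T L D d F) (hL : 0 ≤ L) (hε : 0 < ε)
    (hτT : τ < T) (h0 : ∀ δ > 0, ∃ κ > 0, ∀ᵐ t : ℝ, t ∈ Ioo 0 κ →
      ∫⁻ x in Icc (-ρ) ρ, ‖d (t, x)‖ₑ ≤ ENNReal.ofReal δ) :
    ∫ p : ℝ × ℝ, smoothStep ε ε p.1 * deriv expNegInvGlue (τ - p.1) * coneCutoff L ρ p * d p =
      0 := by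
  refine le_antisymm ?_ (integral_nonneg (H.decay_nonneg ρ ε τ))
  have hlim : Tendsto (fun δ : ℝ => expNegInvGlue τ * δ) (𝓝[>] 0) (𝓝 (expNegInvGlue τ * 0)) :=
    ((continuous_const.mul continuous_id).tendsto 0).mono_left nhdsWithin_le_nhds
  rw [mul_zero] at hlim
  refine ge_of_tendsto hlim ?_
  filter_upwards [self_mem_nhdsWithin] with δ (hδ : 0 < δ)
  obtain ⟨κ, hκ, hκδ⟩ := h0 δ hδ
  set ε' := min (ε / 2) (κ / 3)
  have hε' : 0 < ε' := by positivity
  have hε'ε : ε' ≤ ε / 2 := min_le_left _ _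
  have hε'κ : ε' ≤ κ / 3 := min_le_right _ _
  have hstep (t : ℝ) : smoothStep ε ε t ≤ smoothStep ε' ε' t := by
    rcases le_total t ε with ht | ht
    · exact (smoothStep_of_le hε.le ht).trans_le smoothStep_nonneg
    · exact smoothStep_le_one.trans_eq (smoothStep_of_ge hε' (by linarith)).symm
  refine (integral_mono (H.integrable_decay hL hε ρ τ) (H.integrable_decay hL hε' ρ τ)
    fun p => ?_).trans ((H.integral_decay_le_integral_inflow hL hε' hτT ρ).trans
      (H.integral_inflow_le hL hε' (by linarith) hδ.le hκδ τ))
  exact mul_le_mul_of_nonneg_right (mul_le_mul_of_nonneg_right (mul_le_mul_of_nonneg_right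
    (hstep _) (deriv_expNegInvGlue_nonneg _)) (coneCutoff_nonneg _ _ _)) (H.nonneg p)

theorem ae_eq_zero_of_mem_cone (H : IsDissipated T L D d F) (hL : 0 ≤ L) (hε : 0 < ε)
    (hτT : τ < T) (h0 : ∀ δ > 0, ∃ κ > 0, ∀ᵐ t : ℝ, t ∈ Ioo 0 κ →
      ∫⁻ x in Icc (-ρ) ρ, ‖d (t, x)‖ₑ ≤ ENNReal.ofReal δ) :
    ∀ᵐ p : ℝ × ℝ, p.1 ∈ Ioo ε τ → √(1 + p.2 ^ 2) + L * p.1 < ρ → d p = 0 := by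
  filter_upwards [(integral_eq_zero_iff_of_nonneg (H.decay_nonneg ρ ε τ)
    (H.integrable_decay hL hε ρ τ)).1 (H.integral_decay_eq_zero hL hε hτT h0)]
    with p hp ⟨hεp, hpτ⟩ hcone
  have hτp : 0 < τ - p.1 := sub_pos.2 hpτ
  have hstep : 0 < smoothStep ε ε p.1 :=
    Real.smoothTransition.pos_of_pos (div_pos (sub_pos.2 hεp) hε)
  have hdecay : 0 < deriv expNegInvGlue (τ - p.1) := by
    rw [deriv_expNegInvGlue]
    exact mul_pos (by positivity) (expNegInvGlue.pos_of_pos hτp)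
  have hcutoff : 0 < coneCutoff L ρ p := Real.smoothTransition.pos_of_pos (by linarith)
  exact (mul_eq_zero.1 hp).resolve_left (mul_pos (mul_pos hstep hdecay) hcutoff).ne'

theorem ae_eq_zero (H : IsDissipated T L D d F) (hL : 0 ≤ L)
    (h0 : ∀ ρ, Tendsto (fun t => ∫⁻ x in Icc (-ρ) ρ, ‖d (t, x)‖ₑ) (𝓝[>] 0 ⊓ ae volume) (𝓝 0)) :
    ∀ᵐ p : ℝ × ℝ, p ∈ strip T → d p = 0 := by
  have hinitial (ρ δ : ℝ) (hδ : 0 < δ) : ∃ κ > 0, ∀ᵐ t : ℝ, t ∈ Ioo 0 κ →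
      ∫⁻ x in Icc (-ρ) ρ, ‖d (t, x)‖ₑ ≤ ENNReal.ofReal δ := by
    obtain ⟨s, hs, t, ht, hst⟩ :=
      mem_inf_iff_superset.1 ((h0 ρ).eventually_le_const (ENNReal.ofReal_pos.2 hδ))
    obtain ⟨κ, hκ, hκs⟩ := mem_nhdsGT_iff_exists_Ioo_subset.1 hs
    exact ⟨κ, hκ, mem_of_superset ht fun r hr hrκ => hst ⟨hκs hrκ, hr⟩⟩
  have hall (n N : ℕ) := H.ae_eq_zero_of_mem_cone hL (Nat.one_div_pos_of_nat (α := ℝ) (n := n))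
    (sub_lt_self T (Nat.one_div_pos_of_nat (α := ℝ) (n := n))) (hinitial N)
  filter_upwards [ae_all_iff.2 fun n => ae_all_iff.2 (hall n)] with p hp hpT
  obtain ⟨n, hn⟩ := exists_nat_one_div_lt (lt_min hpT.1.1 (sub_pos.2 hpT.1.2))
  obtain ⟨N, hN⟩ := exists_nat_gt (√(1 + p.2 ^ 2) + L * p.1)
  exact hp n N ⟨hn.trans_le (min_le_left _ _), by linarith [hn.trans_le (min_le_right _ _)]⟩ hN

end IsDissipated

end Cone

/-! ### The Cauchy problem -/

section Cauchy

variable {f : ℝ → ℝ} {g u v v' w w' : ℝ × ℝ → ℝ} {T : ℝ} {u₀ : ℝ → ℝ}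

theorem isOpen_strip (T : ℝ) : IsOpen (strip T) := isOpen_Ioo.prod isOpen_univ

theorem strip_subset_strip₀ (T : ℝ) : strip T ⊆ strip₀ T :=
  prod_mono Ioo_subset_Ico_self le_rfl

theorem eventually_ae_slice_of_ae_strip (hT : 0 < T) {P : ℝ × ℝ → Prop}
    (h : ∀ᵐ p ∂volume.restrict (strip T), P p) :
    ∀ᶠ t in 𝓝[>] 0 ⊓ ae volume, ∀ᵐ x, P (t, x) := by
  rw [strip, Measure.volume_eq_prod, ← Measure.prod_restrict, Measure.restrict_univ] at h
  have hslice := (ae_restrict_iff' measurableSet_Ioo).1 (Measure.ae_ae_of_ae_prod h)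
  filter_upwards [mem_inf_of_left (Ioo_mem_nhdsGT hT), mem_inf_of_right hslice] with t ht hP
    using hP ht

namespace IsContinuousCauchySolution

theorem continuous_slice (H : IsContinuousCauchySolution f g T u₀ u) {t : ℝ} (ht : t ∈ Ico 0 T) :
    Continuous fun x => u (t, x) :=
  H.continuousOn.comp_continuous (by fun_prop) fun _ => ⟨ht, mem_univ _⟩

theorem continuous_initial (H : IsContinuousCauchySolution f g T u₀ u) (hT : 0 < T) :
    Continuous u₀ :=
  (H.continuous_slice ⟨le_rfl, hT⟩).congr H.initial

theorem tendsto_slice (H : IsContinuousCauchySolution f g T u₀ u) (hT : 0 < T) (x : ℝ) :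
    Tendsto (fun t => u (t, x)) (𝓝[>] 0) (𝓝 (u₀ x)) := by
  rw [← H.initial]
  refine (H.continuousOn (0, x) ⟨⟨le_rfl, hT⟩, mem_univ _⟩).tendsto.comp
    (tendsto_nhdsWithin_iff.2 ⟨?_, ?_⟩)
  · exact ((Continuous.prodMk_left x).tendsto 0).mono_left nhdsWithin_le_nhds
  · filter_upwards [Ioo_mem_nhdsGT hT] with t ht using ⟨⟨ht.1.le, ht.2⟩, mem_univ _⟩

theorem tendsto_initial (H : IsContinuousCauchySolution f g T u₀ u) (hT : 0 < T) (R : ℝ) :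
    Tendsto (fun t => ∫⁻ x in Icc (-R) R, ‖u (t, x) - u₀ x‖ₑ) (𝓝[>] 0) (𝓝 0) := by
  obtain ⟨M, hM⟩ := H.bounded
  have hlim := tendsto_lintegral_filter_of_dominated_convergence
    (μ := volume.restrict (Icc (-R) R)) (F := fun t x => ‖u (t, x) - u₀ x‖ₑ) (f := fun _ => 0)
    (l := 𝓝[>] (0 : ℝ)) (fun _ => ENNReal.ofReal (M + M)) ?_ ?_ ?_ ?_
  · rwa [lintegral_zero] at hlim
  · filter_upwards [Ioo_mem_nhdsGT hT] with t ht
    exact ((H.continuous_slice ⟨ht.1.le, ht.2⟩).sub (H.continuous_initial hT)).enorm.measurable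
  · filter_upwards [Ioo_mem_nhdsGT hT] with t ht
    refine ae_of_all _ fun x => ?_
    rw [Real.enorm_eq_ofReal_abs, ← H.initial]
    exact ENNReal.ofReal_le_ofReal ((abs_sub _ _).trans
      (add_le_add (hM _ ⟨⟨ht.1.le, ht.2⟩, mem_univ _⟩) (hM _ ⟨⟨le_rfl, hT⟩, mem_univ _⟩)))
  · rw [lintegral_const]
    exact ENNReal.mul_ne_top ENNReal.ofReal_ne_top (by simp)
  · refine ae_of_all _ fun x => ?_
    simpa using ((H.tendsto_slice hT x).sub_const (u₀ x)).enorm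

theorem isKruzkovEntropySolution (H : IsContinuousCauchySolution f g T u₀ u) (hf : Continuous f)
    (hT : 0 < T) : IsKruzkovEntropySolution f g T u₀ u where
  bounded := by
    obtain ⟨M, hM⟩ := H.bounded
    have hmeas := (isOpen_strip T).measurableSet
    exact memLp_top_of_bound (H.solution.continuousOn.aestronglyMeasurable hmeas) M
      (ae_restrict_of_forall_mem hmeas fun p hp => hM p (strip_subset_strip₀ T hp))
  entropy k φ hφ _ := by
    have hΩ := isOpen_strip T
    have hweak := (distribBalance_iff
      (H.solution.locallyIntegrableOn_comp hΩ (F := fun s => |s - k|) (by fun_prop))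
      (H.solution.locallyIntegrableOn_comp hΩ (F := fun s => kruzkovFlux f s k)
        ((continuous_kruzkovFlux hf).comp (Continuous.prodMk_left k)))
      (locallyIntegrableOn_of_memLp_top (H.solution.memLp_sign_mul hΩ k))).1
      (H.solution.distribBalance_kruzkov hΩ hf k) φ hφ
    rw [← hφ.setIntegral_weakIntegrand] at hweak
    exact hweak.ge
  initial := ⟨∅, measure_empty, fun R => by rw [sdiff_empty]; exact H.tendsto_initial hT R⟩

end IsContinuousCauchySolution

namespace IsBoundedEntropySolution

variable {M : ℝ}

theorem exists_isDissipated (Hv : IsBoundedEntropySolution f g (strip T) M v)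
    (Hw : IsBoundedEntropySolution f g (strip T) M w) (hf : LocallyLipschitz f) :
    ∃ L, 0 ≤ L ∧
      IsDissipated T L (M + M) (fun p => |v p - w p|) fun p => kruzkovFlux f (v p) (w p) := by
  obtain ⟨L, hL, hLf⟩ := exists_abs_kruzkovFlux_sub_le hf M
  refine ⟨L, hL, ?_⟩
  exact
    { measurable := (Hv.measurable.sub Hw.measurable).abs
      nonneg := fun p => abs_nonneg _
      le := fun p => (abs_sub _ _).trans (add_le_add (Hv.abs_le p) (Hw.abs_le p))
      measurable_flux := (continuous_kruzkovFlux hf.continuous).measurable.comp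
        (Hv.measurable.prodMk Hw.measurable)
      abs_flux_le := fun p => by
        simpa [kruzkovFlux, abs_sub_comm] using
          hLf (v p) (w p) (v p) (Hv.abs_le p) (Hw.abs_le p) (Hv.abs_le p)
      dissipation := fun ψ hψ hψ0 => Hv.comparison Hw (isOpen_strip T) hf hψ hψ0 }

end IsBoundedEntropySolution

namespace IsKruzkovEntropySolution

theorem exists_normalized (V : IsKruzkovEntropySolution f g T u₀ v)
    (W : IsKruzkovEntropySolution f g T u₀ w) (hg : MemLp g ⊤ (volume.restrict (strip T))) :
    ∃ (g' v' w' : ℝ × ℝ → ℝ) (M : ℝ), v =ᵐ[volume.restrict (strip T)] v' ∧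
      w =ᵐ[volume.restrict (strip T)] w' ∧ IsBoundedEntropySolution f g' (strip T) M v' ∧
      IsBoundedEntropySolution f g' (strip T) M w' := by
  obtain ⟨g', Mg, hg', hg'M, hgg'⟩ := exists_measurable_bounded_ae_eq hg
  obtain ⟨v', Mv, hv', hv'M, hvv'⟩ := exists_measurable_bounded_ae_eq V.bounded
  obtain ⟨w', Mw, hw', hw'M, hww'⟩ := exists_measurable_bounded_ae_eq W.bounded
  have hg'M' p := (hg'M p).trans (le_max_left Mg (max Mv Mw))
  have hv'M' p := (hv'M p).trans ((le_max_left Mv Mw).trans (le_max_right Mg _))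
  have hw'M' p := (hw'M p).trans ((le_max_right Mv Mw).trans (le_max_right Mg _))
  exact ⟨g', v', w', max Mg (max Mv Mw), hvv', hww',
    .of_ae_eq hg' hg'M' hgg' hv' hv'M' hvv' V.entropy,
    .of_ae_eq hg' hg'M' hgg' hw' hw'M' hww' W.entropy⟩

theorem tendsto_initial_of_ae_eq (V : IsKruzkovEntropySolution f g T u₀ v) (hT : 0 < T)
    (hvv' : v =ᵐ[volume.restrict (strip T)] v') (R : ℝ) :
    Tendsto (fun t => ∫⁻ x in Icc (-R) R, ‖v' (t, x) - u₀ x‖ₑ) (𝓝[>] 0 ⊓ ae volume) (𝓝 0) := by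
  obtain ⟨E, hE, hEv⟩ := V.initial
  have hle : 𝓝[>] (0 : ℝ) ⊓ ae volume ≤ 𝓝[Ioi 0 \ E] 0 := by
    rw [sdiff_eq, nhdsWithin_inter']
    exact inf_le_inf_left _ (le_principal_iff.2 (compl_mem_ae_iff.2 hE))
  refine ((hEv R).mono_left hle).congr' ?_
  filter_upwards [eventually_ae_slice_of_ae_strip hT hvv'] with t ht
  exact lintegral_congr_ae (ae_restrict_of_ae (ht.mono fun x hx => by simp only [hx]))

theorem tendsto_lintegral_abs_sub (V : IsKruzkovEntropySolution f g T u₀ v)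
    (W : IsKruzkovEntropySolution f g T u₀ w) (hT : 0 < T) (hu₀ : Measurable u₀)
    (hw' : Measurable w') (hvv' : v =ᵐ[volume.restrict (strip T)] v')
    (hww' : w =ᵐ[volume.restrict (strip T)] w') (R : ℝ) :
    Tendsto (fun t => ∫⁻ x in Icc (-R) R, ‖|v' (t, x) - w' (t, x)|‖ₑ)
      (𝓝[>] 0 ⊓ ae volume) (𝓝 0) := by
  have hsum := (V.tendsto_initial_of_ae_eq hT hvv' R).add (W.tendsto_initial_of_ae_eq hT hww' R)
  rw [add_zero] at hsum
  refine tendsto_of_tendsto_of_tendsto_of_le_of_le tendsto_const_nhds hsum (fun _ => zero_le)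
    fun t => ?_
  have hmeas : Measurable fun x => ‖w' (t, x) - u₀ x‖ₑ :=
    ((hw'.comp measurable_prodMk_left).sub hu₀).enorm
  dsimp only
  rw [← lintegral_add_right _ hmeas]
  refine lintegral_mono fun x => ?_
  rw [Real.enorm_abs, ← sub_sub_sub_cancel_right _ _ (u₀ x)]
  exact enorm_sub_le

theorem ae_eq (V : IsKruzkovEntropySolution f g T u₀ v) (W : IsKruzkovEntropySolution f g T u₀ w)
    (hf : LocallyLipschitz f) (hg : MemLp g ⊤ (volume.restrict (strip T))) (hT : 0 < T)
    (hu₀ : Measurable u₀) : v =ᵐ[volume.restrict (strip T)] w := by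
  obtain ⟨g', v', w', M, hvv', hww', Hv, Hw⟩ := V.exists_normalized W hg
  obtain ⟨L, hL, hdiss⟩ := Hv.exists_isDissipated Hw hf
  have hzero := hdiss.ae_eq_zero hL (V.tendsto_lintegral_abs_sub W hT hu₀ Hw.measurable hvv' hww')
  filter_upwards [hvv', hww', (ae_restrict_iff' (isOpen_strip T).measurableSet).2 hzero]
    with p hv hw hp
  rw [hv, hw, sub_eq_zero.1 (abs_eq_zero.1 hp)]

end IsKruzkovEntropySolution

theorem IsContinuousCauchySolution.eqOn (V : IsContinuousCauchySolution f g T u₀ v)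
    (W : IsContinuousCauchySolution f g T u₀ w) (hvw : v =ᵐ[volume.restrict (strip T)] w) :
    EqOn v w (strip₀ T) := by
  have hstrip := Measure.eqOn_open_of_ae_eq hvw (isOpen_strip T) V.solution.continuousOn
    W.solution.continuousOn
  rintro ⟨t, x⟩ ⟨ht, -⟩
  rcases ht.1.eq_or_lt with rfl | h0
  · rw [V.initial, W.initial]
  · exact hstrip ⟨⟨h0, ht.2⟩, mem_univ _⟩

end Cauchy

theorem lemmaL_general (f : ℝ → ℝ) (hf : ContDiff ℝ 1 f) :
    (∀ Ω : Set (ℝ × ℝ), IsOpen Ω →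
      ∀ g u : ℝ × ℝ → ℝ, IsContinuousDistribSolution f g Ω u →
        (∀ η q : ℝ → ℝ, IsEntropyPair f η q →
          DistribBalance Ω (fun p => η (u p)) (fun p => q (u p))
            (fun p => deriv η (u p) * g p)) ∧
        (∀ k : ℝ,
          DistribBalance Ω (fun p => |u p - k|)
            (fun p => Real.sign (u p - k) * (f (u p) - f k))
            (fun p => Real.sign (u p - k) * g p))) ∧
    (∀ T : ℝ, 0 < T → ∀ (g : ℝ × ℝ → ℝ) (u₀ : ℝ → ℝ) (u : ℝ × ℝ → ℝ),
      IsContinuousCauchySolution f g T u₀ u →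
        IsKruzkovEntropySolution f g T u₀ u ∧
        (∀ v : ℝ × ℝ → ℝ, IsKruzkovEntropySolution f g T u₀ v →
          v =ᵐ[volume.restrict (strip T)] u) ∧
        (∀ v : ℝ × ℝ → ℝ, IsContinuousCauchySolution f g T u₀ v →
          EqOn v u (strip₀ T))) := by
  refine ⟨fun Ω hΩ g u H => ⟨fun η q hηq => H.distribBalance_entropy hΩ hf hηq,
    fun k => H.distribBalance_kruzkov hΩ hf.continuous k⟩, fun T hT g u₀ u H => ?_⟩
  have hentropy {v} (V : IsContinuousCauchySolution f g T u₀ v) :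
      IsKruzkovEntropySolution f g T u₀ v := V.isKruzkovEntropySolution hf.continuous hT
  have hunique (v) (V : IsKruzkovEntropySolution f g T u₀ v) :
      v =ᵐ[volume.restrict (strip T)] u :=
    V.ae_eq (hentropy H) hf.locallyLipschitz H.solution.source hT
      (H.continuous_initial hT).measurable
  exact ⟨hentropy H, hunique, fun v V => V.eqOn H (hunique v (hentropy V))⟩

theorem lemmaL (f : ℝ → ℝ) (hf : ContDiff ℝ 2 f) :
    (∀ Ω : Set (ℝ × ℝ), IsOpen Ω → Ω ⊆ Ioi 0 ×ˢ univ →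
      ∀ g u : ℝ × ℝ → ℝ, IsContinuousDistribSolution f g Ω u →
        (∀ η q : ℝ → ℝ, IsEntropyPair f η q →
          DistribBalance Ω (fun p => η (u p)) (fun p => q (u p))
            (fun p => deriv η (u p) * g p)) ∧
        (∀ k : ℝ,
          DistribBalance Ω (fun p => |u p - k|)
            (fun p => Real.sign (u p - k) * (f (u p) - f k))
            (fun p => Real.sign (u p - k) * g p))) ∧
    (∀ T : ℝ, 0 < T → ∀ (g : ℝ × ℝ → ℝ) (u₀ : ℝ → ℝ) (u : ℝ × ℝ → ℝ),
      IsContinuousCauchySolution f g T u₀ u →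
        IsKruzkovEntropySolution f g T u₀ u ∧
        (∀ v : ℝ × ℝ → ℝ, IsKruzkovEntropySolution f g T u₀ v →
          v =ᵐ[volume.restrict (strip T)] u) ∧
        (∀ v : ℝ × ℝ → ℝ, IsContinuousCauchySolution f g T u₀ v →
          EqOn v u (strip₀ T))) := by
  have h := lemmaL_general f (hf.of_le one_le_two)
  exact ⟨fun Ω hΩ _ => h.1 Ω hΩ, h.2⟩
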